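/- Plane graphs are counted up to isomorphism of plane graphs on the sphere, i.e. up to graph isomorphisms that preserve, or all reverse, the cyclic orders in which the edges leave the vertices (so the choice of the exterior face is immaterial and reflections are allowed). Consider the following types of plane graphs; a subdivider is a vertex of degree 2. Type 1: a 3-prism with any number (possibly zero) of subdividers placed on each of the three edges joining the two triangles. Type 2: a tetrahedral graph $K_4$, drawn as a point joined to the corners of a surrounding triangle, with at least one subdivider placed on each of the three edges joining the point to the triangle. Type 3: a subdivided complete bipartite graph $K_{2,3}$, i.e. two vertices $\alpha_0,\alpha_1$ joined by three internally disjoint paths, where each of the three paths has at least two inner vertices. Type 4: a wheel on $n\ge 4$ vertices (a hub inside a rim cycle of length $n-1$) with radial edges removed (possibly none, but not all), such that the resulting plane graph does not have all its vertices on one face. Type 5: a simple cycle together with (possibly no) pairwise noncrossing diagonals drawn in its interior. For every $n\ge 3$: (1) the number of $n$-vertex graphs of type 1 is $\left\lfloor \frac{(n-3)^2+6}{12}\right\rfloor$; (2) the number of $n$-vertex graphs of type 2 is $\left\lfloor \frac{(n-4)^2+6}{12}\right\rfloor$; (3) the number of $n$-vertex graphs of type 3 is $\left\lfloor \frac{(n-5)^2+6}{12}\right\rfloor$;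 (4) the number of $n$-vertex graphs of type 4 is $$\frac14\bigl(((n-1) \bmod 2)+3\bigr)2^{\lfloor (n-1)/2\rfloor}+\frac{1}{2(n-1)}\sum_{d\mid n-1}\varphi(d)\,2^{(n-1)/d}-3,$$ where $\varphi$ is Euler's function; (5) the number of $n$-vertex graphs of type 5 equals the number of dissections of a regular $n$-gon by nonintersecting diagonals, counted up to rotations and reflections of the polygon; for $n=3,4,\dots,14$ these numbers are $1, 2, 3, 9, 20, 75, 262, 1117, 4783, 21971, 102249, 489077$. -/

import Mathlib

/-- A graph drawn in an oriented surface, recorded by its rotation system: at every vertex `v` the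
neighbours of `v` are cyclically ordered, `cyc v a b c` saying that `a`, `b`, `c` are three
different neighbours of `v` met in this order when one turns counterclockwise around `v`.
A connected plane graph is determined by its rotation system up to orientation preserving
homeomorphisms of the sphere. -/
@[ext]
structure EmbeddedGraph (V : Type) where
  graph : SimpleGraph V
  cyc : V → V → V → V → Prop
  cyc_adj : ∀ v a b c, cyc v a b c → graph.Adj v a ∧ graph.Adj v b ∧ graph.Adj v c
  cyc_rotate : ∀ v a b c, cyc v a b c → cyc v b c a
  cyc_asymm : ∀ v a b c, cyc v a b c → ¬ cyc v c b a
  cyc_trans : ∀ v a b c d, cyc v a b c → cyc v a c d → cyc v a b d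
  cyc_total : ∀ v a b c, graph.Adj v a → graph.Adj v b → graph.Adj v c →
    a ≠ b → b ≠ c → a ≠ c → cyc v a b c ∨ cyc v c b a

namespace EmbeddedGraph

/-- Isomorphism of drawn graphs: an isomorphism of the graphs that preserves all the cyclic orders,
or that reverses all of them (a reflection). -/
def Iso {V W : Type} (D : EmbeddedGraph V) (E : EmbeddedGraph W) : Prop :=
  ∃ f : D.graph ≃g E.graph,
    (∀ v a b c, D.cyc v a b c ↔ E.cyc (f v) (f a) (f b) (f c)) ∨
    (∀ v a b c, D.cyc v a b c ↔ E.cyc (f v) (f c) (f b) (f a))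

theorem Iso.refl {V : Type} (D : EmbeddedGraph V) : Iso D D :=
  ⟨RelIso.refl _, Or.inl fun _ _ _ _ => Iff.rfl⟩

theorem Iso.symm {V W : Type} {D : EmbeddedGraph V} {E : EmbeddedGraph W} (h : Iso D E) :
    Iso E D := by
  obtain ⟨f, h | h⟩ := h
  · exact ⟨f.symm, Or.inl fun v a b c => by simp [h]⟩
  · exact ⟨f.symm, Or.inr fun v a b c => by simp [h]⟩

theorem Iso.trans {U V W : Type} {C : EmbeddedGraph U} {D : EmbeddedGraph V} {E : EmbeddedGraph W}
    (h : Iso C D) (h' : Iso D E) : Iso C E := by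
  obtain ⟨f, h | h⟩ := h <;> obtain ⟨g, h' | h'⟩ := h'
  · exact ⟨f.trans g, Or.inl fun v a b c => by simp [h, h']⟩
  · exact ⟨f.trans g, Or.inr fun v a b c => by simp [h, h']⟩
  · exact ⟨f.trans g, Or.inr fun v a b c => by simp [h, h']⟩
  · exact ⟨f.trans g, Or.inl fun v a b c => by simp [h, h']⟩

/-- The isomorphism relation on drawn graphs with vertex set `Fin n`. -/
def isoSetoid (n : ℕ) : Setoid (EmbeddedGraph (Fin n)) where
  r D E := Iso D E
  iseqv := ⟨Iso.refl, Iso.symm, Iso.trans⟩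

/-- The number of isomorphism classes of drawn graphs with `n` vertices that have the property
`P`. -/
noncomputable def countUpToIso (n : ℕ) (P : EmbeddedGraph (Fin n) → Prop) : ℕ :=
  Set.ncard {x : Quotient (isoSetoid n) | ∃ D, P D ∧ Quotient.mk (isoSetoid n) D = x}

/-- The drawing of `G` in which the edges leaving `v` are met, counterclockwise from some starting
direction, in the order of increasing `angle v`. -/
def ofAngle {V : Type} (G : SimpleGraph V) (angle : V → V → ℕ)
    (inj : ∀ v a b, G.Adj v a → G.Adj v b → angle v a = angle v b → a = b) : EmbeddedGraph V where
  graph := G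
  cyc v a b c := (G.Adj v a ∧ G.Adj v b ∧ G.Adj v c) ∧
    ((angle v a < angle v b ∧ angle v b < angle v c) ∨
      (angle v b < angle v c ∧ angle v c < angle v a) ∨
      (angle v c < angle v a ∧ angle v a < angle v b))
  cyc_adj _ _ _ _ h := h.1
  cyc_rotate := by
    rintro v a b c ⟨⟨ha, hb, hc⟩, h⟩
    exact ⟨⟨hb, hc, ha⟩, by omega⟩
  cyc_asymm := by
    rintro v a b c ⟨_, h⟩ ⟨_, h'⟩
    omega
  cyc_trans := by
    rintro v a b c d ⟨⟨ha, hb, hc⟩, h⟩ ⟨⟨_, _, hd⟩, h'⟩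
    exact ⟨⟨ha, hb, hd⟩, by omega⟩
  cyc_total := by
    intro v a b c ha hb hc hab hbc hac
    have h1 : angle v a ≠ angle v b := fun h => hab (inj v a b ha hb h)
    have h2 : angle v b ≠ angle v c := fun h => hbc (inj v b c hb hc h)
    have h3 : angle v a ≠ angle v c := fun h => hac (inj v a c ha hc h)
    by_cases h : (angle v a < angle v b ∧ angle v b < angle v c) ∨
      (angle v b < angle v c ∧ angle v c < angle v a) ∨
      (angle v c < angle v a ∧ angle v a < angle v b)
    · exact Or.inl ⟨⟨ha, hb, hc⟩, h⟩
    · exact Or.inr ⟨⟨hc, hb, ha⟩, by omega⟩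

/-- `b` is the neighbour of `v` that follows `a` in the cyclic order at `v`
(it is `a` itself if `v` has degree 1). -/
def IsNext {V : Type} (D : EmbeddedGraph V) (v a b : V) : Prop :=
  D.graph.Adj v a ∧ D.graph.Adj v b ∧ (∀ c, ¬ D.cyc v a c b) ∧
    (b = a → ∀ c, D.graph.Adj v c → c = a)

/-- One step along the boundary of a face: from the directed edge `(u, v)` to `(v, w)`, where `w`
follows `u` in the cyclic order at `v`. -/
def FaceStep {V : Type} (D : EmbeddedGraph V) (d e : V × V) : Prop :=
  e.1 = d.2 ∧ D.IsNext d.2 d.1 e.2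

/-- Some face has all the vertices on its boundary. (The graph is meant to be connected and to have
an edge.) -/
def IsOuterplane {V : Type} (D : EmbeddedGraph V) : Prop :=
  ∃ d : V × V, D.graph.Adj d.1 d.2 ∧
    ∀ v, ∃ w, Relation.ReflTransGen D.FaceStep d (v, w)

end EmbeddedGraph

/-! ### Subdivided prisms -/

/-- The 3-prism with `s i` subdividing vertices on the `i`-th edge between the two triangles.
Column `i` is the path `(i, 0), (i, 1), …, (i, s i + 1)`; the bottom ends `(i, 0)` form a triangle,
and so do the top ends `(i, s i + 1)`. -/
def prismGraph (s : Fin 3 → ℕ) : SimpleGraph (Σ i : Fin 3, Fin (s i + 2)) :=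
  SimpleGraph.fromRel fun v w =>
    (v.1 = w.1 ∧ v.2.val + 1 = w.2.val) ∨
    (v.1 ≠ w.1 ∧ v.2.val = 0 ∧ w.2.val = 0) ∨
    (v.1 ≠ w.1 ∧ v.2.val = s v.1 + 1 ∧ w.2.val = s w.1 + 1)

/-- The plane drawing of the subdivided prism with the bottom triangle (counterclockwise) in the
middle, the top triangle around it, and the columns as radial paths. -/
def prismAngle (s : Fin 3 → ℕ) (v w : Σ i : Fin 3, Fin (s i + 2)) : ℕ :=
  if v.2.val = 0 then (w.1 - v.1).val
  else if v.2.val = s v.1 + 1 then (v.1 - w.1).val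
  else w.2.val

theorem prismAngle_inj (s : Fin 3 → ℕ) (v a b : Σ i : Fin 3, Fin (s i + 2))
    (ha : (prismGraph s).Adj v a) (hb : (prismGraph s).Adj v b)
    (h : prismAngle s v a = prismAngle s v b) : a = b := by
  obtain ⟨v, x⟩ := v
  obtain ⟨a, y⟩ := a
  obtain ⟨b, z⟩ := b
  simp only [prismGraph, SimpleGraph.fromRel_adj, prismAngle] at ha hb h
  have hab : a = b ∧ y.val = z.val := by
    replace ha := ha.2
    replace hb := hb.2
    by_cases hva : v = a
    · by_cases hvb : v = b
      · subst hva
        subst hvb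
        simp only [ne_eq, not_true_eq_false, false_and, or_false, false_or, true_and, not_false_eq_true, sub_self, Fin.val_zero] at ha hb h
        refine ⟨rfl, ?_⟩
        have := x.2
        have := y.2
        have := z.2
        split_ifs at h <;> omega
      · exfalso
        subst hva
        simp only [ne_eq, not_true_eq_false, false_and, or_false, false_or, true_and, not_false_eq_true, sub_self, Fin.val_zero, hvb, Ne.symm hvb] at ha hb h
        have h1 : v - b ≠ 0 := sub_ne_zero.2 hvb
        have h2 : b - v ≠ 0 := sub_ne_zero.2 (Ne.symm hvb)
        have h3 : (v - b).val ≠ 0 := fun h => h1 (Fin.ext h)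
        have h4 : (b - v).val ≠ 0 := fun h => h2 (Fin.ext h)
        split_ifs at h <;> omega
    · by_cases hvb : v = b
      · exfalso
        subst hvb
        simp only [ne_eq, not_true_eq_false, false_and, or_false, false_or, true_and, not_false_eq_true, sub_self, Fin.val_zero, hva, Ne.symm hva] at ha hb h
        have h1 : v - a ≠ 0 := sub_ne_zero.2 hva
        have h2 : a - v ≠ 0 := sub_ne_zero.2 (Ne.symm hva)
        have h3 : (v - a).val ≠ 0 := fun h => h1 (Fin.ext h)
        have h4 : (a - v).val ≠ 0 := fun h => h2 (Fin.ext h)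
        split_ifs at h <;> omega
      · simp only [ne_eq, not_true_eq_false, false_and, or_false, false_or, true_and, not_false_eq_true, sub_self, Fin.val_zero, hva, hvb, Ne.symm hva, Ne.symm hvb] at ha hb
        have hab : a = b := by
          split_ifs at h
          · simpa using Fin.ext h
          · simpa using Fin.ext h
          · omega
        subst hab
        exact ⟨rfl, by omega⟩
  obtain ⟨rfl, h2⟩ := hab
  rw [Fin.ext h2]

/-- The subdivided 3-prism as a plane graph. -/
def prismDrawing (s : Fin 3 → ℕ) : EmbeddedGraph (Σ i : Fin 3, Fin (s i + 2)) :=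
  EmbeddedGraph.ofAngle (prismGraph s) (prismAngle s) (prismAngle_inj s)

/-! ### Subdivided tetrahedral graphs -/

/-- The graph `K₄` with `s i` subdividing vertices on the `i`-th edge from the point `none` to the
triangle. Column `i` is the path `none, (i, 0), …, (i, s i)`, and the ends `(i, s i)` form the
triangle. -/
def tetraGraph (s : Fin 3 → ℕ) : SimpleGraph (Option (Σ i : Fin 3, Fin (s i + 1))) :=
  SimpleGraph.fromRel fun v w =>
    match v, w with
    | none, some w => w.2.val = 0
    | some v, some w =>
        (v.1 = w.1 ∧ v.2.val + 1 = w.2.val) ∨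
        (v.1 ≠ w.1 ∧ v.2.val = s v.1 ∧ w.2.val = s w.1)
    | _, _ => False

/-- The plane drawing of the subdivided `K₄` with the point `none` in the middle, the triangle
(counterclockwise) around it, and the columns as radial paths. -/
def tetraAngle (s : Fin 3 → ℕ) (v w : Option (Σ i : Fin 3, Fin (s i + 1))) : ℕ :=
  match v, w with
  | none, some w => w.1.val
  | some v, some w => if v.2.val = s v.1 then (v.1 - w.1).val else w.2.val + 1
  | _, none => 0

theorem tetraAngle_inj (s : Fin 3 → ℕ) (v a b : Option (Σ i : Fin 3, Fin (s i + 1)))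
    (ha : (tetraGraph s).Adj v a) (hb : (tetraGraph s).Adj v b)
    (h : tetraAngle s v a = tetraAngle s v b) : a = b := by
  have key : ∀ u v : Fin 3, u ≠ v → (u - v).val ≠ 0 :=
    fun u v huv h => sub_ne_zero.2 huv (Fin.ext h)
  simp only [tetraGraph, SimpleGraph.fromRel_adj] at ha hb
  replace ha := ha.2
  replace hb := hb.2
  rcases v with _ | ⟨v, x⟩ <;> rcases a with _ | ⟨a, y⟩ <;> rcases b with _ | ⟨b, z⟩ <;>
    simp only [tetraAngle, or_false, false_or, or_self] at ha hb h
  · have h1 : a = b := Fin.ext h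
    subst h1
    rw [Fin.ext (ha.trans hb.symm)]
  · rfl
  · exfalso
    by_cases hvb : v = b
    · subst hvb
      simp only [ne_eq, not_true_eq_false, false_and, or_false, false_or, true_and, not_false_eq_true, sub_self, Fin.val_zero] at hb h
      have := x.2
      have := z.2
      split_ifs at h
      omega
    · have := key v b hvb
      simp only [ne_eq, not_true_eq_false, false_and, or_false, false_or, true_and, not_false_eq_true, sub_self, Fin.val_zero, hvb, Ne.symm hvb] at hb h
      split_ifs at h
      omega
  · exfalso
    by_cases hva : v = a
    · subst hva
      simp only [ne_eq, not_true_eq_false, false_and, or_false, false_or, true_and, not_false_eq_true, sub_self, Fin.val_zero] at ha h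
      have := x.2
      have := y.2
      split_ifs at h
      omega
    · have := key v a hva
      simp only [ne_eq, not_true_eq_false, false_and, or_false, false_or, true_and, not_false_eq_true, sub_self, Fin.val_zero, hva, Ne.symm hva] at ha h
      split_ifs at h
      omega
  · have hab : a = b ∧ y.val = z.val := by
      by_cases hva : v = a
      · by_cases hvb : v = b
        · subst hva
          subst hvb
          simp only [ne_eq, not_true_eq_false, false_and, or_false, false_or, true_and, not_false_eq_true, sub_self, Fin.val_zero] at ha hb h
          refine ⟨rfl, ?_⟩
          have := x.2
          have := y.2
          have := z.2
          split_ifs at h <;> omega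
        · exfalso
          have := key v b hvb
          subst hva
          simp only [ne_eq, not_true_eq_false, false_and, or_false, false_or, true_and, not_false_eq_true, sub_self, Fin.val_zero, hvb, Ne.symm hvb] at ha hb h
          split_ifs at h <;> omega
      · by_cases hvb : v = b
        · exfalso
          have := key v a hva
          subst hvb
          simp only [ne_eq, not_true_eq_false, false_and, or_false, false_or, true_and, not_false_eq_true, sub_self, Fin.val_zero, hva, Ne.symm hva] at ha hb h
          split_ifs at h <;> omega
        · simp only [ne_eq, not_true_eq_false, false_and, or_false, false_or, true_and, not_false_eq_true, sub_self, Fin.val_zero, hva, hvb, Ne.symm hva, Ne.symm hvb] at ha hb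
          have hab : a = b := by
            split_ifs at h
            · simpa using Fin.ext h
            · omega
          subst hab
          exact ⟨rfl, by omega⟩
    obtain ⟨rfl, h2⟩ := hab
    rw [Fin.ext h2]

/-- The subdivided tetrahedral graph as a plane graph. -/
def tetraDrawing (s : Fin 3 → ℕ) : EmbeddedGraph (Option (Σ i : Fin 3, Fin (s i + 1))) :=
  EmbeddedGraph.ofAngle (tetraGraph s) (tetraAngle s) (tetraAngle_inj s)

/-! ### Subdivided complete bipartite graphs `K_{2,3}` -/

/-- Two vertices `α₀ = inl 0` and `α₁ = inl 1` joined by three internally disjoint paths, the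
`i`-th path having the inner vertices `(i, 0), …, (i, s i - 1)`. For `s i ≥ 1` these are the
graphs that arise from `K_{2,3}` by subdividing edges. -/
def thetaGraph (s : Fin 3 → ℕ) : SimpleGraph (Fin 2 ⊕ (Σ i : Fin 3, Fin (s i))) :=
  SimpleGraph.fromRel fun v w =>
    match v, w with
    | Sum.inl k, Sum.inr w => (k = 0 ∧ w.2.val = 0) ∨ (k = 1 ∧ w.2.val + 1 = s w.1)
    | Sum.inr v, Sum.inr w => v.1 = w.1 ∧ v.2.val + 1 = w.2.val
    | _, _ => False

/-- The plane drawing: the three paths leave `α₀` counterclockwise in the order `0, 1, 2`, and hence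
arrive at `α₁` counterclockwise in the order `2, 1, 0`. -/
def thetaAngle (s : Fin 3 → ℕ) (v w : Fin 2 ⊕ (Σ i : Fin 3, Fin (s i))) : ℕ :=
  match v, w with
  | Sum.inl k, Sum.inr w => if k = 0 then w.1.val else 2 - w.1.val
  | Sum.inr _, Sum.inr w => w.2.val + 1
  | Sum.inr v, Sum.inl k => if k = 0 then 0 else s v.1 + 1
  | Sum.inl _, Sum.inl _ => 0

theorem thetaAngle_inj (s : Fin 3 → ℕ) (v a b : Fin 2 ⊕ (Σ i : Fin 3, Fin (s i)))
    (ha : (thetaGraph s).Adj v a) (hb : (thetaGraph s).Adj v b)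
    (h : thetaAngle s v a = thetaAngle s v b) : a = b := by
  simp only [thetaGraph, SimpleGraph.fromRel_adj] at ha hb
  replace ha := ha.2
  replace hb := hb.2
  rcases v with k | ⟨v, x⟩ <;> rcases a with a | ⟨a, y⟩ <;> rcases b with b | ⟨b, z⟩ <;>
    simp only [thetaAngle, or_false, false_or, or_self] at ha hb h
  · have hab : a = b := by
      split_ifs at h
      · exact Fin.ext h
      · exact Fin.ext (by omega)
    subst hab
    have : y = z := by
      apply Fin.ext
      rcases ha with ha | ha <;> rcases hb with hb | hb
      · omega
      · exact absurd (ha.1.symm.trans hb.1) (by decide)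
      · exact absurd (ha.1.symm.trans hb.1) (by decide)
      · omega
    rw [this]
  · fin_cases a <;> fin_cases b <;> simp at h ⊢
  · exfalso
    rcases hb with ⟨rfl, _⟩ | ⟨rfl, _⟩ <;> have := z.2 <;> split_ifs at h <;> omega
  · exfalso
    rcases ha with ⟨rfl, _⟩ | ⟨rfl, _⟩ <;> have := y.2 <;> split_ifs at h <;> omega
  · have h1 : v = a := by
      rcases ha with ⟨h, _⟩ | ⟨h, _⟩
      · exact h
      · exact h.symm
    have h2 : v = b := by
      rcases hb with ⟨h, _⟩ | ⟨h, _⟩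
      · exact h
      · exact h.symm
    subst h1
    subst h2
    rw [Fin.ext (show y.val = z.val by omega)]

/-- The subdivided `K_{2,3}` as a plane graph. -/
def thetaDrawing (s : Fin 3 → ℕ) : EmbeddedGraph (Fin 2 ⊕ (Σ i : Fin 3, Fin (s i))) :=
  EmbeddedGraph.ofAngle (thetaGraph s) (thetaAngle s) (thetaAngle_inj s)

/-! ### Wheels with radial edges removed -/

/-- The wheel with hub `none` and `m` rim vertices `some i`, in which only the radial edges to the
rim vertices in `R` are kept. -/
def wheelGraph (m : ℕ) [NeZero m] (R : Set (Fin m)) : SimpleGraph (Option (Fin m)) :=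
  SimpleGraph.fromRel fun v w =>
    match v, w with
    | none, some i => i ∈ R
    | some i, some j => j = i + 1
    | _, _ => False

/-- The plane drawing with the rim running counterclockwise around the hub: the rim vertex `i`
meets counterclockwise the edges to `i + 1`, to the hub, and to `i - 1`. -/
def wheelAngle (m : ℕ) [NeZero m] (v w : Option (Fin m)) : ℕ :=
  match v, w with
  | none, some i => i.val
  | some i, some j => if j = i + 1 then 0 else 2
  | some _, none => 1
  | none, none => 0

theorem wheelAngle_inj (m : ℕ) [NeZero m] (R : Set (Fin m)) (v a b : Option (Fin m))
    (ha : (wheelGraph m R).Adj v a) (hb : (wheelGraph m R).Adj v b)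
    (h : wheelAngle m v a = wheelAngle m v b) : a = b := by
  simp only [wheelGraph, SimpleGraph.fromRel_adj] at ha hb
  replace ha := ha.2
  replace hb := hb.2
  rcases v with _ | v <;> rcases a with _ | a <;> rcases b with _ | b <;>
    simp only [wheelAngle, or_false, false_or, or_self] at ha hb h
  · rw [Fin.ext h]
  · rfl
  · split_ifs at h <;> omega
  · split_ifs at h <;> omega
  · split_ifs at h with h1 h2 h2
    · rw [h1, h2]
    · have h3 : v = a + 1 := ha.resolve_left h1
      have h4 : v = b + 1 := hb.resolve_left h2
      rw [add_right_cancel (h3.symm.trans h4)]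

/-- The wheel with some radial edges removed as a plane graph. -/
def wheelDrawing (m : ℕ) [NeZero m] (R : Set (Fin m)) : EmbeddedGraph (Option (Fin m)) :=
  EmbeddedGraph.ofAngle (wheelGraph m R) (wheelAngle m) (wheelAngle_inj m R)

/-! ### Polygons with diagonals -/

/-- `G` consists of the sides of the convex `n`-gon with the vertices `0, …, n - 1` in cyclic order
and of diagonals no two of which cross. -/
def IsDissection {n : ℕ} [NeZero n] (G : SimpleGraph (Fin n)) : Prop :=
  (∀ i : Fin n, G.Adj i (i + 1)) ∧
  ∀ a b c d : Fin n, a < b → b < c → c < d → ¬ (G.Adj a c ∧ G.Adj b d)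

/-- The drawing of `G` with the vertices in convex position and straight edges: seen from the vertex
`i`, the other vertices occur counterclockwise in the order `i + 1, i + 2, …, i - 1`. -/
def polygonDrawing {n : ℕ} [NeZero n] (G : SimpleGraph (Fin n)) : EmbeddedGraph (Fin n) :=
  EmbeddedGraph.ofAngle G (fun i j => (j - i).val) fun _ _ _ _ _ h => sub_left_injective (Fin.ext h)

/-- Two dissections of the `n`-gon are equivalent if a rotation or a reflection of the polygon takes
one to the other. -/
def dissectionSetoid (n : ℕ) [NeZero n] :
    Setoid {G : SimpleGraph (Fin n) // IsDissection G} where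
  r G H := ∃ t : Fin n,
    (∀ i j, G.1.Adj i j ↔ H.1.Adj (i + t) (j + t)) ∨
    (∀ i j, G.1.Adj i j ↔ H.1.Adj (t - i) (t - j))
  iseqv := by
    refine ⟨fun G => ⟨0, Or.inl (by simp)⟩, ?_, ?_⟩
    · rintro G H ⟨t, h | h⟩
      · exact ⟨-t, Or.inl fun i j => by simp [h]⟩
      · exact ⟨t, Or.inr fun i j => by simp [h]⟩
    · rintro G H K ⟨t, h | h⟩ ⟨u, h' | h'⟩
      · exact ⟨t + u, Or.inl fun i j => by simp [h, h', add_assoc]⟩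
      · exact ⟨u - t, Or.inr fun i j => by
          rw [h, h', sub_sub, sub_sub, add_comm t i, add_comm t j]⟩
      · exact ⟨t + u, Or.inr fun i j => by
          rw [h, h', sub_add_eq_add_sub, sub_add_eq_add_sub]⟩
      · exact ⟨u - t, Or.inl fun i j => by
          rw [h, h', sub_sub_eq_add_sub, sub_sub_eq_add_sub, add_sub_right_comm,
            add_sub_right_comm, add_comm i, add_comm j]⟩

/-- The number of dissections of the `n`-gon by nonintersecting diagonals, up to rotations and
reflections. -/
noncomputable def dissectionCount (n : ℕ) [NeZero n] : ℕ :=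
  Nat.card (Quotient (dissectionSetoid n))

/-! ### The five types -/

/-- Type 1: the subdivided 3-prisms. -/
def IsType1 {V : Type} (D : EmbeddedGraph V) : Prop :=
  ∃ s : Fin 3 → ℕ, D.Iso (prismDrawing s)

/-- Type 2: the subdivided tetrahedral graphs, each edge from the point to the triangle having at
least one subdivider. -/
def IsType2 {V : Type} (D : EmbeddedGraph V) : Prop :=
  ∃ s : Fin 3 → ℕ, (∀ i, 1 ≤ s i) ∧ D.Iso (tetraDrawing s)

/-- Type 3: the subdivided complete bipartite graphs `K_{2,3}`, each of the three paths having at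
least two inner vertices. -/
def IsType3 {V : Type} (D : EmbeddedGraph V) : Prop :=
  ∃ s : Fin 3 → ℕ, (∀ i, 2 ≤ s i) ∧ D.Iso (thetaDrawing s)

/-- Type 4: the wheels with at least four vertices (three on the rim), with radial edges removed
leaving a non-outerplanar graph. At least one radius is kept: otherwise the graph is a cycle with
an isolated vertex inside, which lies with the whole rim on the inner face. -/
def IsType4 {V : Type} (D : EmbeddedGraph V) : Prop :=
  ∃ (k : ℕ) (R : Set (Fin (k + 3))), R.Nonempty ∧ ¬ (wheelDrawing (k + 3) R).IsOuterplane ∧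
    D.Iso (wheelDrawing (k + 3) R)

/-- Type 5: a simple cycle with interior diagonals leading to a plane graph. -/
def IsType5 {V : Type} (D : EmbeddedGraph V) : Prop :=
  ∃ (k : ℕ) (G : SimpleGraph (Fin (k + 3))), IsDissection G ∧ D.Iso (polygonDrawing G)

/-! For each type the drawings are put into a parametrized family, and the isomorphism relation is
expressed on the parameters; the number of isomorphism classes is then a number of orbits
(`EmbeddedGraph.countUpToIso_eq_card_quotient`). In every case an isomorphism of the abstract graphs
already forces the relation on the parameters, and conversely related parameters give drawings that
agree up to a rotation or a reflection.

Types 1 to 3 are given by three column lengths. The length of a column is the number of degree-two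
vertices that follow one another between two branch vertices, which is a graph invariant, and every
permutation of three columns is a rotation or a reflection. So one counts multisets of three natural
numbers with sum `n - 6`, `n - 7`, `n - 8`, and the number of partitions of `N` into at most three
parts is `((N + 3) ^ 2 + 6) / 12` rounded down (`sum_sorted_triples`).

Type 4 is given by the set of rim vertices with a radius. A tour of the faces shows that the drawing
is outerplane exactly if this nonempty set lies in a side of the rim
(`wheelDrawing_isOuterplane_iff`). Isomorphism is dihedral equivalence (`wheelDrawing_iso_iff`), so
the count is the number of two-coloured bracelets with `n - 1` beads, found by Burnside's lemma,
minus the three classes of the empty set, a point and a side.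

For type 5 the sides of the polygon are exactly the edges whose two ends do not separate the graph,
so isomorphisms are dihedral symmetries (`polygonDrawing_iso_iff`). The numerical values again come
from Burnside's lemma: the identity contributes a little Schröder number, obtained from a recursion,
and for the other symmetries the invariant noncrossing sets of diagonals are counted by a verified
branching algorithm (`countInvariant_eq`). -/

/-! ### Counting drawings up to isomorphism -/

namespace EmbeddedGraph

/-- The drawing with its vertices renamed by `e`. -/
def transport {V W : Type} (e : V ≃ W) (D : EmbeddedGraph V) : EmbeddedGraph W where
  graph := D.graph.comap e.symm
  cyc v a b c := D.cyc (e.symm v) (e.symm a) (e.symm b) (e.symm c)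
  cyc_adj _ _ _ _ h := D.cyc_adj _ _ _ _ h
  cyc_rotate _ _ _ _ h := D.cyc_rotate _ _ _ _ h
  cyc_asymm _ _ _ _ h := D.cyc_asymm _ _ _ _ h
  cyc_trans _ _ _ _ _ h h' := D.cyc_trans _ _ _ _ _ h h'
  cyc_total _ _ _ _ ha hb hc hab hbc hac :=
    D.cyc_total _ _ _ _ ha hb hc (e.symm.injective.ne hab) (e.symm.injective.ne hbc)
      (e.symm.injective.ne hac)

theorem iso_transport {V W : Type} (e : V ≃ W) (D : EmbeddedGraph V) : Iso D (D.transport e) :=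
  ⟨⟨e, by simp [transport]⟩, Or.inl fun v a b c => by
    change _ ↔ D.cyc (e.symm (e v)) (e.symm (e a)) (e.symm (e b)) (e.symm (e c))
    simp⟩

theorem Iso.nonempty_equiv {V W : Type} {D : EmbeddedGraph V} {E : EmbeddedGraph W}
    (h : Iso D E) : Nonempty (V ≃ W) := by
  obtain ⟨f, _⟩ := h
  exact ⟨f.toEquiv⟩

/-- If the drawings with property `P` are represented by a family of drawings whose isomorphism
relation is `r`, then their number up to isomorphism is the number of classes of `r`. -/
theorem countUpToIso_eq_card_quotient {n : ℕ} {P : EmbeddedGraph (Fin n) → Prop} {X : Type}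
    (r : Setoid X) {V : X → Type} (Dr : ∀ x, EmbeddedGraph (V x))
    (hV : ∀ x, Nonempty (V x ≃ Fin n)) (hP : ∀ D, P D ↔ ∃ x, D.Iso (Dr x))
    (hr : ∀ x y, (Dr x).Iso (Dr y) ↔ r x y) :
    countUpToIso n P = Nat.card (Quotient r) := by
  -- Any numbering of the vertices will do, since a renamed drawing is isomorphic to the original
  -- one.
  let e := fun x => (hV x).some
  let φ : Quotient r → Quotient (isoSetoid n) :=
    Quotient.lift (fun x => Quotient.mk (isoSetoid n) ((Dr x).transport (e x))) fun x y h =>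
      Quotient.sound (s := isoSetoid n) <|
        ((iso_transport _ _).symm.trans ((hr x y).2 h)).trans (iso_transport _ _)
  have hφ : Function.Injective φ := by
    intro x y
    refine Quotient.inductionOn₂ x y fun x y h => Quotient.sound ((hr x y).1 ?_)
    have h' : Iso ((Dr x).transport (e x)) ((Dr y).transport (e y)) :=
      Quotient.exact (s := isoSetoid n) h
    exact ((iso_transport _ _).trans h').trans (iso_transport _ _).symm
  rw [← Set.ncard_range_of_injective hφ, countUpToIso]
  congr 1
  ext q
  constructor
  · rintro ⟨D, hD, rfl⟩
    obtain ⟨x, hx⟩ := (hP D).1 hD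
    exact ⟨Quotient.mk r x,
      Quotient.sound (s := isoSetoid n) ((hx.trans (iso_transport _ _)).symm)⟩
  · rintro ⟨x, rfl⟩
    refine Quotient.inductionOn x fun x => ?_
    exact ⟨_, (hP _).2 ⟨x, (iso_transport _ _).symm⟩, rfl⟩

end EmbeddedGraph

/-! ### Cyclic orders given by angles -/

/-- The numbers `x`, `y`, `z` are in cyclic order. -/
def CycLt (x y z : ℕ) : Prop :=
  (x < y ∧ y < z) ∨ (y < z ∧ z < x) ∨ (z < x ∧ x < y)

instance (x y z : ℕ) : Decidable (CycLt x y z) := by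
  unfold CycLt
  infer_instance

/-- Only the cyclic comparison of the angles of neighbours matters, so the angles themselves may be
shifted or negated by `f`. -/
theorem EmbeddedGraph.iso_ofAngle_of_forall {V W : Type} {G : SimpleGraph V} {H : SimpleGraph W}
    {α : V → V → ℕ} {β : W → W → ℕ}
    {hα : ∀ v a b, G.Adj v a → G.Adj v b → α v a = α v b → a = b}
    {hβ : ∀ v a b, H.Adj v a → H.Adj v b → β v a = β v b → a = b} (f : G ≃g H)
    (h : (∀ v a b c, G.Adj v a → G.Adj v b → G.Adj v c →
        (CycLt (α v a) (α v b) (α v c) ↔ CycLt (β (f v) (f a)) (β (f v) (f b)) (β (f v) (f c)))) ∨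
      (∀ v a b c, G.Adj v a → G.Adj v b → G.Adj v c →
        (CycLt (α v a) (α v b) (α v c) ↔ CycLt (β (f v) (f c)) (β (f v) (f b)) (β (f v) (f a))))) :
    (EmbeddedGraph.ofAngle G α hα).Iso (EmbeddedGraph.ofAngle H β hβ) := by
  have key : ∀ v a b c, (G.Adj v a ∧ G.Adj v b ∧ G.Adj v c) ↔
      (H.Adj (f v) (f a) ∧ H.Adj (f v) (f b) ∧ H.Adj (f v) (f c)) := fun v a b c => by
    simp only [f.map_adj_iff]
  have and_congr_ctx : ∀ {p q r s p' q' : Prop}, ((p ∧ q ∧ r) ↔ s) → (p → q → r → (p' ↔ q')) →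
      (((p ∧ q ∧ r) ∧ p') ↔ (s ∧ q')) := by
    intros
    tauto
  refine ⟨f, h.imp ?_ ?_⟩
  · exact fun h v a b c => and_congr_ctx (key v a b c) (h v a b c)
  · intro h v a b c
    refine and_congr_ctx ((key v a b c).trans ?_) (h v a b c)
    tauto

section Fin

variable {n : ℕ}

/-- A rotation cuts the linear order of `Fin n` at one point and exchanges the two pieces, which
leaves the cyclic order intact. -/
theorem cycLt_val_add (t a b c : Fin n) :
    CycLt (a + t).val (b + t).val (c + t).val ↔ CycLt a.val b.val c.val := by
  simp only [Fin.val_add_eq_ite, CycLt]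
  have := a.2
  have := b.2
  have := c.2
  have := t.2
  split_ifs <;> omega

theorem Fin.val_sub_eq_ite (a b : Fin n) :
    (a - b).val = if b.val ≤ a.val then a.val - b.val else n + a.val - b.val := by
  have := a.2
  have := b.2
  rw [Fin.val_sub]
  split_ifs with h
  · rw [show n - b.val + a.val = (a.val - b.val) + n by omega, Nat.add_mod_right,
      Nat.mod_eq_of_lt (by omega)]
  · rw [show n - b.val + a.val = n + a.val - b.val by omega, Nat.mod_eq_of_lt (by omega)]

theorem cycLt_val_sub (t a b c : Fin n) :
    CycLt (t - a).val (t - b).val (t - c).val ↔ CycLt c.val b.val a.val := by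
  simp only [Fin.val_sub_eq_ite, CycLt]
  have := a.2
  have := b.2
  have := c.2
  have := t.2
  split_ifs <;> omega

theorem Fin.induction_add_one [NeZero n] {P : Fin n → Prop} (h0 : P 0)
    (h : ∀ i, P i → P (i + 1)) (i : Fin n) : P i := by
  obtain ⟨i, hi⟩ := i
  induction i with
  | zero => exact h0
  | succ k ih =>
    have := h _ (ih (by omega))
    convert this using 1
    ext
    rw [Fin.val_add_eq_ite, Fin.val_one', Nat.mod_eq_of_lt (by omega)]
    simp
    omega

theorem Fin.add_one_add_one_ne [NeZero n] (hn : 3 ≤ n) (i : Fin n) : i + 1 + 1 ≠ i := by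
  intro h
  have h1 : (1 : Fin n).val = 1 := by rw [Fin.val_one', Nat.mod_eq_of_lt (by omega)]
  have h2 := congrArg Fin.val h
  simp only [Fin.val_add_eq_ite, h1] at h2
  have := i.2
  split_ifs at h2 <;> omega

/-- A permutation of the vertices of a polygon that preserves the sides is a rotation or a
reflection. -/
theorem Fin.eq_add_or_eq_sub_of_side [NeZero n] (hn : 3 ≤ n) {g : Fin n → Fin n}
    (hg : Function.Injective g) (h : ∀ i, g (i + 1) = g i + 1 ∨ g i = g (i + 1) + 1) :
    ∃ t, (∀ i, g i = i + t) ∨ (∀ i, g i = t - i) := by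
  refine ⟨g 0, ?_⟩
  rcases h 0 with h0 | h0
  · left
    -- The direction taken on the first side persists: turning back would give `g (i + 1 + 1) = g
    -- i`, against injectivity, as `n` is at least 3.
    have : ∀ i, g (i + 1) = g i + 1 := by
      refine Fin.induction_add_one h0 fun i hi => ?_
      rcases h (i + 1) with h1 | h1
      · exact h1
      · exact absurd (hg (add_right_cancel (h1.symm.trans hi))) (Fin.add_one_add_one_ne hn i)
    refine Fin.induction_add_one (by simp) fun i hi => ?_
    rw [this, hi, add_right_comm]
  · right
    have : ∀ i, g i = g (i + 1) + 1 := by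
      refine Fin.induction_add_one h0 fun i hi => ?_
      rcases h (i + 1) with h1 | h1
      · exact absurd (hg (h1.trans hi.symm)) (Fin.add_one_add_one_ne hn i)
      · exact h1
    refine Fin.induction_add_one (by simp) fun i hi => ?_
    rw [eq_sub_of_add_eq (this i).symm, hi, sub_sub]

end Fin

/-! ### Triples of natural numbers up to order -/

/-- Triples with the sum `n - k`, up to the order of the entries. -/
def tripleSetoid (n k : ℕ) : Setoid {u : Fin 3 → ℕ // u 0 + u 1 + u 2 + k = n} where
  r u v := ∃ σ : Equiv.Perm (Fin 3), u.1 = v.1 ∘ σ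
  iseqv := by
    refine ⟨fun u => ⟨1, rfl⟩, ?_, ?_⟩
    · rintro u v ⟨σ, h⟩
      exact ⟨σ⁻¹, by ext i; simp [h]⟩
    · rintro u v w ⟨σ, h⟩ ⟨τ, h'⟩
      exact ⟨τ * σ, by ext i; simp [h, h']⟩

/-- The number of triples `a ≤ b ≤ c` with `a + b + c = N`. -/
theorem sum_sorted_triples (N : ℕ) :
    12 * (∑ a ∈ Finset.range (N / 3 + 1), ((N - a) / 2 + 1 - a)) ≤ (N + 3) ^ 2 + 6 ∧
    (N + 3) ^ 2 + 6 < 12 * (∑ a ∈ Finset.range (N / 3 + 1), ((N - a) / 2 + 1 - a)) + 12 := by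
  induction N using Nat.strong_induction_on with
  | _ N ih =>
    rcases Nat.lt_or_ge N 6 with h | h
    · interval_cases N <;> decide
    · obtain ⟨M, rfl⟩ := Nat.exists_eq_add_of_le' h
      have ih := ih M (by omega)
      -- Induction in steps of six: the terms with `a ≥ 2` for `M + 6` are those for `M` shifted by
      -- two, and the two new terms add up to `M + 6`. The square grows by `12 * (M + 6)`.
      have h3 : (M + 6) / 3 + 1 = M / 3 + 1 + 1 + 1 := by omega
      have hs : ∑ a ∈ Finset.range (M / 3 + 1), ((M + 6 - (a + 1 + 1)) / 2 + 1 - (a + 1 + 1)) =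
          ∑ a ∈ Finset.range (M / 3 + 1), ((M - a) / 2 + 1 - a) := by
        refine Finset.sum_congr rfl fun a ha => ?_
        rw [Finset.mem_range] at ha
        omega
      rw [h3, Finset.sum_range_succ', Finset.sum_range_succ', hs]
      have e : (M + 6 + 3) ^ 2 = (M + 3) ^ 2 + 12 * (M + 6) := by ring
      rw [e]
      omega

/-- Every class has exactly one sorted representative `(a, b, N - a - b)`; here `a` is at most `N /
3` and `b` runs from `a` to `(N - a) / 2`. -/
theorem card_tripleSetoid_of_le {n k : ℕ} (h : k ≤ n) :
    Nat.card (Quotient (tripleSetoid n k)) =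
      ∑ a ∈ Finset.range ((n - k) / 3 + 1), (((n - k) - a) / 2 + 1 - a) := by
  set N := n - k with hN
  let T : Finset (Σ _ : ℕ, ℕ) :=
    (Finset.range (N / 3 + 1)).sigma fun a => Finset.Icc a ((N - a) / 2)
  have hT : ∀ p : T, p.1.1 + p.1.2 ≤ N ∧ p.1.1 ≤ p.1.2 ∧ p.1.2 ≤ N - p.1.1 - p.1.2 := by
    rintro ⟨⟨a, b⟩, hp⟩
    simp only [T, Finset.mem_sigma, Finset.mem_range, Finset.mem_Icc] at hp
    dsimp only
    omega
  let f : T → Quotient (tripleSetoid n k) := fun p =>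
    Quotient.mk _ ⟨![p.1.1, p.1.2, N - p.1.1 - p.1.2], by
      have := hT p
      simp
      omega⟩
  have hmono : ∀ a b c : ℕ, a ≤ b → b ≤ c → Monotone ![a, b, c] := by
    intro a b c h1 h2
    refine Fin.monotone_iff_le_succ.2 fun i => ?_
    fin_cases i <;> simp [h1, h2]
  have hf : Function.Bijective f := by
    constructor
    · intro p q hpq
      obtain ⟨σ, h⟩ := Quotient.exact hpq
      obtain ⟨hp1, hp2, hp3⟩ := hT p
      obtain ⟨hq1, hq2, hq3⟩ := hT q
      simp only at h
      -- Two monotone rearrangements of one tuple coincide.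
      have h' := Tuple.unique_monotone (f := ![q.1.1, q.1.2, N - q.1.1 - q.1.2]) (σ := σ) (τ := 1)
        (h ▸ hmono _ _ _ hp2 hp3) (hmono _ _ _ hq2 hq3)
      rw [← h] at h'
      have e0 := congrFun h' 0
      have e1 := congrFun h' 1
      simp at e0 e1
      exact Subtype.ext (Sigma.ext e0 (heq_of_eq e1))
    · intro q
      refine Quotient.inductionOn q fun ⟨u, hu⟩ => ?_
      have hm := Tuple.monotone_sort u
      set σ := Tuple.sort u with hσ
      have h1 : u (σ 0) ≤ u (σ 1) := hm (by decide)
      have h2 : u (σ 1) ≤ u (σ 2) := hm (by decide)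
      have hs : u (σ 0) + u (σ 1) + u (σ 2) = u 0 + u 1 + u 2 := by
        have := Equiv.sum_comp σ u
        simpa [Fin.sum_univ_three] using this
      refine ⟨⟨⟨u (σ 0), u (σ 1)⟩, ?_⟩, ?_⟩
      · simp only [T, Finset.mem_sigma, Finset.mem_range, Finset.mem_Icc]
        omega
      · refine Quotient.sound ⟨σ, ?_⟩
        ext i
        fin_cases i
        · rfl
        · rfl
        · simp
          omega
  rw [← Nat.card_eq_of_bijective f hf, Nat.card_eq_fintype_card, Fintype.card_coe]
  simp [T]

/-- With `N = n - (j + 3)` one has `N + 3 = n - j`. The types 1, 2, 3 will be the cases `j = 3, 4,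
5`. -/
theorem card_tripleSetoid {n j : ℕ} (hn : 3 ≤ n) (hj : j ≤ 5) :
    (Nat.card (Quotient (tripleSetoid n (j + 3))) : ℤ) = ⌊(((n : ℚ) - j) ^ 2 + 6) / 12⌋ := by
  symm
  rcases Nat.lt_or_ge n (j + 3) with h | h
  -- For small `n` there are no triples, and the formula agrees because `n - j` lies between `-2`
  -- and `2`, so that the fraction is below 1.
  · have : IsEmpty (Quotient (tripleSetoid n (j + 3))) :=
      ⟨fun q => Quotient.inductionOn q fun ⟨u, hu⟩ => by omega⟩
    rw [Nat.card_of_isEmpty, Int.floor_eq_iff]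
    have h1 : (n : ℚ) - j ≤ 2 := by
      have : (n : ℚ) + 1 ≤ j + 3 := by exact_mod_cast h
      linarith
    have h2 : -2 ≤ (n : ℚ) - j := by
      have h3 : (3 : ℚ) ≤ n := by exact_mod_cast hn
      have h4 : (j : ℚ) ≤ 5 := by exact_mod_cast hj
      linarith
    constructor
    · push_cast
      positivity
    · push_cast
      rw [div_lt_iff₀ (by norm_num)]
      nlinarith
  · rw [card_tripleSetoid_of_le h, Int.floor_eq_iff]
    have hs := sum_sorted_triples (n - (j + 3))
    have e : (n : ℚ) - j = ((n - (j + 3) : ℕ) : ℚ) + 3 := by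
      push_cast [h]
      ring
    rw [e]
    generalize ∑ a ∈ Finset.range ((n - (j + 3)) / 3 + 1), (((n - (j + 3)) - a) / 2 + 1 - a) = S at *
    generalize n - (j + 3) = N at *
    obtain ⟨h1, h2⟩ := hs
    have h1 : (12 * S : ℚ) ≤ (N + 3) ^ 2 + 6 := by exact_mod_cast h1
    have h2 : ((N : ℚ) + 3) ^ 2 + 6 < 12 * S + 12 := by exact_mod_cast h2
    push_cast
    constructor
    · linarith
    · linarith

/-! ### Threads of vertices of degree two -/

namespace SimpleGraph

variable {V W : Type} {G : SimpleGraph V} {H : SimpleGraph W}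

/-- The vertex `v` has at least three neighbours. -/
def IsBranch (G : SimpleGraph V) (v : V) : Prop :=
  ∃ a b c, G.Adj v a ∧ G.Adj v b ∧ G.Adj v c ∧ a ≠ b ∧ b ≠ c ∧ a ≠ c

/-- The edge `uv` lies in a triangle. -/
def TriangleEdge (G : SimpleGraph V) (u v : V) : Prop :=
  G.Adj u v ∧ ∃ w, G.Adj u w ∧ G.Adj v w

/-- Starting from `u`, `v` and moving on through vertices of degree two, one meets exactly `m`
of these before one reaches a vertex of higher degree. -/
inductive Thread (G : SimpleGraph V) : V → V → ℕ → Prop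
  | terminal {u v : V} (h : G.IsBranch v) : Thread G u v 0
  | step {u v w : V} {m : ℕ} (huw : u ≠ w) (h : ∀ y, G.Adj v y ↔ y = u ∨ y = w)
      (t : Thread G v w m) : Thread G u v (m + 1)

theorem not_isBranch {u v w : V} (h : ∀ y, G.Adj v y → y = u ∨ y = w) : ¬ G.IsBranch v := by
  rintro ⟨a, b, c, ha, hb, hc, hab, hbc, hac⟩
  rcases h a ha with rfl | rfl <;> rcases h b hb with rfl | rfl <;>
    rcases h c hc with rfl | rfl <;> contradiction

/-- At a vertex of degree two the way onward is forced, and such a vertex is not a branch vertex, so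
neither the course nor the end of the walk can be chosen. -/
theorem Thread.unique {u v : V} {m m' : ℕ} (h : G.Thread u v m) (h' : G.Thread u v m') :
    m = m' := by
  induction h generalizing m' with
  | terminal hv =>
    cases h' with
    | terminal => rfl
    | step _ h _ => exact absurd hv (not_isBranch fun y => (h y).1)
  | @step u v w m huw h _ ih =>
    cases h' with
    | terminal hv => exact absurd hv (not_isBranch fun y => (h y).1)
    | @step _ _ w' m' huw' h' t' =>
      have : w = w' := (((h' w).1 ((h w).2 (Or.inr rfl))).resolve_left (Ne.symm huw))
      subst this
      rw [ih t']

theorem IsBranch.map (f : G ≃g H) {v : V} (h : G.IsBranch v) : H.IsBranch (f v) := by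
  obtain ⟨a, b, c, ha, hb, hc, hab, hbc, hac⟩ := h
  exact ⟨f a, f b, f c, f.map_adj_iff.2 ha, f.map_adj_iff.2 hb, f.map_adj_iff.2 hc,
    f.injective.ne hab, f.injective.ne hbc, f.injective.ne hac⟩

theorem isBranch_map_iff (f : G ≃g H) {v : V} : H.IsBranch (f v) ↔ G.IsBranch v :=
  ⟨fun h => by simpa using h.map f.symm, fun h => h.map f⟩

theorem TriangleEdge.map (f : G ≃g H) {u v : V} (h : G.TriangleEdge u v) :
    H.TriangleEdge (f u) (f v) := by
  obtain ⟨h, w, h1, h2⟩ := h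
  exact ⟨f.map_adj_iff.2 h, f w, f.map_adj_iff.2 h1, f.map_adj_iff.2 h2⟩

theorem triangleEdge_map_iff (f : G ≃g H) {u v : V} :
    H.TriangleEdge (f u) (f v) ↔ G.TriangleEdge u v :=
  ⟨fun h => by simpa using h.map f.symm, fun h => h.map f⟩

/-- Together with `Thread.unique` this makes the lengths of the columns invariants of the graph. -/
theorem Thread.map (f : G ≃g H) {u v : V} {m : ℕ} (h : G.Thread u v m) :
    H.Thread (f u) (f v) m := by
  induction h with
  | terminal h => exact .terminal (h.map f)
  | @step u v w m huw h _ ih =>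
    refine .step (f.injective.ne huw) (fun y => ?_) ih
    obtain ⟨y, rfl⟩ := f.surjective y
    rw [f.map_adj_iff, h, f.injective.eq_iff, f.injective.eq_iff]

end SimpleGraph

/-- Any two different vertices of a triangle are adjacent, so every permutation preserves the sides.
This is why all permutations of the columns are realized by symmetries of the drawings. -/
theorem Fin.perm_three_eq_add_or_eq_sub (σ : Equiv.Perm (Fin 3)) :
    ∃ t, (∀ i, σ i = i + t) ∨ (∀ i, σ i = t - i) := by
  refine Fin.eq_add_or_eq_sub_of_side le_rfl σ.injective fun i => ?_
  have h : ∀ x y : Fin 3, x ≠ y → x = y + 1 ∨ y = x + 1 := by decide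
  exact h _ _ (σ.injective.ne (by revert i; decide))

/-! ### Prisms -/

theorem prismGraph_adj {s : Fin 3 → ℕ} {v w : Σ i : Fin 3, Fin (s i + 2)} :
    (prismGraph s).Adj v w ↔
      (v.1 = w.1 ∧ (v.2.val + 1 = w.2.val ∨ w.2.val + 1 = v.2.val)) ∨
      (v.1 ≠ w.1 ∧ ((v.2.val = 0 ∧ w.2.val = 0) ∨
        (v.2.val = s v.1 + 1 ∧ w.2.val = s w.1 + 1))) := by
  rw [prismGraph, SimpleGraph.fromRel_adj]
  by_cases h : v.1 = w.1
  · simp only [h, ne_eq, not_true_eq_false, false_and, or_false, true_and]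
    refine ⟨fun h => h.2, fun h' => ⟨?_, h'⟩⟩
    rintro rfl
    omega
  · simp only [h, Ne.symm h, ne_eq, not_false_eq_true, true_and, false_and, false_or]
    refine ⟨fun h => by tauto, fun h' => ⟨?_, by tauto⟩⟩
    rintro rfl
    exact h rfl

/-- The angles at the corners are differences of column indices: a rotation of the columns fixes
these differences and a reflection negates them, at both triangles at once. -/
theorem prismDrawing_iso (s : Fin 3 → ℕ) (σ : Equiv.Perm (Fin 3)) :
    (prismDrawing (s ∘ σ)).Iso (prismDrawing s) := by
  let f : prismGraph (s ∘ σ) ≃g prismGraph s :=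
    ⟨Equiv.sigmaCongrLeft (β := fun i => Fin (s i + 2)) σ, fun {v w} => by
      rw [prismGraph_adj, prismGraph_adj]
      simp [Equiv.sigmaCongrLeft]⟩
  refine EmbeddedGraph.iso_ofAngle_of_forall f ?_
  have hf : ∀ v, (f v).1 = σ v.1 ∧ (f v).2.val = v.2.val := fun v => ⟨rfl, rfl⟩
  have hang : ∀ v w, prismAngle s (f v) (f w) = if v.2.val = 0 then (σ w.1 - σ v.1).val
      else if v.2.val = s (σ v.1) + 1 then (σ v.1 - σ w.1).val else w.2.val := by
    intro v w
    simp only [prismAngle, (hf _).1, (hf _).2]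
  -- A subdivider has only two neighbours, so no triple is in cyclic order there and orientation is
  -- no condition.
  have hadj : ∀ v a b c, (prismGraph (s ∘ σ)).Adj v a → (prismGraph (s ∘ σ)).Adj v b →
      (prismGraph (s ∘ σ)).Adj v c → ¬ v.2.val = 0 → ¬ v.2.val = s (σ v.1) + 1 →
      ¬ CycLt a.2.val b.2.val c.2.val := by
    intro v a b c ha hb hc h1 h2
    rw [prismGraph_adj] at ha hb hc
    simp only [Function.comp_apply] at ha hb hc
    unfold CycLt
    omega
  obtain ⟨t, ht | ht⟩ := Fin.perm_three_eq_add_or_eq_sub σ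
  · left
    intro v a b c _ _ _
    rw [hang, hang, hang]
    simp only [prismAngle, ht, add_sub_add_right_eq_sub, Function.comp_apply]
  · right
    intro v a b c ha hb hc
    have hadj1 := hadj v a b c ha hb hc
    have hadj2 := hadj v c b a hc hb ha
    rw [hang, hang, hang]
    simp only [prismAngle, Function.comp_apply, ht, sub_sub_sub_cancel_left] at *
    split_ifs with h1 h2
    · have := cycLt_val_sub 0 (v.1 - a.1) (v.1 - b.1) (v.1 - c.1)
      simpa using this
    · have := cycLt_val_sub 0 (a.1 - v.1) (b.1 - v.1) (c.1 - v.1)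
      simpa using this
    · exact iff_of_false (hadj1 h1 h2) (hadj2 h1 h2)

/-- No column edge lies in a triangle, even if the column is a single edge, since its two ends
belong to different triangles. Thus the columns can be read off from the graph. -/
theorem prismGraph_triangleEdge {s : Fin 3 → ℕ} {v w : Σ i : Fin 3, Fin (s i + 2)} :
    (prismGraph s).TriangleEdge v w ↔ v.1 ≠ w.1 ∧ (prismGraph s).Adj v w := by
  have third : ∀ i j : Fin 3, i ≠ j → ∃ k, i ≠ k ∧ j ≠ k := by decide
  constructor
  · rintro ⟨h, u, h1, h2⟩
    refine ⟨fun hvw => ?_, h⟩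
    rw [prismGraph_adj] at h h1 h2
    have := v.2.2
    have := w.2.2
    have := u.2.2
    rcases v with ⟨v, x⟩
    rcases w with ⟨w, y⟩
    rcases u with ⟨u, z⟩
    dsimp only at *
    subst hvw
    by_cases hu : v = u
    · subst hu
      simp only [ne_eq, not_true_eq_false, false_and, or_false, true_and] at h h1 h2
      omega
    · simp only [hu, ne_eq, not_true_eq_false, not_false_eq_true, false_and, false_or, or_false,
        true_and] at h h1 h2
      omega
  · rintro ⟨hne, h⟩
    refine ⟨h, ?_⟩
    obtain ⟨k, hk1, hk2⟩ := third _ _ hne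
    rw [prismGraph_adj] at h
    rcases (h.resolve_left fun h => hne h.1).2 with ⟨h1, h2⟩ | ⟨h1, h2⟩
    · exact ⟨⟨k, 0⟩, prismGraph_adj.2 (Or.inr ⟨hk1, Or.inl ⟨h1, rfl⟩⟩),
        prismGraph_adj.2 (Or.inr ⟨hk2, Or.inl ⟨h2, rfl⟩⟩)⟩
    · exact ⟨⟨k, Fin.last _⟩, prismGraph_adj.2 (Or.inr ⟨hk1, Or.inr ⟨h1, rfl⟩⟩),
        prismGraph_adj.2 (Or.inr ⟨hk2, Or.inr ⟨h2, rfl⟩⟩)⟩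

theorem prismGraph_isBranch {s : Fin 3 → ℕ} {v : Σ i : Fin 3, Fin (s i + 2)}
    (h : v.2.val = 0 ∨ v.2.val = s v.1 + 1) : (prismGraph s).IsBranch v := by
  obtain ⟨i, x⟩ := v
  have two : ∀ i : Fin 3, i ≠ i + 1 ∧ i ≠ i + 2 ∧ i + 1 ≠ i + 2 := by decide
  obtain ⟨h1, h2, h3⟩ := two i
  dsimp only at h
  rcases h with h | h
  · refine ⟨⟨i, 1⟩, ⟨i + 1, 0⟩, ⟨i + 2, 0⟩, ?_, ?_, ?_, ?_, ?_, ?_⟩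
    · exact prismGraph_adj.2 (Or.inl ⟨rfl, by simp [h]⟩)
    · exact prismGraph_adj.2 (Or.inr ⟨h1, Or.inl ⟨h, rfl⟩⟩)
    · exact prismGraph_adj.2 (Or.inr ⟨h2, Or.inl ⟨h, rfl⟩⟩)
    · exact fun h => h1 (congrArg Sigma.fst h)
    · exact fun h => h3 (congrArg Sigma.fst h)
    · exact fun h => h2 (congrArg Sigma.fst h)
  · refine ⟨⟨i, ⟨s i, by omega⟩⟩, ⟨i + 1, Fin.last _⟩, ⟨i + 2, Fin.last _⟩, ?_, ?_, ?_, ?_, ?_, ?_⟩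
    · exact prismGraph_adj.2 (Or.inl ⟨rfl, by simp [h]⟩)
    · exact prismGraph_adj.2 (Or.inr ⟨h1, Or.inr ⟨h, rfl⟩⟩)
    · exact prismGraph_adj.2 (Or.inr ⟨h2, Or.inr ⟨h, rfl⟩⟩)
    · exact fun h => h1 (congrArg Sigma.fst h)
    · exact fun h => h3 (congrArg Sigma.fst h)
    · exact fun h => h2 (congrArg Sigma.fst h)

theorem prismGraph_thread_up (s : Fin 3 → ℕ) (i : Fin 3) (d : ℕ) :
    ∀ v w : Σ i : Fin 3, Fin (s i + 2), v.1 = i → w.1 = i → w.2.val = v.2.val + 1 →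
      v.2.val + d = s i → (prismGraph s).Thread v w d := by
  induction d with
  | zero =>
    rintro ⟨v, x⟩ ⟨w, y⟩ rfl hw h1 h2
    dsimp only at hw
    subst hw
    exact .terminal (prismGraph_isBranch (Or.inr (by dsimp only at *; omega)))
  | succ d ih =>
    rintro ⟨v, x⟩ ⟨w, y⟩ rfl hw h1 h2
    dsimp only at hw
    subst hw
    dsimp only at h1 h2
    refine .step (w := ⟨w, ⟨y.val + 1, by omega⟩⟩) ?_ ?_ (ih _ _ rfl rfl rfl (by
      dsimp only
      omega))
    · intro h
      have := congrArg (fun v : Σ i : Fin 3, Fin (s i + 2) => v.2.val) h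
      dsimp only at this
      omega
    · rintro ⟨u, z⟩
      rw [prismGraph_adj]
      constructor
      · rintro (⟨rfl, h⟩ | ⟨hne, h⟩)
        · dsimp only at h
          rcases h with h | h
          · right
            congr 1
            exact Fin.ext h.symm
          · left
            congr 1
            ext
            omega
        · dsimp only at h
          omega
      · rintro (h | h)
        · rw [h]
          exact Or.inl ⟨rfl, by dsimp only; omega⟩
        · rw [h]
          exact Or.inl ⟨rfl, by dsimp only; omega⟩

theorem prismGraph_thread_down (s : Fin 3 → ℕ) (i : Fin 3) (d : ℕ) :
    ∀ v w : Σ i : Fin 3, Fin (s i + 2), v.1 = i → w.1 = i → v.2.val = w.2.val + 1 →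
      w.2.val = d → (prismGraph s).Thread v w d := by
  induction d with
  | zero =>
    rintro ⟨v, x⟩ ⟨w, y⟩ rfl hw h1 h2
    dsimp only at hw
    subst hw
    exact .terminal (prismGraph_isBranch (Or.inl (by dsimp only at *; omega)))
  | succ d ih =>
    rintro ⟨v, x⟩ ⟨w, y⟩ rfl hw h1 h2
    dsimp only at hw
    subst hw
    have := x.2
    dsimp only at h1 h2
    refine .step (w := ⟨w, ⟨d, by omega⟩⟩) ?_ ?_ (ih _ _ rfl rfl h2 rfl)
    · intro h
      have := congrArg (fun v : Σ i : Fin 3, Fin (s i + 2) => v.2.val) h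
      dsimp only at this
      omega
    · rintro ⟨u, z⟩
      rw [prismGraph_adj]
      constructor
      · rintro (⟨rfl, h⟩ | ⟨hne, h⟩)
        · dsimp only at h
          rcases h with h | h
          · left
            congr 1
            ext
            omega
          · right
            congr 1
            ext
            dsimp only
            omega
        · dsimp only at h
          omega
      · rintro (h | h)
        · rw [h]
          exact Or.inl ⟨rfl, by dsimp only; omega⟩
        · rw [h]
          exact Or.inl ⟨rfl, by dsimp only; omega⟩

/-- The bottom corners are pairwise joined by triangle edges, so their images lie in three different
columns, which defines the permutation. The column edge at a bottom corner lies in no triangle, so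
its image stays in one column, and the threads starting with these edges have equal lengths. -/
theorem exists_perm_of_prismGraph_iso {s s' : Fin 3 → ℕ} (f : prismGraph s ≃g prismGraph s') :
    ∃ σ : Equiv.Perm (Fin 3), s = s' ∘ σ := by
  let b : Fin 3 → Σ i : Fin 3, Fin (s i + 2) := fun i => ⟨i, 0⟩
  have hb : ∀ i j, i ≠ j → (prismGraph s').TriangleEdge (f (b i)) (f (b j)) := by
    intro i j hij
    refine SimpleGraph.TriangleEdge.map f ?_
    rw [prismGraph_triangleEdge]
    exact ⟨hij, prismGraph_adj.2 (Or.inr ⟨hij, Or.inl ⟨rfl, rfl⟩⟩)⟩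
  have hinj : Function.Injective fun i => (f (b i)).1 := by
    intro i j hij
    by_contra h
    exact (prismGraph_triangleEdge.1 (hb i j h)).1 hij
  refine ⟨Equiv.ofBijective _ (Finite.injective_iff_bijective.1 hinj), funext fun i => ?_⟩
  change s i = s' (f (b i)).1
  let c : Σ i : Fin 3, Fin (s i + 2) := ⟨i, 1⟩
  have ht : (prismGraph s).Thread (b i) c (s i) :=
    prismGraph_thread_up s i (s i) _ _ rfl rfl rfl (by simp [b])
  have hbc : (prismGraph s).Adj (b i) c := prismGraph_adj.2 (Or.inl ⟨rfl, by simp [b, c]⟩)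
  have hcol : (f (b i)).1 = (f c).1 := by
    by_contra h
    exact (prismGraph_triangleEdge.1 ((SimpleGraph.triangleEdge_map_iff f).1
      (prismGraph_triangleEdge.2 ⟨h, f.map_adj_iff.2 hbc⟩))).1 rfl
  have hend : (f (b i)).2.val = 0 ∨ (f (b i)).2.val = s' (f (b i)).1 + 1 := by
    obtain ⟨hne, h⟩ := prismGraph_triangleEdge.1 (hb i (i + 1) ((by decide : ∀ i : Fin 3, i ≠ i + 1) i))
    rw [prismGraph_adj] at h
    rcases h with h | h
    · exact absurd h.1 hne
    · exact h.2.imp And.left And.left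
  have hadj := prismGraph_adj.1 (f.map_adj_iff.2 hbc)
  have hval : (f c).2.val < s' (f (b i)).1 + 2 := by
    rw [hcol]
    exact (f c).2.2
  -- The image of a bottom corner may be a bottom or a top corner, so the image thread runs up or
  -- down.
  rcases hadj.resolve_right fun h => h.1 hcol with ⟨_, h | h⟩
  · refine (ht.map f).unique (prismGraph_thread_up s' _ _ _ _ rfl hcol.symm h.symm ?_)
    omega
  · refine (ht.map f).unique (prismGraph_thread_down s' _ _ _ _ rfl hcol.symm h.symm ?_)
    omega

theorem card_sigma_fin_three (s : Fin 3 → ℕ) :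
    Nat.card (Σ i : Fin 3, Fin (s i)) = s 0 + s 1 + s 2 := by
  simp [Nat.card_eq_fintype_card, Fin.sum_univ_three]

theorem countUpToIso_isType1 (n : ℕ) :
    EmbeddedGraph.countUpToIso n IsType1 = Nat.card (Quotient (tripleSetoid n 6)) := by
  have hcard : ∀ s : Fin 3 → ℕ, Nat.card (Σ i : Fin 3, Fin (s i + 2)) = s 0 + s 1 + s 2 + 6 :=
    fun s => by
      rw [card_sigma_fin_three fun i => s i + 2]
      omega
  refine EmbeddedGraph.countUpToIso_eq_card_quotient (tripleSetoid n 6)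
    (fun u => prismDrawing u.1) (fun u => ?_) (fun D => ⟨?_, ?_⟩) fun u v => ⟨?_, ?_⟩
  · exact ⟨Finite.equivFinOfCardEq ((hcard _).trans u.2)⟩
  · rintro ⟨s, h⟩
    obtain ⟨e⟩ := h.nonempty_equiv
    exact ⟨⟨s, by rw [← hcard, ← Nat.card_congr e, Nat.card_fin]⟩, h⟩
  · rintro ⟨u, h⟩
    exact ⟨u.1, h⟩
  · rintro ⟨f, _⟩
    exact exists_perm_of_prismGraph_iso f
  · rintro ⟨σ, h⟩
    rw [h]
    exact prismDrawing_iso _ σ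

/-! ### Tetrahedral graphs -/

theorem tetraGraph_adj_none_some {s : Fin 3 → ℕ} {w : Σ i : Fin 3, Fin (s i + 1)} :
    (tetraGraph s).Adj none (some w) ↔ w.2.val = 0 := by
  simp [tetraGraph, SimpleGraph.fromRel_adj]

theorem tetraGraph_adj_some_some {s : Fin 3 → ℕ} {v w : Σ i : Fin 3, Fin (s i + 1)} :
    (tetraGraph s).Adj (some v) (some w) ↔
      (v.1 = w.1 ∧ (v.2.val + 1 = w.2.val ∨ w.2.val + 1 = v.2.val)) ∨
      (v.1 ≠ w.1 ∧ v.2.val = s v.1 ∧ w.2.val = s w.1) := by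
  rw [tetraGraph, SimpleGraph.fromRel_adj]
  by_cases h : v.1 = w.1
  · simp only [h, ne_eq, not_true_eq_false, false_and, or_false, true_and]
    refine ⟨fun h => h.2, fun h' => ⟨?_, h'⟩⟩
    intro h
    obtain rfl := Option.some.inj h
    omega
  · simp only [h, Ne.symm h, ne_eq, not_false_eq_true, true_and, false_and, false_or]
    refine ⟨fun h => by tauto, fun h' => ⟨?_, by tauto⟩⟩
    intro h'
    obtain rfl := Option.some.inj h'
    exact h rfl

/-- As for prisms, a permutation of the columns is a rotation or a reflection; at `none` the cyclic
order is that of the column indices. -/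
theorem tetraDrawing_iso (s : Fin 3 → ℕ) (σ : Equiv.Perm (Fin 3)) :
    (tetraDrawing (s ∘ σ)).Iso (tetraDrawing s) := by
  let e : Option (Σ i : Fin 3, Fin ((s ∘ σ) i + 1)) ≃ Option (Σ i : Fin 3, Fin (s i + 1)) :=
    Equiv.optionCongr (Equiv.sigmaCongrLeft (β := fun i => Fin (s i + 1)) σ)
  let f : tetraGraph (s ∘ σ) ≃g tetraGraph s :=
    ⟨e, fun {v w} => by
      rcases v with _ | v <;> rcases w with _ | w
      · simp [e]
      · change (tetraGraph s).Adj none (some _) ↔ _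
        rw [tetraGraph_adj_none_some, tetraGraph_adj_none_some]
        rfl
      · change (tetraGraph s).Adj (some _) none ↔ _
        rw [SimpleGraph.adj_comm, tetraGraph_adj_none_some, SimpleGraph.adj_comm,
          tetraGraph_adj_none_some]
        rfl
      · change (tetraGraph s).Adj (some _) (some _) ↔ _
        rw [tetraGraph_adj_some_some, tetraGraph_adj_some_some]
        simp [Equiv.sigmaCongrLeft]⟩
  refine EmbeddedGraph.iso_ofAngle_of_forall f ?_
  have hfn : f none = none := rfl
  have hfs : ∀ v, f (some v) = some ⟨σ v.1, v.2⟩ := fun v => rfl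
  have hadj : ∀ v a b c, (tetraGraph (s ∘ σ)).Adj (some v) a → (tetraGraph (s ∘ σ)).Adj (some v) b →
      (tetraGraph (s ∘ σ)).Adj (some v) c → ¬ v.2.val = s (σ v.1) →
      ¬ CycLt (tetraAngle (s ∘ σ) (some v) a) (tetraAngle (s ∘ σ) (some v) b)
        (tetraAngle (s ∘ σ) (some v) c) := by
    have key : ∀ v a, (tetraGraph (s ∘ σ)).Adj (some v) a → ¬ v.2.val = s (σ v.1) →
        tetraAngle (s ∘ σ) (some v) a = v.2.val ∨ tetraAngle (s ∘ σ) (some v) a = v.2.val + 2 := by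
      rintro v (_ | a) h hv
      · rw [SimpleGraph.adj_comm, tetraGraph_adj_none_some] at h
        left
        simp [tetraAngle, h]
      · rw [tetraGraph_adj_some_some] at h
        simp only [tetraAngle, Function.comp_apply, hv, if_false] at h ⊢
        rcases h with ⟨_, h⟩ | ⟨_, h, _⟩
        · omega
        · exact h.elim
    intro v a b c ha hb hc hv
    have := key v a ha hv
    have := key v b hb hv
    have := key v c hc hv
    unfold CycLt
    omega
  obtain ⟨t, ht | ht⟩ := Fin.perm_three_eq_add_or_eq_sub σ
  · left
    have hang : ∀ v a, tetraAngle s (f (some v)) (f a) = tetraAngle (s ∘ σ) (some v) a := by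
      rintro v (_ | a)
      · rfl
      · simp [tetraAngle, hfs, ht]
    rintro (_ | v) (_ | a) (_ | b) (_ | c) ha hb hc <;>
      first
      | exact absurd rfl ha.ne
      | exact absurd rfl hb.ne
      | exact absurd rfl hc.ne
      | skip
    · simp only [hfn, hfs, tetraAngle, ht]
      exact (cycLt_val_add t _ _ _).symm
    all_goals simp only [hang]
  · right
    have hang : ∀ v a, ¬ v.2.val = s (σ v.1) →
        tetraAngle s (f (some v)) (f a) = tetraAngle (s ∘ σ) (some v) a := by
      rintro v (_ | a) hv
      · rfl
      · simp [tetraAngle, hfs, hv]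
    rintro (_ | v) a b c ha hb hc
    · rcases a with (_ | a)
      · exact absurd rfl ha.ne
      rcases b with (_ | b)
      · exact absurd rfl hb.ne
      rcases c with (_ | c)
      · exact absurd rfl hc.ne
      simp only [hfn, hfs, tetraAngle, ht]
      exact (cycLt_val_sub t _ _ _).symm
    · by_cases hv : v.2.val = s (σ v.1)
      -- At a corner the edge into its own column has angle 0, whether it ends in a subdivider or in
      -- `none`, and a reflection negates all the angles modulo 3.
      · have h1 : ∀ a, (tetraGraph (s ∘ σ)).Adj (some v) a → ∃ i : Fin 3,
            tetraAngle (s ∘ σ) (some v) a = i.val ∧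
            tetraAngle s (f (some v)) (f a) = (0 - i).val := by
          rintro (_ | a) ha
          · exact ⟨0, rfl, rfl⟩
          · refine ⟨v.1 - a.1, ?_, ?_⟩
            · simp [tetraAngle, hv]
            · simp [tetraAngle, hfs, hv, ht]
        obtain ⟨i, ha1, ha2⟩ := h1 a ha
        obtain ⟨j, hb1, hb2⟩ := h1 b hb
        obtain ⟨k, hc1, hc2⟩ := h1 c hc
        rw [ha1, ha2, hb1, hb2, hc1, hc2]
        exact (cycLt_val_sub 0 _ _ _).symm
      · rw [hang v a hv, hang v b hv, hang v c hv]
        exact iff_of_false (hadj v a b c ha hb hc hv) (hadj v c b a hc hb ha hv)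

theorem tetraGraph_isBranch_none (s : Fin 3 → ℕ) : (tetraGraph s).IsBranch none :=
  ⟨some ⟨0, 0⟩, some ⟨1, 0⟩, some ⟨2, 0⟩, tetraGraph_adj_none_some.2 rfl,
    tetraGraph_adj_none_some.2 rfl, tetraGraph_adj_none_some.2 rfl,
    fun h => absurd (congrArg Sigma.fst (Option.some.inj h)) (by decide : (0 : Fin 3) ≠ 1),
    fun h => absurd (congrArg Sigma.fst (Option.some.inj h)) (by decide : (1 : Fin 3) ≠ 2),
    fun h => absurd (congrArg Sigma.fst (Option.some.inj h)) (by decide : (0 : Fin 3) ≠ 2)⟩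

theorem tetraGraph_triangleEdge {s : Fin 3 → ℕ} {v : Σ i : Fin 3, Fin (s i + 1)}
    (h : v.2.val = s v.1) :
    (tetraGraph s).TriangleEdge (some v) (some ⟨v.1 + 1, Fin.last _⟩) := by
  have two : ∀ i : Fin 3, i ≠ i + 1 ∧ i ≠ i + 2 ∧ i + 1 ≠ i + 2 := by decide
  obtain ⟨h1, h2, h3⟩ := two v.1
  exact ⟨tetraGraph_adj_some_some.2 (Or.inr ⟨h1, h, rfl⟩), some ⟨v.1 + 2, Fin.last _⟩,
    tetraGraph_adj_some_some.2 (Or.inr ⟨h2, h, rfl⟩),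
    tetraGraph_adj_some_some.2 (Or.inr ⟨h3, rfl, rfl⟩)⟩

theorem tetraGraph_isBranch_some {s : Fin 3 → ℕ} {v : Σ i : Fin 3, Fin (s i + 1)}
    (h : v.2.val = s v.1) : (tetraGraph s).IsBranch (some v) := by
  have two : ∀ i : Fin 3, i ≠ i + 1 ∧ i ≠ i + 2 ∧ i + 1 ≠ i + 2 := by decide
  obtain ⟨h1, h2, h3⟩ := two v.1
  obtain ⟨i, ⟨x, hx⟩⟩ := v
  dsimp only at h
  subst h
  have h4 : (tetraGraph s).Adj (some ⟨i, ⟨s i, hx⟩⟩) (some ⟨i + 1, Fin.last _⟩) :=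
    tetraGraph_adj_some_some.2 (Or.inr ⟨h1, rfl, rfl⟩)
  have h5 : (tetraGraph s).Adj (some ⟨i, ⟨s i, hx⟩⟩) (some ⟨i + 2, Fin.last _⟩) :=
    tetraGraph_adj_some_some.2 (Or.inr ⟨h2, rfl, rfl⟩)
  obtain hs | ⟨k, hs⟩ : s i = 0 ∨ ∃ k, s i = k + 1 := by cases s i <;> simp
  · exact ⟨_, _, none, h4, h5,
      (tetraGraph_adj_none_some.2 hs).symm,
      fun h => h3 (congrArg Sigma.fst (Option.some.inj h)), by simp, by simp⟩
  · refine ⟨_, _, some ⟨i, ⟨k, by omega⟩⟩, h4, h5,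
      tetraGraph_adj_some_some.2 (Or.inl ⟨rfl, Or.inr hs.symm⟩),
      fun h => h3 (congrArg Sigma.fst (Option.some.inj h)),
      fun h => h2 (congrArg Sigma.fst (Option.some.inj h)).symm,
      fun h => h1 (congrArg Sigma.fst (Option.some.inj h)).symm⟩

theorem tetraGraph_thread_some (s : Fin 3 → ℕ) (i : Fin 3) (d : ℕ) :
    ∀ v w : Σ i : Fin 3, Fin (s i + 1), v.1 = i → w.1 = i → w.2.val = v.2.val + 1 →
      w.2.val + d = s i → (tetraGraph s).Thread (some v) (some w) d := by
  induction d with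
  | zero =>
    rintro ⟨v, x⟩ ⟨w, y⟩ rfl hw h1 h2
    dsimp only at hw
    subst hw
    exact .terminal (tetraGraph_isBranch_some (by dsimp only at *; omega))
  | succ d ih =>
    rintro ⟨v, x⟩ ⟨w, y⟩ rfl hw h1 h2
    dsimp only at hw
    subst hw
    dsimp only at h1 h2
    refine .step (w := some ⟨w, ⟨y.val + 1, by omega⟩⟩) ?_ ?_ (ih _ _ rfl rfl rfl (by
      dsimp only
      omega))
    · intro h
      have := congrArg (fun v : Σ i : Fin 3, Fin (s i + 1) => v.2.val) (Option.some.inj h)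
      dsimp only at this
      omega
    · rintro (_ | ⟨u, z⟩)
      · rw [SimpleGraph.adj_comm, tetraGraph_adj_none_some]
        simp [h1]
      rw [tetraGraph_adj_some_some]
      constructor
      · rintro (⟨rfl, h⟩ | ⟨hne, h⟩)
        · dsimp only at h
          rcases h with h | h
          · right
            congr 2
            exact Fin.ext h.symm
          · left
            congr 2
            ext
            omega
        · dsimp only at h
          omega
      · rintro (h | h)
        · rw [Option.some.inj h]
          exact Or.inl ⟨rfl, by dsimp only; omega⟩
        · rw [Option.some.inj h]
          exact Or.inl ⟨rfl, by dsimp only; omega⟩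

theorem tetraGraph_thread_none (s : Fin 3 → ℕ) (v : Σ i : Fin 3, Fin (s i + 1))
    (hv : v.2.val = 0) : (tetraGraph s).Thread none (some v) (s v.1) := by
  rcases v with ⟨i, x⟩
  dsimp only at hv ⊢
  rcases hs : s i with _ | k
  · exact .terminal (tetraGraph_isBranch_some (by dsimp only; omega))
  · refine .step (w := some ⟨i, ⟨1, by omega⟩⟩) (by simp) ?_
      (tetraGraph_thread_some s i k _ _ rfl rfl (by simp [hv]) (by dsimp only; omega))
    rintro (_ | ⟨u, z⟩)
    · rw [SimpleGraph.adj_comm, tetraGraph_adj_none_some]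
      simp [hv]
    rw [tetraGraph_adj_some_some]
    constructor
    · rintro (⟨rfl, h⟩ | ⟨hne, h⟩)
      · dsimp only at h
        right
        congr 2
        ext
        dsimp only
        omega
      · dsimp only at h
        omega
    · rintro (h | h)
      · simp at h
      · rw [Option.some.inj h]
        exact Or.inl ⟨rfl, by dsimp only; omega⟩

/-- With a subdivider on each column `none` lies in no triangle, unlike the three corners, which are
the only other branch vertices. So `f` fixes `none`, permutes its three neighbours and preserves the
lengths of the threads that start there. -/
theorem exists_perm_of_tetraGraph_iso {s s' : Fin 3 → ℕ} (hs : ∀ i, 1 ≤ s i)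
    (f : tetraGraph s ≃g tetraGraph s') : ∃ σ : Equiv.Perm (Fin 3), s = s' ∘ σ := by
  have hnone : f none = none := by
    rcases hf : f none with _ | v
    · rfl
    exfalso
    have hbr : (tetraGraph s').IsBranch (some v) := hf ▸ (tetraGraph_isBranch_none s).map f
    have hv : v.2.val = s' v.1 := by
      by_contra hv
      have hlt : v.2.val < s' v.1 := by
        have := v.2.2
        omega
      obtain ⟨i, x⟩ := v
      dsimp only at hlt
      by_cases h0 : x.val = 0
      · refine SimpleGraph.not_isBranch (u := none) (w := some ⟨i, ⟨x.val + 1, by omega⟩⟩) ?_ hbr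
        rintro (_ | ⟨u, z⟩) h
        · exact Or.inl rfl
        · rw [tetraGraph_adj_some_some] at h
          rcases h with ⟨rfl, h⟩ | ⟨hne, h⟩
          · right
            congr 2
            ext
            dsimp only at h ⊢
            omega
          · dsimp only at h
            omega
      · refine SimpleGraph.not_isBranch (u := some ⟨i, ⟨x.val - 1, by omega⟩⟩)
          (w := some ⟨i, ⟨x.val + 1, by omega⟩⟩) ?_ hbr
        rintro (_ | ⟨u, z⟩) h
        · rw [SimpleGraph.adj_comm, tetraGraph_adj_none_some] at h
          exact absurd h h0
        · rw [tetraGraph_adj_some_some] at h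
          rcases h with ⟨rfl, h | h⟩ | ⟨hne, h⟩
          · right
            congr 2
            ext
            dsimp only at h ⊢
            omega
          · left
            congr 2
            ext
            dsimp only at h ⊢
            omega
          · dsimp only at h
            omega
    -- A triangle at the corner `v` would pull back to a triangle at `none`, whose neighbours are
    -- pairwise nonadjacent by `hs`.
    obtain ⟨u, hu⟩ : ∃ u, f u = some ⟨v.1 + 1, Fin.last _⟩ := f.surjective _
    have ht := tetraGraph_triangleEdge hv
    rw [← hf, ← hu, SimpleGraph.triangleEdge_map_iff] at ht
    obtain ⟨h1, w, h2, h3⟩ := ht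
    rcases u with _ | u
    · exact h1.ne rfl
    rcases w with _ | w
    · exact h2.ne rfl
    rw [tetraGraph_adj_none_some] at h1 h2
    rw [tetraGraph_adj_some_some] at h3
    have := hs u.1
    omega
  have hcol : ∀ i : Fin 3, ∃ j : Fin 3, f (some ⟨i, 0⟩) = some ⟨j, 0⟩ := by
    intro i
    have h : (tetraGraph s').Adj (f none) (f (some ⟨i, 0⟩)) :=
      f.map_adj_iff.2 (tetraGraph_adj_none_some.2 rfl)
    rw [hnone] at h
    rcases hf : f (some ⟨i, 0⟩) with _ | ⟨j, x⟩
    · rw [hf] at h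
      exact absurd rfl h.ne
    · rw [hf, tetraGraph_adj_none_some] at h
      exact ⟨j, by congr 2; exact Fin.ext h⟩
  choose σ hσ using hcol
  have hinj : Function.Injective σ := by
    intro i j hij
    have : f (some ⟨i, 0⟩) = f (some ⟨j, 0⟩) := by rw [hσ, hσ, hij]
    exact congrArg Sigma.fst (Option.some.inj (f.injective this))
  refine ⟨Equiv.ofBijective _ (Finite.injective_iff_bijective.1 hinj), funext fun i => ?_⟩
  have ht := (tetraGraph_thread_none s ⟨i, 0⟩ rfl).map f
  rw [hnone, hσ] at ht
  exact ht.unique (tetraGraph_thread_none s' ⟨σ i, 0⟩ rfl)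

/-- There are four branch vertices, and the obligatory subdivider on each column adds three: the
triples `u` record the surplus. -/
theorem countUpToIso_isType2 (n : ℕ) :
    EmbeddedGraph.countUpToIso n IsType2 = Nat.card (Quotient (tripleSetoid n 7)) := by
  have hcard : ∀ s : Fin 3 → ℕ,
      Nat.card (Option (Σ i : Fin 3, Fin (s i + 1))) = s 0 + s 1 + s 2 + 4 := fun s => by
    rw [Finite.card_option, card_sigma_fin_three fun i => s i + 1]
    omega
  refine EmbeddedGraph.countUpToIso_eq_card_quotient (tripleSetoid n 7)
    (fun u => tetraDrawing fun i => u.1 i + 1) (fun u => ?_) (fun D => ⟨?_, ?_⟩)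
    fun u v => ⟨?_, ?_⟩
  · exact ⟨Finite.equivFinOfCardEq ((hcard _).trans (by have := u.2; omega))⟩
  · rintro ⟨s, hs, h⟩
    obtain ⟨u, rfl⟩ : ∃ u : Fin 3 → ℕ, s = fun i => u i + 1 :=
      ⟨fun i => s i - 1, funext fun i => (Nat.sub_add_cancel (hs i)).symm⟩
    obtain ⟨e⟩ := h.nonempty_equiv
    have h1 := hcard fun i => u i + 1
    rw [← Nat.card_congr e, Nat.card_fin] at h1
    exact ⟨⟨u, by omega⟩, h⟩
  · rintro ⟨u, h⟩
    exact ⟨_, fun i => Nat.le_add_left 1 _, h⟩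
  · rintro ⟨f, _⟩
    obtain ⟨σ, h⟩ := exists_perm_of_tetraGraph_iso (fun i => Nat.le_add_left 1 _) f
    exact ⟨σ, funext fun i => by simpa using congrFun h i⟩
  · rintro ⟨σ, h⟩
    rw [h]
    exact tetraDrawing_iso (fun i => v.1 i + 1) σ

/-! ### Subdivided complete bipartite graphs `K_{2,3}` -/

theorem thetaGraph_adj_inl_inr {s : Fin 3 → ℕ} {k : Fin 2} {w : Σ i : Fin 3, Fin (s i)} :
    (thetaGraph s).Adj (Sum.inl k) (Sum.inr w) ↔
      (k = 0 ∧ w.2.val = 0) ∨ (k = 1 ∧ w.2.val + 1 = s w.1) := by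
  simp [thetaGraph, SimpleGraph.fromRel_adj]

theorem thetaGraph_adj_inl_inl {s : Fin 3 → ℕ} {k l : Fin 2} :
    ¬ (thetaGraph s).Adj (Sum.inl k) (Sum.inl l) := by
  simp [thetaGraph, SimpleGraph.fromRel_adj]

theorem thetaGraph_adj_inr_inr {s : Fin 3 → ℕ} {v w : Σ i : Fin 3, Fin (s i)} :
    (thetaGraph s).Adj (Sum.inr v) (Sum.inr w) ↔
      v.1 = w.1 ∧ (v.2.val + 1 = w.2.val ∨ w.2.val + 1 = v.2.val) := by
  rw [thetaGraph, SimpleGraph.fromRel_adj]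
  constructor
  · rintro ⟨_, ⟨h, h'⟩ | ⟨h, h'⟩⟩
    · exact ⟨h, Or.inl h'⟩
    · exact ⟨h.symm, Or.inr h'⟩
  · rintro ⟨h, h'⟩
    refine ⟨?_, h'.imp (fun h' => ⟨h, h'⟩) fun h' => ⟨h.symm, h'⟩⟩
    intro e
    obtain rfl := Sum.inr.inj e
    omega

/-- The two ends see the paths in opposite cyclic orders, so a rotation of the paths preserves both
orders and a reflection reverses both. -/
theorem thetaDrawing_iso (s : Fin 3 → ℕ) (σ : Equiv.Perm (Fin 3)) :
    (thetaDrawing (s ∘ σ)).Iso (thetaDrawing s) := by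
  let e : (Fin 2 ⊕ (Σ i : Fin 3, Fin ((s ∘ σ) i))) ≃ (Fin 2 ⊕ (Σ i : Fin 3, Fin (s i))) :=
    Equiv.sumCongr (Equiv.refl _) (Equiv.sigmaCongrLeft (β := fun i => Fin (s i)) σ)
  have hfl : ∀ k, e (Sum.inl k) = Sum.inl k := fun k => rfl
  have hfr : ∀ v, e (Sum.inr v) = Sum.inr ⟨σ v.1, v.2⟩ := fun v => rfl
  let f : thetaGraph (s ∘ σ) ≃g thetaGraph s :=
    ⟨e, fun {v w} => by
      rcases v with k | v <;> rcases w with l | w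
      · rw [hfl, hfl]
        exact iff_of_false thetaGraph_adj_inl_inl thetaGraph_adj_inl_inl
      · rw [hfl, hfr, thetaGraph_adj_inl_inr, thetaGraph_adj_inl_inr]
        rfl
      · rw [hfl, hfr, SimpleGraph.adj_comm, thetaGraph_adj_inl_inr, SimpleGraph.adj_comm,
          thetaGraph_adj_inl_inr]
        rfl
      · rw [hfr, hfr, thetaGraph_adj_inr_inr, thetaGraph_adj_inr_inr]
        simp⟩
  refine EmbeddedGraph.iso_ofAngle_of_forall f ?_
  replace hfl : ∀ k, f (Sum.inl k) = Sum.inl k := hfl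
  replace hfr : ∀ v, f (Sum.inr v) = Sum.inr ⟨σ v.1, v.2⟩ := hfr
  have hang : ∀ v a, thetaAngle s (f (Sum.inr v)) (f a) = thetaAngle (s ∘ σ) (Sum.inr v) a := by
    rintro v (k | a) <;> rfl
  have hadj : ∀ v a b c, (thetaGraph (s ∘ σ)).Adj (Sum.inr v) a →
      (thetaGraph (s ∘ σ)).Adj (Sum.inr v) b → (thetaGraph (s ∘ σ)).Adj (Sum.inr v) c →
      ¬ CycLt (thetaAngle (s ∘ σ) (Sum.inr v) a) (thetaAngle (s ∘ σ) (Sum.inr v) b)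
        (thetaAngle (s ∘ σ) (Sum.inr v) c) := by
    have key : ∀ v a, (thetaGraph (s ∘ σ)).Adj (Sum.inr v) a →
        thetaAngle (s ∘ σ) (Sum.inr v) a = v.2.val ∨
          thetaAngle (s ∘ σ) (Sum.inr v) a = v.2.val + 2 := by
      rintro v (k | a) h
      · rw [SimpleGraph.adj_comm, thetaGraph_adj_inl_inr] at h
        rcases h with ⟨rfl, h⟩ | ⟨rfl, h⟩
        · exact Or.inl h.symm
        · exact Or.inr (congrArg (· + 1) h.symm)
      · rw [thetaGraph_adj_inr_inr] at h
        change a.2.val + 1 = _ ∨ a.2.val + 1 = _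
        omega
    intro v a b c ha hb hc
    have := key v a ha
    have := key v b hb
    have := key v c hc
    unfold CycLt
    omega
  -- For indices at most 2 the subtraction `2 - i` of natural numbers agrees with the one modulo 3,
  -- so the lemmas on `Fin 3` apply at both ends.
  have hinl : ∀ (k : Fin 2) (i : Fin 3),
      (if k = 0 then i.val else 2 - i.val) = (if k = 0 then i else 2 - i).val := by decide
  have hinl' : ∀ k w, thetaAngle (s ∘ σ) (Sum.inl k) (Sum.inr w) =
      (if k = 0 then w.1 else 2 - w.1).val := fun k w => hinl k w.1
  have hinl'' : ∀ k w, thetaAngle s (f (Sum.inl k)) (f (Sum.inr w)) =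
      (if k = 0 then σ w.1 else 2 - σ w.1).val := fun k w => hinl k (σ w.1)
  obtain ⟨t, ht | ht⟩ := Fin.perm_three_eq_add_or_eq_sub σ
  · left
    rintro (k | v) a b c ha hb hc
    · rcases a with (_ | a)
      · exact absurd ha thetaGraph_adj_inl_inl
      rcases b with (_ | b)
      · exact absurd hb thetaGraph_adj_inl_inl
      rcases c with (_ | c)
      · exact absurd hc thetaGraph_adj_inl_inl
      simp only [hinl', hinl'', ht]
      split_ifs
      · exact (cycLt_val_add t _ _ _).symm
      · rw [cycLt_val_sub, cycLt_val_sub, cycLt_val_add]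
    · simp only [hang]
  · right
    rintro (k | v) a b c ha hb hc
    · rcases a with (_ | a)
      · exact absurd ha thetaGraph_adj_inl_inl
      rcases b with (_ | b)
      · exact absurd hb thetaGraph_adj_inl_inl
      rcases c with (_ | c)
      · exact absurd hc thetaGraph_adj_inl_inl
      simp only [hinl', hinl'', ht]
      split_ifs
      · exact (cycLt_val_sub t _ _ _).symm
      · rw [cycLt_val_sub, cycLt_val_sub, cycLt_val_sub]
    · simp only [hang]
      exact iff_of_false (hadj v a b c ha hb hc) (hadj v c b a hc hb ha)

theorem thetaGraph_isBranch_inl {s : Fin 3 → ℕ} (hs : ∀ i, 1 ≤ s i) (k : Fin 2) :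
    (thetaGraph s).IsBranch (Sum.inl k) := by
  have h : ∀ i, ∃ x : Fin (s i), (thetaGraph s).Adj (Sum.inl k) (Sum.inr ⟨i, x⟩) := by
    intro i
    have := hs i
    fin_cases k
    · exact ⟨⟨0, by omega⟩, thetaGraph_adj_inl_inr.2 (Or.inl ⟨rfl, rfl⟩)⟩
    · exact ⟨⟨s i - 1, by omega⟩, thetaGraph_adj_inl_inr.2 (Or.inr ⟨rfl, by dsimp only; omega⟩)⟩
  choose x hx using h
  exact ⟨_, _, _, hx 0, hx 1, hx 2,
    fun h => absurd (congrArg Sigma.fst (Sum.inr.inj h)) (by decide : (0 : Fin 3) ≠ 1),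
    fun h => absurd (congrArg Sigma.fst (Sum.inr.inj h)) (by decide : (1 : Fin 3) ≠ 2),
    fun h => absurd (congrArg Sigma.fst (Sum.inr.inj h)) (by decide : (0 : Fin 3) ≠ 2)⟩

/-- The neighbour of `(i, x)` in the direction of `α₀`. -/
def thetaPred (s : Fin 3 → ℕ) (v : Σ i : Fin 3, Fin (s i)) : Fin 2 ⊕ (Σ i : Fin 3, Fin (s i)) :=
  if v.2.val = 0 then Sum.inl 0 else Sum.inr ⟨v.1, ⟨v.2.val - 1, by omega⟩⟩

/-- The neighbour of `(i, x)` in the direction of `α₁`. -/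
def thetaSucc (s : Fin 3 → ℕ) (v : Σ i : Fin 3, Fin (s i)) : Fin 2 ⊕ (Σ i : Fin 3, Fin (s i)) :=
  if h : v.2.val + 1 = s v.1 then Sum.inl 1 else Sum.inr ⟨v.1, ⟨v.2.val + 1, by omega⟩⟩

theorem thetaPred_ne_thetaSucc (s : Fin 3 → ℕ) (v : Σ i : Fin 3, Fin (s i)) :
    thetaPred s v ≠ thetaSucc s v := by
  unfold thetaPred thetaSucc
  split_ifs
  · simp
  · simp
  · simp
  · intro h
    have := congrArg (fun v : Σ i : Fin 3, Fin (s i) => v.2.val) (Sum.inr.inj h)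
    dsimp only at this
    omega

theorem thetaGraph_adj_inr {s : Fin 3 → ℕ} {v : Σ i : Fin 3, Fin (s i)}
    {y : Fin 2 ⊕ (Σ i : Fin 3, Fin (s i))} :
    (thetaGraph s).Adj (Sum.inr v) y ↔ y = thetaPred s v ∨ y = thetaSucc s v := by
  obtain ⟨i, x⟩ := v
  unfold thetaPred thetaSucc
  rcases y with k | ⟨j, y⟩
  · rw [SimpleGraph.adj_comm, thetaGraph_adj_inl_inr]
    dsimp only
    split_ifs <;> simp only [Sum.inl.injEq, or_false, false_or] <;> tauto
  · rw [thetaGraph_adj_inr_inr]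
    have e : ∀ (m : ℕ) (hm : m < s i), (Sum.inr ⟨j, y⟩ : Fin 2 ⊕ (Σ i : Fin 3, Fin (s i))) =
        Sum.inr ⟨i, ⟨m, hm⟩⟩ ↔ i = j ∧ y.val = m := by
      intro m hm
      constructor
      · intro h
        obtain rfl : j = i := congrArg Sigma.fst (Sum.inr.inj h)
        exact ⟨rfl, congrArg (fun v : Σ i : Fin 3, Fin (s i) => v.2.val) (Sum.inr.inj h)⟩
      · rintro ⟨rfl, rfl⟩
        rfl
    have hy := y.2
    by_cases hij : i = j
    · subst hij
      dsimp only
      split_ifs with h1 h2 h2 <;> simp only [e, true_and, false_or, or_false, iff_false] <;>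
        omega
    · dsimp only
      split_ifs <;> simp [hij, e]

theorem thetaGraph_isBranch_iff {s : Fin 3 → ℕ} (hs : ∀ i, 1 ≤ s i)
    {v : Fin 2 ⊕ (Σ i : Fin 3, Fin (s i))} : (thetaGraph s).IsBranch v ↔ ∃ k, v = Sum.inl k := by
  constructor
  · intro h
    rcases v with k | v
    · exact ⟨k, rfl⟩
    · exact absurd h (SimpleGraph.not_isBranch fun y => thetaGraph_adj_inr.1)
  · rintro ⟨k, rfl⟩
    exact thetaGraph_isBranch_inl hs k

theorem thetaGraph_thread_up {s : Fin 3 → ℕ} (hs : ∀ i, 1 ≤ s i) (d : ℕ) :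
    ∀ v : Σ i : Fin 3, Fin (s i), v.2.val + d + 1 = s v.1 →
      (thetaGraph s).Thread (thetaPred s v) (Sum.inr v) (d + 1) := by
  induction d with
  | zero =>
    intro v hv
    refine .step (thetaPred_ne_thetaSucc s v) (fun y => thetaGraph_adj_inr) ?_
    rw [thetaSucc, dif_pos (by omega)]
    exact .terminal (thetaGraph_isBranch_inl hs 1)
  | succ d ih =>
    intro v hv
    refine .step (thetaPred_ne_thetaSucc s v) (fun y => thetaGraph_adj_inr) ?_
    rw [thetaSucc, dif_neg (by omega)]
    have := ih ⟨v.1, ⟨v.2.val + 1, by omega⟩⟩ (by dsimp only; omega)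
    simpa [thetaPred] using this

theorem thetaGraph_thread_down {s : Fin 3 → ℕ} (hs : ∀ i, 1 ≤ s i) (d : ℕ) :
    ∀ v : Σ i : Fin 3, Fin (s i), v.2.val = d →
      (thetaGraph s).Thread (thetaSucc s v) (Sum.inr v) (d + 1) := by
  induction d with
  | zero =>
    intro v hv
    refine .step (thetaPred_ne_thetaSucc s v).symm
      (fun y => thetaGraph_adj_inr.trans or_comm) ?_
    rw [thetaPred, if_pos hv]
    exact .terminal (thetaGraph_isBranch_inl hs 0)
  | succ d ih =>
    intro v hv
    refine .step (thetaPred_ne_thetaSucc s v).symm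
      (fun y => thetaGraph_adj_inr.trans or_comm) ?_
    rw [thetaPred, if_neg (by omega)]
    have := ih ⟨v.1, ⟨v.2.val - 1, by omega⟩⟩ (by dsimp only; omega)
    have e : thetaSucc s ⟨v.1, ⟨v.2.val - 1, by omega⟩⟩ = Sum.inr v := by
      rw [thetaSucc, dif_neg (by dsimp only; omega)]
      congr 2
      ext
      dsimp only
      omega
    rwa [e] at this

theorem thetaGraph_thread_inl {s : Fin 3 → ℕ} (hs : ∀ i, 1 ≤ s i) {k : Fin 2}
    {v : Σ i : Fin 3, Fin (s i)} (h : (thetaGraph s).Adj (Sum.inl k) (Sum.inr v)) :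
    (thetaGraph s).Thread (Sum.inl k) (Sum.inr v) (s v.1) := by
  have := hs v.1
  rw [thetaGraph_adj_inl_inr] at h
  rcases h with ⟨rfl, h⟩ | ⟨rfl, h⟩
  · have := thetaGraph_thread_up hs (s v.1 - 1) v (by omega)
    rwa [thetaPred, if_pos h, Nat.sub_add_cancel (hs _)] at this
  · have := thetaGraph_thread_down hs _ v rfl
    rwa [thetaSucc, dif_pos h, h] at this

/-- The only branch vertices are the two common ends of the paths, so `f` sends `α₀` to one of them.
The threads starting at an end are the three whole paths. -/
theorem exists_perm_of_thetaGraph_iso {s s' : Fin 3 → ℕ} (hs : ∀ i, 1 ≤ s i)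
    (hs' : ∀ i, 1 ≤ s' i) (f : thetaGraph s ≃g thetaGraph s') :
    ∃ σ : Equiv.Perm (Fin 3), s = s' ∘ σ := by
  obtain ⟨k, hk⟩ := (thetaGraph_isBranch_iff hs').1 ((thetaGraph_isBranch_inl hs 0).map f)
  have hadj : ∀ i : Fin 3, (thetaGraph s).Adj (Sum.inl 0) (Sum.inr ⟨i, ⟨0, hs i⟩⟩) :=
    fun i => thetaGraph_adj_inl_inr.2 (Or.inl ⟨rfl, rfl⟩)
  have hcol : ∀ i : Fin 3, ∃ v, f (Sum.inr ⟨i, ⟨0, hs i⟩⟩) = Sum.inr v ∧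
      (thetaGraph s').Adj (Sum.inl k) (Sum.inr v) := by
    intro i
    have h := f.map_adj_iff.2 (hadj i)
    rw [hk] at h
    rcases hf : f (Sum.inr ⟨i, ⟨0, hs i⟩⟩) with l | v
    · rw [hf] at h
      exact absurd h thetaGraph_adj_inl_inl
    · rw [hf] at h
      exact ⟨v, rfl, h⟩
  choose g hg hg' using hcol
  have hinj : Function.Injective fun i => (g i).1 := by
    intro i j hij
    -- Each end has only one neighbour on each path.
    have hij' : g i = g j := by
      have h1 := hg' i
      have h2 := hg' j
      dsimp only at hij
      rw [thetaGraph_adj_inl_inr] at h1 h2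
      generalize g i = v at *
      generalize g j = w at *
      obtain ⟨v, x⟩ := v
      obtain ⟨w, y⟩ := w
      dsimp only at hij h1 h2
      subst hij
      congr 1
      ext
      rcases h1 with ⟨rfl, h1⟩ | ⟨rfl, h1⟩ <;> simp at h2 <;> omega
    have : f (Sum.inr ⟨i, ⟨0, hs i⟩⟩) = f (Sum.inr ⟨j, ⟨0, hs j⟩⟩) := by rw [hg, hg, hij']
    exact congrArg Sigma.fst (Sum.inr.inj (f.injective this))
  refine ⟨Equiv.ofBijective _ (Finite.injective_iff_bijective.1 hinj), funext fun i => ?_⟩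
  have ht := (thetaGraph_thread_inl hs (hadj i)).map f
  rw [hk, hg] at ht
  exact ht.unique (thetaGraph_thread_inl hs' (hg' i))

/-- Two ends and two obligatory inner vertices on each of the three paths make 8. -/
theorem countUpToIso_isType3 (n : ℕ) :
    EmbeddedGraph.countUpToIso n IsType3 = Nat.card (Quotient (tripleSetoid n 8)) := by
  have hcard : ∀ s : Fin 3 → ℕ,
      Nat.card (Fin 2 ⊕ (Σ i : Fin 3, Fin (s i))) = s 0 + s 1 + s 2 + 2 := fun s => by
    rw [Nat.card_sum, card_sigma_fin_three, Nat.card_fin, add_comm]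
  refine EmbeddedGraph.countUpToIso_eq_card_quotient (tripleSetoid n 8)
    (fun u => thetaDrawing fun i => u.1 i + 2) (fun u => ?_) (fun D => ⟨?_, ?_⟩)
    fun u v => ⟨?_, ?_⟩
  · exact ⟨Finite.equivFinOfCardEq ((hcard _).trans (by have := u.2; omega))⟩
  · rintro ⟨s, hs, h⟩
    obtain ⟨u, rfl⟩ : ∃ u : Fin 3 → ℕ, s = fun i => u i + 2 :=
      ⟨fun i => s i - 2, funext fun i => (Nat.sub_add_cancel (hs i)).symm⟩
    obtain ⟨e⟩ := h.nonempty_equiv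
    have h1 := hcard fun i => u i + 2
    rw [← Nat.card_congr e, Nat.card_fin] at h1
    exact ⟨⟨u, by omega⟩, h⟩
  · rintro ⟨u, h⟩
    exact ⟨_, fun i => Nat.le_add_left 2 _, h⟩
  · rintro ⟨f, _⟩
    obtain ⟨σ, h⟩ := exists_perm_of_thetaGraph_iso (fun i => Nat.le_add_left 1 _)
      (fun i => Nat.le_add_left 1 _) f
    exact ⟨σ, funext fun i => by simpa using congrFun h i⟩
  · rintro ⟨σ, h⟩
    rw [h]
    exact thetaDrawing_iso (fun i => v.1 i + 2) σ

/-! ### Counting orbits of the dihedral group -/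

section Burnside

variable {X : Type} {n : ℕ}

/-- Burnside's lemma for the dihedral group, given by the actions `ρ t` of the rotations `i ↦ i + t`
and `τ t` of the reflections `i ↦ t - i`. -/
theorem card_quotient_mul_eq_sum_fixed [Finite X] [NeZero n] (ρ τ : Fin n → X → X)
    (hρ : ∀ x, ρ 0 x = x) (hρρ : ∀ s t x, ρ s (ρ t x) = ρ (s + t) x)
    (hρτ : ∀ s t x, ρ s (τ t x) = τ (s + t) x) (hτρ : ∀ s t x, τ s (ρ t x) = τ (s - t) x)
    (hττ : ∀ s t x, τ s (τ t x) = ρ (s - t) x) (r : Setoid X)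
    (hr : ∀ x y, r x y ↔ ∃ t, ρ t x = y ∨ τ t x = y) :
    Nat.card (Quotient r) * (2 * n) =
      ∑ t, Nat.card {x // ρ t x = x} + ∑ t, Nat.card {x // τ t x = x} := by
  classical
  -- For a successor, `ZMod n`, which indexes the elements of `DihedralGroup n`, is `Fin n` by
  -- definition.
  obtain ⟨m, rfl⟩ : ∃ m, n = m + 1 := ⟨n - 1, (Nat.succ_pred_eq_of_ne_zero (NeZero.ne n)).symm⟩
  -- The sign is needed because `r i * sr j = sr (j - i)`, whereas `ρ s ∘ τ t = τ (s + t)`.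
  let act : DihedralGroup (m + 1) → X → X := fun g x =>
    match g with
    | .r i => ρ i x
    | .sr i => τ (-i) x
  let : MulAction (DihedralGroup (m + 1)) X :=
    { smul := act
      one_smul := hρ
      mul_smul := by
        rintro (i | i) (j | j) x
        · exact (hρρ i j x).symm
        · refine ((hρτ i (-j) x).trans ?_).symm
          exact congrFun (congrArg τ (show (i : Fin (m + 1)) + -j = -(j - i) by abel)) x
        · refine ((hτρ (-i) j x).trans ?_).symm
          exact congrFun (congrArg τ (show -(i : Fin (m + 1)) - j = -(i + j) by abel)) x
        · refine ((hττ (-i) (-j) x).trans ?_).symm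
          exact congrFun (congrArg ρ (show -(i : Fin (m + 1)) - -j = j - i by abel)) x }
  have : Fintype X := Fintype.ofFinite X
  have key := MulAction.sum_card_fixedBy_eq_card_orbits_mul_card_group (DihedralGroup (m + 1)) X
  have horb : r = MulAction.orbitRel (DihedralGroup (m + 1)) X := by
    ext x y
    rw [hr, MulAction.orbitRel_apply]
    have hsymm : (x ∈ MulAction.orbit (DihedralGroup (m + 1)) y) ↔
        y ∈ MulAction.orbit (DihedralGroup (m + 1)) x := MulAction.mem_orbit_symm
    rw [hsymm]
    constructor
    · rintro ⟨t, h | h⟩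
      · exact ⟨.r t, h⟩
      · refine ⟨.sr (-t : Fin (m + 1)), ?_⟩
        refine Eq.trans ?_ h
        exact congrFun (congrArg τ (neg_neg (t : Fin (m + 1)))) x
    · rintro ⟨i | i, h⟩
      · exact ⟨i, Or.inl h⟩
      · exact ⟨(-i : Fin (m + 1)), Or.inr h⟩
  rw [DihedralGroup.card, ← Nat.card_eq_fintype_card] at key
  rw [horb, ← key]
  let e : Fin (m + 1) ⊕ Fin (m + 1) ≃ DihedralGroup (m + 1) :=
    { toFun := Sum.elim (fun i => .r i) (fun i => .sr i)
      invFun := fun g => match g with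
        | .r i => Sum.inl i
        | .sr i => Sum.inr i
      left_inv := by rintro (i | i) <;> rfl
      right_inv := by rintro (i | i) <;> rfl }
  rw [← e.sum_comp, Fintype.sum_sum_type]
  congr 1
  · refine Finset.sum_congr rfl fun t _ => ?_
    rw [← Nat.card_eq_fintype_card]
    rfl
  · rw [← Equiv.sum_comp (Equiv.neg (Fin (m + 1)))]
    refine Finset.sum_congr rfl fun t _ => ?_
    rw [← Nat.card_eq_fintype_card]
    have h : ∀ x, act (.sr (-t : Fin (m + 1))) x = τ t x := fun x =>
      congrFun (congrArg τ (neg_neg t)) x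
    refine Nat.card_congr (Equiv.subtypeEquivRight fun x => ?_)
    rw [← h x]
    rfl

/-- Conjugation by `ρ s` turns `τ t` into `τ (s + s + t)`, and conjugate maps have equally many
fixed points. -/
theorem card_fixed_reflection_add [NeZero n] (ρ τ : Fin n → X → X)
    (hρ : ∀ x, ρ 0 x = x) (hρρ : ∀ s t x, ρ s (ρ t x) = ρ (s + t) x)
    (hρτ : ∀ s t x, ρ s (τ t x) = τ (s + t) x) (hτρ : ∀ s t x, τ s (ρ t x) = τ (s - t) x)
    (s t : Fin n) : Nat.card {x // τ (s + s + t) x = x} = Nat.card {x // τ t x = x} := by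
  have h1 : ∀ x, τ t x = x → τ (s + s + t) (ρ s x) = ρ s x := fun x h => by
    have h := congrArg (ρ s) h
    rw [hρτ] at h
    rw [hτρ, ← h]
    congr 1
    abel
  have h2 : ∀ x, τ (s + s + t) x = x → τ t (ρ (-s) x) = ρ (-s) x := fun x h => by
    have h := congrArg (ρ (-s)) h
    rw [hρτ] at h
    rw [hτρ, ← h]
    congr 1
    abel
  exact (Nat.card_congr ⟨fun x => ⟨ρ s x.1, h1 _ x.2⟩, fun x => ⟨ρ (-s) x.1, h2 _ x.2⟩,
    fun x => by simp [hρρ, hρ], fun x => by simp [hρρ, hρ]⟩).symm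

/-- Burnside's lemma for the dihedral group with the reflections sorted into conjugacy classes. -/
theorem card_quotient_mul_eq_sum_fixed_rotation [Finite X] [NeZero n] (ρ τ : Fin n → X → X)
    (hρ : ∀ x, ρ 0 x = x) (hρρ : ∀ s t x, ρ s (ρ t x) = ρ (s + t) x)
    (hρτ : ∀ s t x, ρ s (τ t x) = τ (s + t) x) (hτρ : ∀ s t x, τ s (ρ t x) = τ (s - t) x)
    (hττ : ∀ s t x, τ s (τ t x) = ρ (s - t) x) (r : Setoid X)
    (hr : ∀ x y, r x y ↔ ∃ t, ρ t x = y ∨ τ t x = y) :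
    Nat.card (Quotient r) * (2 * n) =
      ∑ t, Nat.card {x // ρ t x = x} + ((n + 1) / 2 * Nat.card {x // τ 0 x = x} +
        n / 2 * Nat.card {x // τ 1 x = x}) := by
  rw [card_quotient_mul_eq_sum_fixed ρ τ hρ hρρ hρτ hτρ hττ r hr]
  congr 1
  -- Write `t` as twice `t / 2` plus its parity. For odd `n` all the reflections are conjugate, but
  -- the distinction does no harm.
  have h : ∀ t : Fin n, Nat.card {x // τ t x = x} =
      if t.val % 2 = 0 then Nat.card {x // τ 0 x = x} else Nat.card {x // τ 1 x = x} := by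
    intro t
    have := t.2
    split_ifs with ht
    · rw [← card_fixed_reflection_add ρ τ hρ hρρ hρτ hτρ (Fin.ofNat n (t.val / 2)) 0]
      have e : Fin.ofNat n (t.val / 2) + Fin.ofNat n (t.val / 2) + 0 = t := by
        ext
        simp only [Fin.val_add, Fin.ofNat, Nat.mod_add_mod, Nat.add_mod_mod, add_zero]
        rw [Nat.mod_eq_of_lt (by omega)]
        · omega
      rw [e]
    · rw [← card_fixed_reflection_add ρ τ hρ hρρ hρτ hτρ (Fin.ofNat n (t.val / 2)) 1]
      have e : Fin.ofNat n (t.val / 2) + Fin.ofNat n (t.val / 2) + 1 = t := by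
        ext
        simp only [Fin.val_add, Fin.ofNat, Nat.mod_add_mod, Nat.add_mod_mod, Fin.val_one']
        rw [Nat.mod_eq_of_lt (by omega)]
        · omega
      rw [e]
  rw [Finset.sum_congr rfl fun t _ => h t]
  generalize Nat.card {x // τ 0 x = x} = A
  generalize Nat.card {x // τ 1 x = x} = B
  -- Below `n` there are `(n + 1) / 2` even and `n / 2` odd numbers.
  rw [Fin.sum_univ_eq_sum_range (fun t => if t % 2 = 0 then A else B) n]
  clear * -
  induction n with
  | zero => simp
  | succ n ih =>
    rw [Finset.sum_range_succ, ih]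
    split_ifs with h
    · rw [show (n + 1 + 1) / 2 = (n + 1) / 2 + 1 by omega, show (n + 1) / 2 = n / 2 by omega]
      ring
    · rw [show (n + 1 + 1) / 2 = (n + 1) / 2 by omega, show (n + 1) / 2 = n / 2 + 1 by omega]
      ring

end Burnside

/-! ### Invariant subsets of a polygon -/

section InvariantSets

variable {n : ℕ} [NeZero n]

/-- Read as a predicate on the natural numbers, membership has the periods `n` and `t`, hence by
Bézout the period `gcd n t`. -/
theorem Fin.mem_iff_ofNat_mod_gcd_mem {S : Set (Fin n)} {t : Fin n}
    (h : ∀ i, i ∈ S ↔ i + t ∈ S) (i : Fin n) :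
    i ∈ S ↔ Fin.ofNat n (i.val % n.gcd t.val) ∈ S := by
  let P : ℕ → Prop := fun x => Fin.ofNat n x ∈ S
  have hn : Function.Periodic P n := fun x => by
    change (Fin.ofNat n (x + n) ∈ S) = (Fin.ofNat n x ∈ S)
    congr 1
    ext
    simp
  have ht : Function.Periodic P t.val := fun x => by
    change (Fin.ofNat n (x + t.val) ∈ S) = (Fin.ofNat n x ∈ S)
    rw [h (Fin.ofNat n x), eq_iff_iff]
    have : Fin.ofNat n (x + t.val) = Fin.ofNat n x + t := by
      ext
      simp [Fin.val_add]
    rw [this]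
  have hg : Function.Periodic P (n.gcd t.val) := by
    rcases Nat.eq_zero_or_pos t.val with h0 | h0
    · rw [h0, Nat.gcd_zero_right]
      exact hn
    -- A multiple of `t` is congruent to the gcd modulo `n`; this form of Bézout's identity needs
    -- the gcd to be smaller than `n`, which fails for `t = 0`.
    · obtain ⟨m, hm⟩ := Nat.exists_mul_mod_eq_gcd (n := t.val) (k := n)
        ((Nat.gcd_le_left n h0).trans_lt t.2)
      intro x
      rw [Nat.gcd_comm, ← hm.2, ← (hn.nat_mul (t.val * m / n)) (x + t.val * m % n)]
      have e : x + t.val * m % n + t.val * m / n * n = x + m * t.val := by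
        rw [add_assoc, mul_comm (t.val * m / n), Nat.mod_add_div, mul_comm]
      rw [Nat.cast_id, e]
      exact ht.nat_mul m x
  have := hg.map_mod_nat i.val
  have hi : Fin.ofNat n i.val = i := by simp
  change (Fin.ofNat n _ ∈ S) = (Fin.ofNat n _ ∈ S) at this
  rw [this, hi]

/-- The number of subsets of a polygon that are invariant under the rotation by `t`. -/
theorem card_sets_fixed_rotation (t : Fin n) :
    Nat.card {S : Set (Fin n) // ∀ i, i ∈ S ↔ i + t ∈ S} = 2 ^ n.gcd t.val := by
  have hn : 0 < n := Nat.pos_of_ne_zero (NeZero.ne n)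
  have hg : 0 < n.gcd t.val := Nat.gcd_pos_of_pos_left _ hn
  have hgn : n.gcd t.val ≤ n := Nat.gcd_le_left _ hn
  have hcard : Nat.card (Set (Fin (n.gcd t.val))) = 2 ^ n.gcd t.val := by
    simp
  rw [← hcard]
  refine Nat.card_congr ⟨fun S => {i | Fin.ofNat n i.val ∈ S.1},
    fun T => ⟨{i | ⟨i.val % n.gcd t.val, Nat.mod_lt _ hg⟩ ∈ T}, fun i => ?_⟩, ?_, ?_⟩
  · have e : (i + t).val % n.gcd t.val = i.val % n.gcd t.val := by
      rw [Fin.val_add, Nat.mod_mod_of_dvd _ (Nat.gcd_dvd_left _ _), Nat.add_mod,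
        Nat.mod_eq_zero_of_dvd (Nat.gcd_dvd_right n t.val), add_zero, Nat.mod_mod]
    simp only [Set.mem_ofPred_eq, e]
  · rintro ⟨S, hS⟩
    ext i
    exact (Fin.mem_iff_ofNat_mod_gcd_mem hS i).symm
  · intro T
    ext i
    have hi := i.2
    have : (Fin.ofNat n i.val).val % n.gcd t.val = i.val := by
      rw [Fin.ofNat, Fin.val_mk, Nat.mod_eq_of_lt (hi.trans_le hgn), Nat.mod_eq_of_lt hi]
    simp only [Set.mem_ofPred_eq, this]

/-- The number of subsets invariant under an involution `σ`, if every orbit has exactly one element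
in `H`. -/
theorem card_sets_fixed_involution {α : Type} [Fintype α] (σ : α → α) (hσ : ∀ x, σ (σ x) = x)
    (H : Finset α) (h1 : ∀ x, x ∈ H ∨ σ x ∈ H) (h2 : ∀ x, x ∈ H → σ x ∈ H → σ x = x) :
    Nat.card {S : Set α // ∀ x, x ∈ S ↔ σ x ∈ S} = 2 ^ H.card := by
  have hcard : Nat.card (Set H) = 2 ^ H.card := by
    simp
  rw [← hcard]
  refine Nat.card_congr ⟨fun S => {x | x.1 ∈ S.1},
    fun T => ⟨{x | ∃ y ∈ T, x = y.1 ∨ x = σ y.1}, fun x => ?_⟩, ?_, ?_⟩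
  · constructor
    · rintro ⟨y, hy, rfl | rfl⟩
      · exact ⟨y, hy, Or.inr rfl⟩
      · exact ⟨y, hy, Or.inl (hσ _)⟩
    · rintro ⟨y, hy, h | h⟩
      · exact ⟨y, hy, Or.inr (by rw [← h, hσ])⟩
      · exact ⟨y, hy, Or.inl (by rw [← hσ x, h, hσ])⟩
  · rintro ⟨S, hS⟩
    ext x
    constructor
    · rintro ⟨y, hy, rfl | rfl⟩
      · exact hy
      · exact (hS _).1 hy
    · intro hx
      rcases h1 x with h | h
      · exact ⟨⟨x, h⟩, hx, Or.inl rfl⟩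
      · exact ⟨⟨σ x, h⟩, (hS x).1 hx, Or.inr (hσ x).symm⟩
  · intro T
    ext x
    constructor
    · rintro ⟨y, hy, h | h⟩
      · rwa [Subtype.ext h]
      · have := h2 y.1 y.2 (h ▸ x.2)
        rw [this] at h
        rwa [Subtype.ext h]
    · intro hx
      exact ⟨x, hx, Or.inl rfl⟩

theorem Fin.card_filter_val_mem_Icc {a b : ℕ} (h : b < n) :
    (Finset.univ.filter fun i : Fin n => a ≤ i.val ∧ i.val ≤ b).card = b + 1 - a := by
  rw [← Nat.card_Icc, ← Finset.card_map Fin.valEmbedding]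
  congr 1
  ext x
  simp only [Finset.mem_map, Finset.mem_filter, Finset.mem_univ, true_and, Fin.valEmbedding_apply,
    Finset.mem_Icc]
  constructor
  · rintro ⟨i, hi, rfl⟩
    exact hi
  · intro hx
    exact ⟨⟨x, by omega⟩, hx, rfl⟩

/-- The numbers `0, …, n / 2` represent the pairs `i, n - i`. -/
theorem card_sets_fixed_neg :
    Nat.card {S : Set (Fin n) // ∀ i, i ∈ S ↔ 0 - i ∈ S} = 2 ^ (n / 2 + 1) := by
  have hn : 0 < n := Nat.pos_of_ne_zero (NeZero.ne n)
  have hval : ∀ i : Fin n, (0 - i).val = if i.val = 0 then 0 else n - i.val := by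
    intro i
    rw [Fin.val_sub_eq_ite, Fin.val_zero]
    split_ifs <;> omega
  rw [card_sets_fixed_involution (fun i : Fin n => 0 - i) (by simp)
    (Finset.univ.filter fun i : Fin n => 0 ≤ i.val ∧ i.val ≤ n / 2),
    Fin.card_filter_val_mem_Icc (by omega)]
  · rfl
  · intro i
    simp only [Finset.mem_filter, Finset.mem_univ, true_and, hval]
    split_ifs <;> omega
  · intro i
    simp only [Finset.mem_filter, Finset.mem_univ, true_and, hval, Fin.ext_iff]
    split_ifs <;> omega

/-- The numbers `1, …, (n + 1) / 2` represent the pairs `i, n + 1 - i`, where `n` stands for 0. -/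
theorem card_sets_fixed_one_sub (hn : 2 ≤ n) :
    Nat.card {S : Set (Fin n) // ∀ i, i ∈ S ↔ 1 - i ∈ S} = 2 ^ ((n + 1) / 2) := by
  have h1 : (1 : Fin n).val = 1 := by rw [Fin.val_one', Nat.mod_eq_of_lt (by omega)]
  rw [card_sets_fixed_involution (fun i : Fin n => 1 - i) (by simp)
    (Finset.univ.filter fun i : Fin n => 1 ≤ i.val ∧ i.val ≤ (n + 1) / 2)]
  · rcases Nat.lt_or_ge ((n + 1) / 2) n with h | h
    · rw [Fin.card_filter_val_mem_Icc h]
      rfl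
    · omega
  · intro i
    simp only [Finset.mem_filter, Finset.mem_univ, true_and, Fin.val_sub_eq_ite, h1]
    split_ifs <;> omega
  · intro i
    simp only [Finset.mem_filter, Finset.mem_univ, true_and, Fin.val_sub_eq_ite, h1, Fin.ext_iff]
    split_ifs <;> omega

/-- There are `φ(n / d)` numbers below `n` whose gcd with `n` is `d`; afterwards `d` is replaced by
`n / d`. -/
theorem sum_two_pow_gcd (n : ℕ) (hn : 0 < n) :
    ∑ t ∈ Finset.range n, 2 ^ n.gcd t = ∑ d ∈ n.divisors, d.totient * 2 ^ (n / d) := by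
  rw [← Finset.sum_fiberwise_of_maps_to (g := fun t => n.gcd t) (t := n.divisors)
    fun t _ => Nat.mem_divisors.2 ⟨Nat.gcd_dvd_left n t, hn.ne'⟩]
  rw [← Nat.sum_div_divisors n fun d => d.totient * 2 ^ (n / d)]
  refine Finset.sum_congr rfl fun d hd => ?_
  rw [Nat.mem_divisors] at hd
  rw [Nat.totient_div_of_dvd hd.1, Nat.div_div_self hd.1 hd.2,
    Finset.sum_congr rfl fun t ht => by rw [(Finset.mem_filter.1 ht).2], Finset.sum_const,
    smul_eq_mul]

end InvariantSets

/-! ### Wheels -/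

/-- Of two candidates one would lie between `a` and the other. So the walk around a face is
deterministic. -/
theorem EmbeddedGraph.IsNext.unique {V : Type} {D : EmbeddedGraph V} {v a b b' : V}
    (h : D.IsNext v a b) (h' : D.IsNext v a b') : b = b' := by
  obtain ⟨ha, hb, h1, h2⟩ := h
  obtain ⟨_, hb', h1', h2'⟩ := h'
  by_contra hne
  have hba : b ≠ a := fun e => hne (e.trans (h2 e b' hb').symm)
  have hba' : b' ≠ a := fun e => hne ((h2' e b hb).trans e.symm)
  rcases D.cyc_total v a b b' ha hb hb' hba.symm hne hba'.symm with h | h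
  · exact h1' b h
  · exact h1 b' (D.cyc_rotate _ _ _ _ (D.cyc_rotate _ _ _ _ h))

section Wheel

variable {m : ℕ} [NeZero m] {R : Set (Fin m)}

theorem wheelGraph_adj_none_some {i : Fin m} :
    (wheelGraph m R).Adj none (some i) ↔ i ∈ R := by
  simp [wheelGraph, SimpleGraph.fromRel_adj]

theorem Fin.add_one_ne_self (hm : 2 ≤ m) (i : Fin m) : i + 1 ≠ i := by
  intro h
  have h1 : (1 : Fin m) = 0 := by simpa using h
  have := congrArg Fin.val h1
  rw [Fin.val_one', Nat.mod_eq_of_lt (by omega)] at this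
  simp at this

theorem wheelGraph_adj_some_some (hm : 3 ≤ m) {i j : Fin m} :
    (wheelGraph m R).Adj (some i) (some j) ↔ j = i + 1 ∨ i = j + 1 := by
  simp only [wheelGraph, SimpleGraph.fromRel_adj]
  refine ⟨fun h => h.2, fun h => ⟨fun e => ?_, h⟩⟩
  obtain rfl := Option.some.inj e
  rcases h with h | h <;> exact Fin.add_one_ne_self (by omega) i h.symm

theorem wheelGraph_adj_some (hm : 3 ≤ m) {i : Fin m} {x : Option (Fin m)} :
    (wheelGraph m R).Adj (some i) x ↔
      x = some (i + 1) ∨ (x = none ∧ i ∈ R) ∨ x = some (i - 1) := by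
  rcases x with _ | j
  · rw [SimpleGraph.adj_comm, wheelGraph_adj_none_some]
    simp
  · rw [wheelGraph_adj_some_some hm]
    simp [eq_sub_iff_add_eq, eq_comm]

theorem wheelAngle_succ (i : Fin m) : wheelAngle m (some i) (some (i + 1)) = 0 := by
  simp [wheelAngle]

theorem Fin.sub_one_ne_add_one (hm : 3 ≤ m) (i : Fin m) : i - 1 ≠ i + 1 := by
  intro h
  rw [sub_eq_iff_eq_add] at h
  exact Fin.add_one_add_one_ne hm i h.symm

theorem wheelAngle_pred (hm : 3 ≤ m) (i : Fin m) : wheelAngle m (some i) (some (i - 1)) = 2 := by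
  simp only [wheelAngle]
  rw [if_neg (Fin.sub_one_ne_add_one hm i)]

theorem wheelDrawing_cyc {v a b c : Option (Fin m)} :
    (wheelDrawing m R).cyc v a b c ↔ ((wheelGraph m R).Adj v a ∧ (wheelGraph m R).Adj v b ∧
      (wheelGraph m R).Adj v c) ∧
      CycLt (wheelAngle m v a) (wheelAngle m v b) (wheelAngle m v c) := Iff.rfl

/-- At a rim vertex the only angles are 0 for the successor, 1 for the hub and 2 for the
predecessor, so the claims about consecutive edges become finite checks. -/
theorem wheelDrawing_not_cyc_some (hm : 3 ≤ m) {i : Fin m} {a b : Option (Fin m)}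
    (h : ∀ c, ((c = 0 ∨ c = 2) ∨ (c = 1 ∧ i ∈ R)) →
      ¬ CycLt (wheelAngle m (some i) a) c (wheelAngle m (some i) b)) (c : Option (Fin m)) :
    ¬ (wheelDrawing m R).cyc (some i) a c b := by
  rintro hc
  rw [wheelDrawing_cyc] at hc
  obtain ⟨⟨_, hc, _⟩, hh⟩ := hc
  refine h _ ?_ hh
  rcases (wheelGraph_adj_some hm).1 hc with rfl | ⟨rfl, hi⟩ | rfl
  · exact Or.inl (Or.inl (wheelAngle_succ i))
  · exact Or.inr ⟨rfl, hi⟩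
  · exact Or.inl (Or.inr (wheelAngle_pred hm i))

/-- This and the next three lemmas give the turns at a rim vertex: from the successor to the hub, on
to the predecessor and back to the successor, the hub being skipped if there is no radius. -/
theorem wheelDrawing_isNext_succ_none (hm : 3 ≤ m) {i : Fin m} (hi : i ∈ R) :
    (wheelDrawing m R).IsNext (some i) (some (i + 1)) none := by
  refine ⟨(wheelGraph_adj_some hm).2 (Or.inl rfl),
    (wheelGraph_adj_some hm).2 (Or.inr (Or.inl ⟨rfl, hi⟩)),
    wheelDrawing_not_cyc_some hm fun c hc => ?_, by simp⟩
  rw [wheelAngle_succ, show wheelAngle m (some i) none = 1 from rfl]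
  rintro hh
  unfold CycLt at hh
  omega

theorem wheelDrawing_isNext_succ_pred (hm : 3 ≤ m) {i : Fin m} (hi : i ∉ R) :
    (wheelDrawing m R).IsNext (some i) (some (i + 1)) (some (i - 1)) := by
  refine ⟨(wheelGraph_adj_some hm).2 (Or.inl rfl),
    (wheelGraph_adj_some hm).2 (Or.inr (Or.inr rfl)),
    wheelDrawing_not_cyc_some hm fun c hc => ?_,
    fun h => absurd (Option.some.inj h) (Fin.sub_one_ne_add_one hm i)⟩
  rw [wheelAngle_succ, wheelAngle_pred hm]
  rintro hh
  simp only [hi, and_false, or_false] at hc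
  unfold CycLt at hh
  omega

theorem wheelDrawing_isNext_none_pred (hm : 3 ≤ m) {i : Fin m} (hi : i ∈ R) :
    (wheelDrawing m R).IsNext (some i) none (some (i - 1)) := by
  refine ⟨(wheelGraph_adj_some hm).2 (Or.inr (Or.inl ⟨rfl, hi⟩)),
    (wheelGraph_adj_some hm).2 (Or.inr (Or.inr rfl)),
    wheelDrawing_not_cyc_some hm fun c hc => ?_, by simp⟩
  rw [wheelAngle_pred hm, show wheelAngle m (some i) none = 1 from rfl]
  rintro hh
  unfold CycLt at hh
  omega

theorem wheelDrawing_isNext_pred_succ (hm : 3 ≤ m) (i : Fin m) :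
    (wheelDrawing m R).IsNext (some i) (some (i - 1)) (some (i + 1)) := by
  refine ⟨(wheelGraph_adj_some hm).2 (Or.inr (Or.inr rfl)),
    (wheelGraph_adj_some hm).2 (Or.inl rfl),
    wheelDrawing_not_cyc_some hm fun c hc => ?_,
    fun h => absurd (Option.some.inj h).symm (Fin.sub_one_ne_add_one hm i)⟩
  rw [wheelAngle_succ, wheelAngle_pred hm]
  rintro hh
  unfold CycLt at hh
  omega

/-- Translation by `-p` turns the cyclic order at the hub into the order of the differences `x - p`,
where `q` comes first. -/
theorem wheelDrawing_isNext_hub {p q : Fin m} (hp : p ∈ R) (hq : q ∈ R) (hpq : p ≠ q)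
    (h : ∀ x ∈ R, x ≠ p → (q - p).val ≤ (x - p).val) :
    (wheelDrawing m R).IsNext none (some p) (some q) := by
  refine ⟨wheelGraph_adj_none_some.2 hp, wheelGraph_adj_none_some.2 hq, ?_,
    fun e => absurd (Option.some.inj e).symm hpq⟩
  rintro (_ | x) hc
  · exact (wheelDrawing_cyc.1 hc).1.2.1.ne rfl
  · rw [wheelDrawing_cyc] at hc
    obtain ⟨⟨_, hx, _⟩, hc⟩ := hc
    rw [wheelGraph_adj_none_some] at hx
    change CycLt p.val x.val q.val at hc
    rw [← cycLt_val_add (-p), ← sub_eq_add_neg, ← sub_eq_add_neg, ← sub_eq_add_neg, sub_self] at hc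
    have hxp : x ≠ p := by
      rintro rfl
      rw [sub_self] at hc
      unfold CycLt at hc
      omega
    have := h x hx hxp
    unfold CycLt at hc
    simp only [Fin.val_zero] at hc
    omega

/-- The face entered along the radius at `i` follows the rim through `i, i - 1, …, i + 1`: no radius
interrupts it before `i + 1`. -/
theorem wheelDrawing_isOuterplane_of_subset (hm : 3 ≤ m) (hR : R.Nonempty) {i : Fin m}
    (h : R ⊆ {i, i + 1}) : (wheelDrawing m R).IsOuterplane := by
  -- Otherwise the only radius is the one at `i + 1`, which can then take the role of `i`.
  wlog hi : i ∈ R generalizing i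
  · obtain ⟨x, hx⟩ := hR
    have hx1 : ∀ x ∈ R, x = i + 1 := fun x hx => (h hx).resolve_left fun e => hi (e ▸ hx)
    exact this (i := i + 1) (fun x hx => Or.inl (hx1 x hx)) (hx1 x hx ▸ hx)
  refine ⟨(none, some i), wheelGraph_adj_none_some.2 hi, ?_⟩
  have base : Relation.ReflTransGen (wheelDrawing m R).FaceStep (none, some i)
      (some i, some (i - 1)) :=
    .single ⟨rfl, wheelDrawing_isNext_none_pred hm hi⟩
  -- The vertex `i + 1` is left out because it may carry a radius, where the walk turns to the hub.
  have rim : ∀ z, i - z ≠ i + 1 → Relation.ReflTransGen (wheelDrawing m R).FaceStep (none, some i)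
      (some (i - z), some (i - z - 1)) := by
    refine Fin.induction_add_one (by simpa using fun _ => base) fun z ih hz => ?_
    by_cases h1 : i - (z + 1) = i
    · rw [h1]
      exact base
    · have h2 : i - z ≠ i + 1 := fun e => h1 (by rw [← sub_sub, e, add_sub_cancel_right])
      refine (ih h2).tail ⟨congrArg some (sub_sub _ _ _).symm, ?_⟩
      have := wheelDrawing_isNext_succ_pred (R := R) hm (i := i - z - 1) fun hh =>
        (h hh).elim (fun e => h1 (by rw [← sub_sub, e])) fun e => hz (by rw [← sub_sub]; exact e)
      rw [sub_add_cancel] at this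
      simpa [sub_sub] using this
  replace rim : ∀ y, y ≠ i + 1 → Relation.ReflTransGen (wheelDrawing m R).FaceStep (none, some i)
      (some y, some (y - 1)) := fun y hy => by
    simpa using rim (i - y) (by simpa using hy)
  rintro (_ | y)
  · exact ⟨some i, .refl⟩
  · by_cases hy : y = i + 1
    · subst hy
      have h1 := rim (i + 1 + 1) (Fin.add_one_ne_self (by omega) _)
      rw [add_sub_cancel_right] at h1
      by_cases h2 : i + 1 ∈ R
      · exact ⟨none, h1.tail ⟨rfl, wheelDrawing_isNext_succ_none hm h2⟩⟩
      · exact ⟨_, h1.tail ⟨rfl, wheelDrawing_isNext_succ_pred hm h2⟩⟩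
    · exact ⟨_, rim y hy⟩

theorem Fin.val_sub_one_sub {x p : Fin m} (hm : 2 ≤ m) (h : x ≠ p) :
    (x - 1 - p).val + 1 = (x - p).val := by
  have h1 : (1 : Fin m).val = 1 := by rw [Fin.val_one', Nat.mod_eq_of_lt (by omega)]
  have h2 : x.val ≠ p.val := fun e => h (Fin.ext e)
  have := x.2
  have := p.2
  simp only [Fin.val_sub_eq_ite, h1]
  split_ifs <;> omega

/-- If the radii do not end in two adjacent vertices or in one vertex, then the face next to the rim
that lies counterclockwise from the radius at `p` misses the vertex `p - 1`. -/
theorem wheelDrawing_not_reachable_of_mem (hm : 3 ≤ m) (hR : ∀ i, ¬ R ⊆ {i, i + 1}) {p : Fin m}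
    (hp : p ∈ R) {e : Option (Fin m) × Option (Fin m)}
    (he : e = (some p, none) ∨ ∃ x, x ≠ p ∧ (∀ q ∈ R, q ≠ p → (x - p).val ≤ (q - p).val) ∧
      e = (some x, some (x - 1))) (w : Option (Fin m)) :
    ¬ Relation.ReflTransGen (wheelDrawing m R).FaceStep e (some (p - 1), w) := by
  have h1 : (1 : Fin m).val = 1 := by rw [Fin.val_one', Nat.mod_eq_of_lt (by omega)]
  have hne' : (R \ {p}).Nonempty := by
    by_contra h
    rw [Set.not_nonempty_iff_eq_empty, Set.sdiff_eq_empty] at h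
    exact hR p (h.trans (Set.singleton_subset_iff.2 (Or.inl rfl)))
  -- The next radius counterclockwise from the one at `p` ends in `q`.
  obtain ⟨q, ⟨hq, hqp⟩, hqmin⟩ :=
    Set.exists_min_image (R \ {p}) (fun q => (q - p).val) (Set.toFinite _) hne'
  replace hqp : q ≠ p := hqp
  replace hqmin : ∀ z ∈ R, z ≠ p → (q - p).val ≤ (z - p).val := fun z hz hzp => hqmin z ⟨hz, hzp⟩
  -- Otherwise all ends of radii except `p` coincide with `p - 1`, and `R` lies in the side `p - 1,
  -- p`.
  have hlt : (q - p).val + 1 < m := by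
    by_contra hlt
    refine hR (p - 1) fun z hz => ?_
    by_cases hzp : z = p
    · right
      rw [hzp, sub_add_cancel]
      rfl
    · left
      have := hqmin z hz hzp
      have := (z - p).2
      have h2 : (z - p).val = (0 - 1 : Fin m).val := by
        rw [Fin.val_sub_eq_ite (0 : Fin m) 1, h1, Fin.val_zero]
        split_ifs <;> omega
      have h3 : z - p = 0 - 1 := Fin.ext h2
      rw [sub_eq_iff_eq_add] at h3
      rw [h3]
      abel
  -- These are the directed edges around the sector between the radii at `p` and `q`. The set is
  -- closed under `FaceStep`.
  let F : Option (Fin m) × Option (Fin m) → Prop := fun e =>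
    e = (none, some q) ∨ e = (some p, none) ∨
      ∃ z, z ≠ p ∧ (z - p).val ≤ (q - p).val ∧ e = (some z, some (z - 1))
  have hstep : ∀ d e, F d → (wheelDrawing m R).FaceStep d e → F e := by
    rintro d ⟨e1, e2⟩ hd ⟨he, hn⟩
    dsimp only at he hn
    subst he
    rcases hd with rfl | rfl | ⟨z, hz, hzq, rfl⟩
    · right
      right
      exact ⟨q, hqp, le_rfl, by rw [hn.unique (wheelDrawing_isNext_none_pred hm hq)]⟩
    · left
      rw [hn.unique (wheelDrawing_isNext_hub hp hq hqp.symm hqmin)]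
    · right
      have h2 := Fin.val_sub_one_sub (by omega) hz
      by_cases hzR : z - 1 ∈ R
      · left
        have h3 : z - 1 = p := by
          by_contra h3
          have := hqmin _ hzR h3
          omega
        have := wheelDrawing_isNext_succ_none hm hzR
        rw [sub_add_cancel] at this
        rw [hn.unique this, h3]
      · right
        refine ⟨z - 1, fun e => hzR (e ▸ hp), by omega, ?_⟩
        have := wheelDrawing_isNext_succ_pred hm hzR
        rw [sub_add_cancel] at this
        rw [hn.unique this]
  intro hw
  have hF : F (some (p - 1), w) := by
    have : ∀ e', Relation.ReflTransGen (wheelDrawing m R).FaceStep e e' → F e' := by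
      intro e' h
      induction h with
      | refl =>
        rcases he with rfl | ⟨x, hx, hxq, rfl⟩
        · exact Or.inr (Or.inl rfl)
        · exact Or.inr (Or.inr ⟨x, hx, hxq q hq hqp, rfl⟩)
      | tail _ h ih => exact hstep _ _ ih h
    exact this _ hw
  -- Seen from `p`, the vertex `p - 1` is the last one of the rim, and by `hlt` it lies beyond the
  -- sector.
  have h4 : (p - 1 - p).val = m - 1 := by
    have := p.2
    simp only [Fin.val_sub_eq_ite, h1]
    split_ifs <;> omega
  rcases hF with h | h | ⟨z, hz, hzq, h⟩
  · simp at h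
  · have := Option.some.inj (Prod.ext_iff.1 h).1
    rw [this, sub_self, Fin.val_zero] at h4
    omega
  · have := Option.some.inj (Prod.ext_iff.1 h).1
    rw [this] at h4
    omega

/-- The edge from `x` to `x - 1` bounds the sector that begins at the nearest radius `p` found on
going down from `x - 1`, and this sector misses `p - 1`. -/
theorem wheelDrawing_exists_not_reachable (hm : 3 ≤ m) (hR : ∀ i, ¬ R ⊆ {i, i + 1}) (x : Fin m) :
    ∃ y, ∀ w, ¬ Relation.ReflTransGen (wheelDrawing m R).FaceStep (some x, some (x - 1))
      (some y, w) := by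
  have h1 : (1 : Fin m).val = 1 := by rw [Fin.val_one', Nat.mod_eq_of_lt (by omega)]
  have hne : R.Nonempty := by
    by_contra h
    rw [Set.not_nonempty_iff_eq_empty] at h
    exact hR 0 (h ▸ Set.empty_subset _)
  obtain ⟨p, hp, hpmin⟩ := Set.exists_min_image R (fun p => (x - 1 - p).val) (Set.toFinite R) hne
  have hpos : ∀ z p : Fin m, z ≠ p → 1 ≤ (z - p).val := by
    intro z p hz
    rw [Nat.one_le_iff_ne_zero]
    intro e
    exact hz (sub_eq_zero.1 (Fin.ext e))
  -- Going down from `x - 1` one meets `x` last of all, so any second radius would be nearer.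
  have hx : x ≠ p := by
    rintro rfl
    obtain ⟨q, hq, hqp⟩ : ∃ q ∈ R, q ≠ x := by
      by_contra h
      push Not at h
      exact hR x fun q hq => Or.inl (h q hq)
    have h2 := hpmin q hq
    have h3 := Fin.val_sub_one_sub (x := x) (p := q) (by omega) hqp.symm
    have h4 : (x - 1 - x).val = m - 1 := by
      have := x.2
      simp only [Fin.val_sub_eq_ite, h1]
      split_ifs <;> omega
    have := (x - q).2
    omega
  refine ⟨p - 1, wheelDrawing_not_reachable_of_mem hm hR hp
    (Or.inr ⟨x, hx, fun q hq hqp => ?_, rfl⟩)⟩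
  · by_contra hlt
    have h2 := hpmin q hq
    have hxq : x ≠ q := by
      rintro rfl
      exact hlt le_rfl
    have h3 := Fin.val_sub_one_sub (by omega) hx
    have h4 := Fin.val_sub_one_sub (by omega) hxq
    have h5 : (x - q).val = (x - p).val - (q - p).val := by
      rw [← sub_sub_sub_cancel_right x q p, Fin.val_sub_eq_ite (x - p)]
      rw [if_pos (by omega)]
    have := hpos q p hqp
    omega

/-- If the radii are not confined to a side, every directed edge fails: the outer face misses the
hub, and each inner face misses a rim vertex. -/
theorem wheelDrawing_isOuterplane_iff (hm : 3 ≤ m) (hR : R.Nonempty) :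
    (wheelDrawing m R).IsOuterplane ↔ ∃ i, R ⊆ {i, i + 1} := by
  refine ⟨fun h => ?_, fun ⟨i, h⟩ => wheelDrawing_isOuterplane_of_subset hm hR h⟩
  by_contra hcon
  push Not at hcon
  obtain ⟨⟨d1, d2⟩, hd, h⟩ := h
  change (wheelGraph m R).Adj d1 d2 at hd
  have key := wheelDrawing_exists_not_reachable hm hcon
  -- The walk is deterministic, so its first edge can be dropped; this reduces an edge coming from
  -- the hub to an edge of the rim.
  have step : ∀ x y w, (some y, w) ≠ (d1, d2) →
      Relation.ReflTransGen (wheelDrawing m R).FaceStep (d1, d2) (some y, w) →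
      d2 = some x → (wheelDrawing m R).IsNext (some x) d1 (some (x - 1)) →
      Relation.ReflTransGen (wheelDrawing m R).FaceStep (some x, some (x - 1)) (some y, w) := by
    rintro x y w hne hr rfl hn
    rcases hr.cases_head with h | ⟨⟨e1, e2⟩, ⟨h1, h2⟩, h3⟩
    · exact absurd h.symm hne
    · dsimp only at h1 h2
      subst h1
      rwa [h2.unique hn] at h3
  rcases d1 with _ | i
  · rcases d2 with _ | i
    · exact hd.ne rfl
    · rw [wheelGraph_adj_none_some] at hd
      obtain ⟨y, hy⟩ := key i
      obtain ⟨w, hw⟩ := h (some y)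
      exact hy w (step i y w (by simp) hw rfl (wheelDrawing_isNext_none_pred hm hd))
  · rcases (wheelGraph_adj_some hm).1 hd with rfl | ⟨rfl, hi⟩ | rfl
    -- The outer face runs along the rim only and never starts an edge at the hub.
    · have : ∀ e, Relation.ReflTransGen (wheelDrawing m R).FaceStep (some i, some (i + 1)) e →
          ∃ z, e = (some z, some (z + 1)) := by
        intro e he
        induction he with
        | refl => exact ⟨i, rfl⟩
        | tail _ h ih =>
          obtain ⟨z, rfl⟩ := ih
          rename_i e _
          obtain ⟨h1, h2⟩ := h
          have h3 := wheelDrawing_isNext_pred_succ (R := R) hm (z + 1)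
          rw [add_sub_cancel_right] at h3
          exact ⟨z + 1, Prod.ext h1 (h2.unique h3)⟩
      obtain ⟨w, hw⟩ := h none
      obtain ⟨z, hz⟩ := this _ hw
      simp at hz
    · obtain ⟨w, hw⟩ := h (some (i - 1))
      exact wheelDrawing_not_reachable_of_mem hm hcon hi (Or.inl rfl) w hw
    · obtain ⟨y, hy⟩ := key i
      obtain ⟨w, hw⟩ := h (some y)
      exact hy w hw

end Wheel

/-! ### Isomorphisms of wheels -/

/-- Two vertices with the same further neighbours can be exchanged. -/
def SimpleGraph.swapIso {V : Type} [DecidableEq V] (G : SimpleGraph V) (a b : V)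
    (h : ∀ x, x ≠ a → x ≠ b → (G.Adj a x ↔ G.Adj b x)) : G ≃g G :=
  ⟨Equiv.swap a b, by
    have key : ∀ x y, G.Adj x y → G.Adj (Equiv.swap a b x) (Equiv.swap a b y) := by
      intro x y hxy
      by_cases hxa : x = a
      · subst hxa
        by_cases hyb : y = b
        · subst hyb
          simpa using hxy.symm
        · rw [Equiv.swap_apply_left, Equiv.swap_apply_of_ne_of_ne hxy.ne.symm hyb]
          exact (h y hxy.ne.symm hyb).1 hxy
      · by_cases hxb : x = b
        · subst hxb
          by_cases hya : y = a
          · subst hya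
            simpa using hxy.symm
          · rw [Equiv.swap_apply_right, Equiv.swap_apply_of_ne_of_ne hya hxy.ne.symm]
            exact (h y hya hxy.ne.symm).2 hxy
        · rw [Equiv.swap_apply_of_ne_of_ne hxa hxb]
          by_cases hya : y = a
          · subst hya
            rw [Equiv.swap_apply_left]
            exact ((h x hxa hxb).1 hxy.symm).symm
          · by_cases hyb : y = b
            · subst hyb
              rw [Equiv.swap_apply_right]
              exact ((h x hxa hxb).2 hxy.symm).symm
            · rwa [Equiv.swap_apply_of_ne_of_ne hya hyb]
    intro x y
    refine ⟨fun hxy => ?_, key x y⟩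
    simpa using key _ _ hxy⟩

section Wheel

variable {m : ℕ} [NeZero m] {R R' : Set (Fin m)}

theorem wheelDrawing_iso_of_add (hm : 3 ≤ m) {t : Fin m} (h : ∀ i, i ∈ R ↔ i + t ∈ R') :
    (wheelDrawing m R).Iso (wheelDrawing m R') := by
  let f : wheelGraph m R ≃g wheelGraph m R' :=
    ⟨(Equiv.addRight t).optionCongr, fun {v w} => by
      rcases v with _ | v <;> rcases w with _ | w
      · simp
      · change (wheelGraph m R').Adj none (some (w + t)) ↔ _
        rw [wheelGraph_adj_none_some, wheelGraph_adj_none_some, h]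
      · change (wheelGraph m R').Adj (some (v + t)) none ↔ _
        rw [SimpleGraph.adj_comm, wheelGraph_adj_none_some, SimpleGraph.adj_comm,
          wheelGraph_adj_none_some, h]
      · change (wheelGraph m R').Adj (some (v + t)) (some (w + t)) ↔ _
        rw [wheelGraph_adj_some_some hm, wheelGraph_adj_some_some hm, add_right_comm,
          add_right_comm w, add_left_inj, add_left_inj]⟩
  have hfs : ∀ v, f (some v) = some (v + t) := fun v => rfl
  have hang : ∀ v a, wheelAngle m (f (some v)) (f a) = wheelAngle m (some v) a := by
    rintro v (_ | a)
    · rfl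
    · rw [hfs, hfs]
      simp only [wheelAngle, add_right_comm v t, add_left_inj]
  refine EmbeddedGraph.iso_ofAngle_of_forall f (Or.inl ?_)
  rintro (_ | v) a b c ha hb hc
  · rcases a with _ | a
    · exact absurd rfl ha.ne
    rcases b with _ | b
    · exact absurd rfl hb.ne
    rcases c with _ | c
    · exact absurd rfl hc.ne
    exact (cycLt_val_add t a b c).symm
  · rw [hang, hang, hang]

/-- A reflection exchanges successor and predecessor, so an angle `x` at a rim vertex becomes `2 -
x`, and the order at the hub is reversed as well. -/
theorem wheelDrawing_iso_of_sub (hm : 3 ≤ m) {t : Fin m} (h : ∀ i, i ∈ R ↔ t - i ∈ R') :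
    (wheelDrawing m R).Iso (wheelDrawing m R') := by
  have hsub : ∀ v w : Fin m, t - v = t - w + 1 ↔ w = v + 1 := fun v w => by
    rw [sub_add, sub_right_inj, eq_sub_iff_add_eq, eq_comm]
  let f : wheelGraph m R ≃g wheelGraph m R' :=
    ⟨(Equiv.subLeft t).optionCongr, fun {v w} => by
      rcases v with _ | v <;> rcases w with _ | w
      · simp
      · change (wheelGraph m R').Adj none (some (t - w)) ↔ _
        rw [wheelGraph_adj_none_some, wheelGraph_adj_none_some, h]
      · change (wheelGraph m R').Adj (some (t - v)) none ↔ _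
        rw [SimpleGraph.adj_comm, wheelGraph_adj_none_some, SimpleGraph.adj_comm,
          wheelGraph_adj_none_some, h]
      · change (wheelGraph m R').Adj (some (t - v)) (some (t - w)) ↔ _
        rw [wheelGraph_adj_some_some hm, wheelGraph_adj_some_some hm, hsub, hsub, or_comm]⟩
  have hfs : ∀ v, f (some v) = some (t - v) := fun v => rfl
  have hang : ∀ v a, (wheelGraph m R).Adj (some v) a →
      wheelAngle m (f (some v)) (f a) = 2 - wheelAngle m (some v) a ∧
        wheelAngle m (some v) a ≤ 2 := by
    rintro v a ha
    rcases (wheelGraph_adj_some hm).1 ha with rfl | ⟨rfl, hv⟩ | rfl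
    · rw [wheelAngle_succ, hfs, hfs, ← sub_sub, wheelAngle_pred hm]
      simp
    · simp only [wheelAngle, hfs]
      exact ⟨rfl, by omega⟩
    · rw [wheelAngle_pred hm, hfs, hfs, ← sub_add, wheelAngle_succ]
      simp
  refine EmbeddedGraph.iso_ofAngle_of_forall f (Or.inr ?_)
  rintro (_ | v) a b c ha hb hc
  · rcases a with _ | a
    · exact absurd rfl ha.ne
    rcases b with _ | b
    · exact absurd rfl hb.ne
    rcases c with _ | c
    · exact absurd rfl hc.ne
    exact (cycLt_val_sub t c b a).symm
  · obtain ⟨h1, h1'⟩ := hang v a ha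
    obtain ⟨h2, h2'⟩ := hang v b hb
    obtain ⟨h3, h3'⟩ := hang v c hc
    rw [h1, h2, h3]
    unfold CycLt
    omega

theorem wheelGraph_isBranch_some (hm : 3 ≤ m) {i : Fin m} :
    (wheelGraph m R).IsBranch (some i) ↔ i ∈ R := by
  constructor
  · intro h
    by_contra hi
    refine SimpleGraph.not_isBranch (u := some (i + 1)) (w := some (i - 1)) (fun y hy => ?_) h
    simpa [hi] using (wheelGraph_adj_some hm).1 hy
  · intro hi
    exact ⟨some (i + 1), none, some (i - 1), (wheelGraph_adj_some hm).2 (Or.inl rfl),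
      (wheelGraph_adj_some hm).2 (Or.inr (Or.inl ⟨rfl, hi⟩)),
      (wheelGraph_adj_some hm).2 (Or.inr (Or.inr rfl)), by simp, by simp,
      fun h => Fin.sub_one_ne_add_one hm i (Option.some.inj h).symm⟩

/-- If an isomorphism of wheels does not preserve the hub, then it can be corrected by exchanging
the hub and a vertex of the rim. -/
theorem exists_wheelGraph_iso_none_eq_none (hm : 3 ≤ m) (f : wheelGraph m R ≃g wheelGraph m R') :
    ∃ g : wheelGraph m R ≃g wheelGraph m R', g none = none := by
  rcases hf : f none with _ | j
  · exact ⟨f, hf⟩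
  have hadj : ∀ x, (wheelGraph m R').Adj (some j) x ↔ ∃ i ∈ R, x = f (some i) := by
    intro x
    obtain ⟨y, rfl⟩ := f.surjective x
    rw [← hf, f.map_adj_iff]
    rcases y with _ | i
    · simp
    · rw [wheelGraph_adj_none_some]
      simp
  have hnb : ∀ i ∈ R, (wheelGraph m R').IsBranch (f (some i)) := fun i hi =>
    ((wheelGraph_isBranch_some hm).2 hi).map f
  -- The neighbours of the image `j` of the hub are branch vertices, which puts `j + 1` and `j - 1`
  -- into `R'`. Conversely every branch vertex of the rim other than `j` is a neighbour of `j`.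
  have hsucc : j + 1 ∈ R' := by
    obtain ⟨i, hi, h⟩ := (hadj _).1 ((wheelGraph_adj_some hm).2 (Or.inl rfl))
    exact (wheelGraph_isBranch_some hm).1 (h ▸ hnb i hi)
  have hpred : j - 1 ∈ R' := by
    obtain ⟨i, hi, h⟩ := (hadj _).1 ((wheelGraph_adj_some hm).2 (Or.inr (Or.inr rfl)))
    exact (wheelGraph_isBranch_some hm).1 (h ▸ hnb i hi)
  have hR' : ∀ x ∈ R', x = j ∨ x = j + 1 ∨ x = j - 1 := by
    intro x hx
    have hxb := (wheelGraph_isBranch_some hm).2 hx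
    obtain ⟨y, hy⟩ := f.surjective (some x)
    rw [← hy, SimpleGraph.isBranch_map_iff f] at hxb
    rcases y with _ | i
    · rw [hf] at hy
      exact Or.inl (Option.some.inj hy).symm
    · have := (hadj (some x)).2 ⟨i, (wheelGraph_isBranch_some hm).1 hxb, hy.symm⟩
      right
      simpa using (wheelGraph_adj_some hm).1 this
  -- Apart from each other, the hub and `j` have the same neighbours `j + 1` and `j - 1`. The
  -- corrected map need not respect the drawing; an isomorphism of graphs is enough below.
  refine ⟨f.trans (SimpleGraph.swapIso _ none (some j) ?_), ?_⟩
  · rintro (_ | x) hx1 hx2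
    · exact absurd rfl hx1
    · rw [wheelGraph_adj_none_some, wheelGraph_adj_some hm]
      have hxj : x ≠ j := fun e => hx2 (congrArg some e)
      constructor
      · intro hx
        simpa using (hR' x hx).resolve_left hxj
      · rintro (h | h | h)
        · rwa [Option.some.inj h]
        · simp at h
        · rwa [Option.some.inj h]
  · change Equiv.swap none (some j) (f none) = none
    rw [hf, Equiv.swap_apply_right]

/-- An isomorphism that fixes the hub preserves the rim cycle, so it acts there as a rotation or a
reflection. -/
theorem exists_dihedral_of_wheelGraph_iso (hm : 3 ≤ m) (f : wheelGraph m R ≃g wheelGraph m R') :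
    ∃ t, (∀ i, i ∈ R ↔ i + t ∈ R') ∨ (∀ i, i ∈ R ↔ t - i ∈ R') := by
  obtain ⟨f, hf⟩ := exists_wheelGraph_iso_none_eq_none hm f
  have hsome : ∀ i, ∃ j, f (some i) = some j := by
    intro i
    rcases h : f (some i) with _ | j
    · rw [← hf] at h
      exact absurd (f.injective h) (by simp)
    · exact ⟨j, rfl⟩
  choose g hg using hsome
  have hinj : Function.Injective g := fun i j hij =>
    Option.some.inj (f.injective (by rw [hg, hg, hij]))
  have hmem : ∀ i, i ∈ R ↔ g i ∈ R' := fun i => by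
    rw [← wheelGraph_adj_none_some, ← f.map_adj_iff, hf, hg, wheelGraph_adj_none_some]
  obtain ⟨t, ht⟩ := Fin.eq_add_or_eq_sub_of_side hm hinj fun i => by
    rw [← wheelGraph_adj_some_some (R := R') hm, ← hg, ← hg, f.map_adj_iff]
    exact (wheelGraph_adj_some_some hm).2 (Or.inl rfl)
  refine ⟨t, ht.imp (fun h i => ?_) fun h i => ?_⟩
  · rw [hmem, h]
  · rw [hmem, h]

theorem wheelDrawing_iso_iff (hm : 3 ≤ m) : (wheelDrawing m R).Iso (wheelDrawing m R') ↔
    ∃ t, (∀ i, i ∈ R ↔ i + t ∈ R') ∨ (∀ i, i ∈ R ↔ t - i ∈ R') := by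
  constructor
  · rintro ⟨f, _⟩
    exact exists_dihedral_of_wheelGraph_iso hm f
  · rintro ⟨t, h | h⟩
    · exact wheelDrawing_iso_of_add hm h
    · exact wheelDrawing_iso_of_sub hm h

end Wheel

/-! ### Bracelets -/

section Bracelets

variable (m : ℕ) [NeZero m]

/-- Two sets of vertices of a polygon are equivalent if a rotation or a reflection takes one to the
other. -/
def braceletSetoid : Setoid (Set (Fin m)) where
  r R S := ∃ t : Fin m, (∀ i, i ∈ R ↔ i + t ∈ S) ∨ (∀ i, i ∈ R ↔ t - i ∈ S)
  iseqv := by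
    refine ⟨fun R => ⟨0, Or.inl (by simp)⟩, ?_, ?_⟩
    · rintro R S ⟨t, h | h⟩
      · exact ⟨-t, Or.inl fun i => by simp [h]⟩
      · exact ⟨t, Or.inr fun i => by simp [h]⟩
    · rintro R S T ⟨t, h | h⟩ ⟨u, h' | h'⟩
      · exact ⟨t + u, Or.inl fun i => by rw [h, h', add_assoc]⟩
      · exact ⟨u - t, Or.inr fun i => by rw [h, h', sub_sub, add_comm t i]⟩
      · exact ⟨t + u, Or.inr fun i => by rw [h, h', sub_add_eq_add_sub]⟩
      · exact ⟨u - t, Or.inl fun i => by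
          rw [h, h', sub_sub_eq_add_sub, add_sub_right_comm, add_comm]⟩

/-- Burnside's lemma: the rotation by `t` fixes `2 ^ gcd m t` sets, which gives the sum over the
divisors, and the last two terms come from the two kinds of reflections. -/
theorem card_braceletSetoid_mul (hm : 2 ≤ m) :
    Nat.card (Quotient (braceletSetoid m)) * (2 * m) =
      ∑ d ∈ m.divisors, d.totient * 2 ^ (m / d) +
        ((m + 1) / 2 * 2 ^ (m / 2 + 1) + m / 2 * 2 ^ ((m + 1) / 2)) := by
  rw [card_quotient_mul_eq_sum_fixed_rotation (fun t S => {i | i - t ∈ S})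
    (fun t S => {i | t - i ∈ S})]
  · congr 1
    · rw [← sum_two_pow_gcd m (by omega), ← Fin.sum_univ_eq_sum_range fun t => 2 ^ m.gcd t]
      refine Finset.sum_congr rfl fun t _ => ?_
      rw [← card_sets_fixed_rotation t]
      refine Nat.card_congr (Equiv.subtypeEquivRight fun S => ?_)
      rw [Set.ext_iff]
      constructor
      · intro h i
        simpa using h (i + t)
      · intro h i
        simpa using h (i - t)
    · congr 2
      · rw [← card_sets_fixed_neg]
        refine Nat.card_congr (Equiv.subtypeEquivRight fun S => ?_)
        rw [Set.ext_iff]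
        exact forall_congr' fun i => Iff.comm
      · rw [← card_sets_fixed_one_sub hm]
        refine Nat.card_congr (Equiv.subtypeEquivRight fun S => ?_)
        rw [Set.ext_iff]
        exact forall_congr' fun i => Iff.comm
  · simp
  · intro s t S
    ext i
    simp [sub_sub]
  · intro s t S
    ext i
    simp only [Set.mem_ofPred_eq]
    rw [show t - (i - s) = s + t - i by abel]
  · intro s t S
    ext i
    simp only [Set.mem_ofPred_eq]
    rw [show s - i - t = s - t - i by abel]
  · intro s t S
    ext i
    simp only [Set.mem_ofPred_eq]
    rw [show t - (s - i) = i - (s - t) by abel]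
  · intro R S
    refine exists_congr fun t => or_congr ?_ ?_
    · rw [Set.ext_iff]
      constructor
      · intro h i
        simpa using h (i - t)
      · intro h i
        simpa using h (i + t)
    · rw [Set.ext_iff]
      constructor
      · intro h i
        simpa using h (t - i)
      · intro h i
        simpa using h (t - i)

/-- The equivalence of sets that are not contained in a side of the polygon. -/
def wideBraceletSetoid : Setoid {R : Set (Fin m) // ∀ i, ¬ R ⊆ {i, i + 1}} :=
  (braceletSetoid m).comap Subtype.val

variable {m}

theorem braceletSetoid.subset_side {R S : Set (Fin m)} (h : braceletSetoid m R S) {i : Fin m}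
    (hR : R ⊆ {i, i + 1}) : ∃ j, S ⊆ {j, j + 1} := by
  obtain ⟨t, h | h⟩ := h
  · refine ⟨i + t, fun x hx => ?_⟩
    have := hR ((h (x - t)).2 (by simpa using hx))
    rw [Set.mem_insert_iff, Set.mem_singleton_iff, sub_eq_iff_eq_add, sub_eq_iff_eq_add] at this
    rw [Set.mem_insert_iff, Set.mem_singleton_iff, add_right_comm]
    exact this
  · refine ⟨t - i - 1, fun x hx => ?_⟩
    have := hR ((h (t - x)).2 (by simpa using hx))
    rw [Set.mem_insert_iff, Set.mem_singleton_iff, sub_eq_iff_eq_add, sub_eq_iff_eq_add] at this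
    rw [Set.mem_insert_iff, Set.mem_singleton_iff, sub_add_cancel]
    rcases this with h | h
    · right
      rw [h]
      abel
    · left
      rw [h]
      abel

theorem braceletSetoid.ncard_eq {R S : Set (Fin m)} (h : braceletSetoid m R S) :
    R.ncard = S.ncard := by
  obtain ⟨t, h | h⟩ := h
  · have : (Equiv.addRight t) '' R = S := by
      ext x
      rw [Equiv.image_eq_preimage_symm, Set.mem_preimage, h]
      simp
    rw [← this, Set.ncard_image_of_injective _ (Equiv.injective _)]
  · have : (Equiv.subLeft t) '' R = S := by
      ext x
      rw [Equiv.image_eq_preimage_symm, Set.mem_preimage, h]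
      simp
    rw [← this, Set.ncard_image_of_injective _ (Equiv.injective _)]

/-- The subsets of sides form three classes, those of the empty set, a point and a side, which are
told apart by their size. This is the `-3` in the formula for type 4. -/
theorem card_wideBraceletSetoid_add (hm : 2 ≤ m) :
    Nat.card (Quotient (wideBraceletSetoid m)) + 3 = Nat.card (Quotient (braceletSetoid m)) := by
  classical
  let ι : Quotient (wideBraceletSetoid m) → Quotient (braceletSetoid m) :=
    Quotient.map' Subtype.val fun _ _ h => h
  have hι : Function.Injective ι := by
    intro x y
    refine Quotient.inductionOn₂ x y fun x y h => Quotient.sound ?_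
    have h' : Quotient.mk (braceletSetoid m) x.1 = Quotient.mk (braceletSetoid m) y.1 := h
    exact (Quotient.exact h' : braceletSetoid m x.1 y.1)
  let N : Finset (Quotient (braceletSetoid m)) :=
    {Quotient.mk _ ∅, Quotient.mk _ {0}, Quotient.mk _ {0, 1}}
  have h01 : (0 : Fin m) ≠ 1 := by simpa using (Fin.add_one_ne_self hm (0 : Fin m)).symm
  have hN : N.card = 3 := by
    refine Finset.card_eq_three.2 ⟨_, _, _, ?_, ?_, ?_, rfl⟩
    · intro h
      have := braceletSetoid.ncard_eq (Quotient.exact h)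
      simp at this
    · intro h
      have := braceletSetoid.ncard_eq (Quotient.exact h)
      simp [Set.ncard_pair h01] at this
    · intro h
      have := braceletSetoid.ncard_eq (Quotient.exact h)
      simp [Set.ncard_pair h01] at this
  have hcompl : (Set.range ι)ᶜ = N := by
    ext q
    refine Quotient.inductionOn q fun R => ?_
    have hmem : Quotient.mk (braceletSetoid m) R ∈ N ↔ ∃ i, R ⊆ {i, i + 1} := by
      constructor
      · intro h
        simp only [N, Finset.mem_insert, Finset.mem_singleton] at h
        rcases h with h | h | h
        · exact braceletSetoid.subset_side ((braceletSetoid m).symm (Quotient.exact h)) (i := 0)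
            (by simp)
        · exact braceletSetoid.subset_side ((braceletSetoid m).symm (Quotient.exact h)) (i := 0)
            (by simp)
        · exact braceletSetoid.subset_side ((braceletSetoid m).symm (Quotient.exact h)) (i := 0)
            (by simp)
      · rintro ⟨i, hi⟩
        simp only [N, Finset.mem_insert, Finset.mem_singleton]
        rcases Set.subset_pair_iff_eq.1 hi with rfl | rfl | rfl | rfl
        · exact Or.inl rfl
        · exact Or.inr (Or.inl (Quotient.sound ⟨-i, Or.inl fun x => by
            simp [← sub_eq_add_neg, sub_eq_zero]⟩))
        · exact Or.inr (Or.inl (Quotient.sound ⟨-(i + 1), Or.inl fun x => by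
            rw [← sub_eq_add_neg, Set.mem_singleton_iff, Set.mem_singleton_iff, sub_eq_zero]⟩))
        · exact Or.inr (Or.inr (Quotient.sound ⟨-i, Or.inl fun x => by
            rw [← sub_eq_add_neg]
            simp only [Set.mem_insert_iff, Set.mem_singleton_iff, sub_eq_iff_eq_add,
              add_comm, add_zero]⟩))
    rw [Finset.mem_coe, hmem, Set.mem_compl_iff]
    constructor
    · intro h
      by_contra hR
      push Not at hR
      exact h ⟨Quotient.mk _ ⟨R, hR⟩, rfl⟩
    · rintro ⟨i, hi⟩ ⟨x, hx⟩
      revert hx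
      refine Quotient.inductionOn x fun ⟨S, hS⟩ hx => ?_
      obtain ⟨j, hj⟩ := braceletSetoid.subset_side
        ((braceletSetoid m).symm (Quotient.exact hx)) hi
      exact hS j hj
  rw [← Set.ncard_range_of_injective hι, ← hN, ← Set.ncard_coe_finset, ← hcompl,
    Set.ncard_add_ncard_compl]

end Bracelets

theorem countUpToIso_isType4_eq (k : ℕ) :
    EmbeddedGraph.countUpToIso (k + 4) IsType4 =
      Nat.card (Quotient (wideBraceletSetoid (k + 3))) := by
  have hm : 3 ≤ k + 3 := by omega
  refine EmbeddedGraph.countUpToIso_eq_card_quotient (wideBraceletSetoid (k + 3))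
    (fun R => wheelDrawing (k + 3) R.1) (fun R => ?_) (fun D => ⟨?_, ?_⟩) fun R S => ?_
  · exact ⟨Finite.equivFinOfCardEq (by simp)⟩
  · rintro ⟨l, R, hne, hout, h⟩
    obtain ⟨e⟩ := h.nonempty_equiv
    have := Nat.card_congr e
    simp only [Nat.card_eq_fintype_card, Fintype.card_fin, Fintype.card_option] at this
    obtain rfl : l = k := by omega
    rw [wheelDrawing_isOuterplane_iff hm hne] at hout
    push Not at hout
    exact ⟨⟨R, hout⟩, h⟩
  · rintro ⟨⟨R, hR⟩, h⟩
    have hne : R.Nonempty := by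
      by_contra hne
      rw [Set.not_nonempty_iff_eq_empty] at hne
      exact hR 0 (hne ▸ Set.empty_subset _)
    refine ⟨k, R, hne, ?_, h⟩
    rw [wheelDrawing_isOuterplane_iff hm hne]
    push Not
    exact hR
  · exact wheelDrawing_iso_iff hm

/-- There is no wheel with three vertices, and for `n = 3` the formula gives `3/2 + 3/2 - 3 = 0`.
Otherwise the equation from Burnside's lemma is divided by twice the length of the rim. -/
theorem countUpToIso_isType4 {n : ℕ} (hn : 3 ≤ n) :
    (EmbeddedGraph.countUpToIso n IsType4 : ℚ) =
      1 / 4 * ((((n - 1) % 2 : ℕ) : ℚ) + 3) * 2 ^ ((n - 1) / 2) +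
        1 / (2 * ((n : ℚ) - 1)) *
          ∑ d ∈ (n - 1).divisors, (Nat.totient d : ℚ) * 2 ^ ((n - 1) / d) - 3 := by
  rcases hn.eq_or_lt with rfl | hn
  · have h0 : EmbeddedGraph.countUpToIso 3 IsType4 = 0 := by
      refine (congrArg Set.ncard (Set.eq_empty_iff_forall_notMem.2 ?_)).trans
        (Set.ncard_empty _)
      rintro _ ⟨D, ⟨l, R, -, -, h⟩, -⟩
      obtain ⟨e⟩ := h.nonempty_equiv
      have := Nat.card_congr e
      simp at this
    have h2 : Nat.divisors 2 = {1, 2} := by decide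
    rw [h0]
    norm_num [h2]
  · obtain ⟨k, rfl⟩ := Nat.exists_eq_add_of_le' (Nat.succ_le_of_lt hn)
    rw [countUpToIso_isType4_eq]
    have h1 := card_wideBraceletSetoid_add (m := k + 3) (by omega)
    have h2 := card_braceletSetoid_mul (k + 3) (by omega)
    rw [← h1] at h2
    generalize Nat.card (Quotient (wideBraceletSetoid (k + 3))) = c at h2 ⊢
    have h3 : ((c : ℚ) + 3) * (2 * (k + 3)) =
        ∑ d ∈ (k + 3).divisors, (d.totient : ℚ) * 2 ^ ((k + 3) / d) +
          (((k + 3 + 1) / 2 : ℕ) * 2 ^ ((k + 3) / 2 + 1) +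
            ((k + 3) / 2 : ℕ) * 2 ^ ((k + 3 + 1) / 2)) := by
      exact_mod_cast h2
    rw [show k + (3 + 1) - 1 = k + 3 from rfl]
    generalize ∑ d ∈ (k + 3).divisors, (d.totient : ℚ) * 2 ^ ((k + 3) / d) = S at *
    have hk : ((k + (3 + 1) : ℕ) : ℚ) - 1 = k + 3 := by
      push_cast
      ring
    rw [hk]
    have hpos : (0 : ℚ) < k + 3 := by positivity
    -- For a rim of length `2 * a` the reflections contribute `3 * a * 2 ^ a`, for length `2 * a +
    -- 1` they contribute `(2 * a + 1) * 2 ^ (a + 1)`; the remainder modulo 2 merges the two cases.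
    have key : (((k + 3 + 1) / 2 : ℕ) : ℚ) * 2 ^ ((k + 3) / 2 + 1) +
        ((k + 3) / 2 : ℕ) * 2 ^ ((k + 3 + 1) / 2) =
        (2 * (k + 3)) * (1 / 4 * ((((k + 3) % 2 : ℕ) : ℚ) + 3) * 2 ^ ((k + 3) / 2)) := by
      obtain ⟨a, ha | ha⟩ : ∃ a, k + 3 = 2 * a ∨ k + 3 = 2 * a + 1 := ⟨(k + 3) / 2, by omega⟩
      · have hq : (k : ℚ) + 3 = 2 * a := by exact_mod_cast ha
        rw [ha, hq, show (2 * a + 1) / 2 = a by omega, show 2 * a / 2 = a by omega,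
          show 2 * a % 2 = 0 by omega]
        push_cast
        ring
      · have hq : (k : ℚ) + 3 = 2 * a + 1 := by exact_mod_cast ha
        rw [ha, hq, show (2 * a + 1 + 1) / 2 = a + 1 by omega, show (2 * a + 1) / 2 = a by omega,
          show (2 * a + 1) % 2 = 1 by omega]
        push_cast
        ring
    rw [key] at h3
    field_simp
    linarith

/-! ### Polygons with diagonals -/

namespace SimpleGraph

variable {V W : Type}

/-- The vertices `x` and `y` are joined by a path that avoids `u` and `v`. -/
def ReachableAvoiding (G : SimpleGraph V) (u v x y : V) : Prop :=
  Relation.ReflTransGen (fun a b => G.Adj a b ∧ (a ≠ u ∧ a ≠ v) ∧ (b ≠ u ∧ b ≠ v)) x y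

/-- The edge `uv` does not separate the graph. -/
def IsNonseparatingEdge (G : SimpleGraph V) (u v : V) : Prop :=
  G.Adj u v ∧ ∀ x y, (x ≠ u ∧ x ≠ v) → (y ≠ u ∧ y ≠ v) → G.ReachableAvoiding u v x y

theorem ReachableAvoiding.symm {G : SimpleGraph V} {u v x y : V}
    (h : G.ReachableAvoiding u v x y) : G.ReachableAvoiding u v y x := by
  induction h with
  | refl => exact .refl
  | tail _ h ih => exact .head ⟨h.1.symm, h.2.2, h.2.1⟩ ih

theorem IsNonseparatingEdge.map {G : SimpleGraph V} {H : SimpleGraph W} (f : G ≃g H) {u v : V}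
    (h : G.IsNonseparatingEdge u v) : H.IsNonseparatingEdge (f u) (f v) := by
  refine ⟨f.map_adj_iff.2 h.1, fun x y hx hy => ?_⟩
  obtain ⟨x, rfl⟩ := f.surjective x
  obtain ⟨y, rfl⟩ := f.surjective y
  simp only [ne_eq, f.injective.eq_iff] at hx hy
  refine Relation.ReflTransGen.lift f (fun a b h => ?_) _ _ (h.2 x y hx hy)
  simpa only [Function.onFun, ne_eq, f.injective.eq_iff, f.map_adj_iff] using h

end SimpleGraph

section Dissection

variable {n : ℕ} [NeZero n] {G H : SimpleGraph (Fin n)}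

/-- The condition in `IsDissection` is for increasing vertices; in cyclic form it covers all four
ways of cutting the cycle open. -/
theorem IsDissection.not_cross (hG : IsDissection G) {i j z w : Fin n} (hij : G.Adj i j)
    (hzw : G.Adj z w) (hz : CycLt i.val z.val j.val) (hw : CycLt j.val w.val i.val) : False := by
  have h1 := hG.2 i z j w
  have h2 := hG.2 z j w i
  have h3 := hG.2 j w i z
  have h4 := hG.2 w i z j
  simp only [hij, hzw, hij.symm, hzw.symm, and_self, not_true_eq_false, imp_false, Fin.lt_def]
    at h1 h2 h3 h4
  unfold CycLt at hz hw
  omega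

/-- The remaining vertices form a path of sides that starts at `i + 2`. -/
theorem IsDissection.isNonseparatingEdge_succ (hG : IsDissection G) (i : Fin n) :
    G.IsNonseparatingEdge i (i + 1) := by
  refine ⟨hG.1 i, ?_⟩
  have key : ∀ z, (i + 1 + 1 + z ≠ i ∧ i + 1 + 1 + z ≠ i + 1) →
      G.ReachableAvoiding i (i + 1) (i + 1 + 1) (i + 1 + 1 + z) := by
    refine Fin.induction_add_one (fun _ => by rw [add_zero]; exact .refl) fun z ih hz => ?_
    by_cases h1 : i + 1 + 1 + z = i + 1
    · rw [← add_assoc, h1]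
      exact .refl
    · by_cases h0 : i + 1 + 1 + z = i
      · exact absurd (by rw [← add_assoc, h0]) hz.2
      · refine (ih ⟨h0, h1⟩).tail ⟨?_, ⟨h0, h1⟩, hz⟩
        rw [← add_assoc]
        exact hG.1 _
  replace key : ∀ x, (x ≠ i ∧ x ≠ i + 1) → G.ReachableAvoiding i (i + 1) (i + 1 + 1) x :=
    fun x hx => by simpa using key (x - (i + 1 + 1)) (by simpa using hx)
  exact fun x y hx hy => (key x hx).symm.trans (key y hy)

/-- A diagonal separates `i + 1` from `j + 1`, because a path avoiding its ends would have to cross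
it. So the sides are determined by the abstract graph. -/
theorem IsDissection.isNonseparatingEdge_iff (hG : IsDissection G) {i j : Fin n} :
    G.IsNonseparatingEdge i j ↔ j = i + 1 ∨ i = j + 1 := by
  constructor
  · intro ⟨hij, h⟩
    by_contra hne
    push Not at hne
    have hval : ∀ k : Fin n, (k + 1).val = if k.val + 1 = n then 0 else k.val + 1 := by
      intro k
      have := k.2
      rw [Fin.val_add, Fin.val_one', Nat.add_mod_mod]
      split_ifs with h
      · rw [h, Nat.mod_self]
      · exact Nat.mod_eq_of_lt (by omega)
    have hi := hval i
    have hj := hval j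
    have e1 : j.val ≠ (i + 1).val := fun e => hne.1 (Fin.ext e)
    have e2 : i.val ≠ (j + 1).val := fun e => hne.2 (Fin.ext e)
    have e3 : i.val ≠ j.val := fun e => hij.ne (Fin.ext e)
    have hi2 := i.2
    have hj2 := j.2
    have hsi : CycLt i.val (i + 1).val j.val := by
      rw [hi] at e1 ⊢
      unfold CycLt
      split_ifs at e1 ⊢ <;> omega
    have hreach := h (i + 1) (j + 1)
      ⟨fun e => by rw [e] at hsi; unfold CycLt at hsi; omega, hne.1.symm⟩
      ⟨hne.2.symm, fun e => by
        have := congrArg Fin.val e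
        rw [hj] at this
        split_ifs at this <;> omega⟩
    have hin : ∀ y, G.ReachableAvoiding i j (i + 1) y → CycLt i.val y.val j.val := by
      intro y hy
      induction hy with
      | refl => exact hsi
      | @tail z w _ hzw ih =>
        by_contra hw
        refine hG.not_cross hij hzw.1 ih ?_
        have h1 : w.val ≠ i.val := fun e => hzw.2.2.1 (Fin.ext e)
        have h2 : w.val ≠ j.val := fun e => hzw.2.2.2 (Fin.ext e)
        unfold CycLt at hw ⊢
        omega
    have := hin _ hreach
    rw [hj] at this e2
    unfold CycLt at this
    split_ifs at this e2 <;> omega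
  · rintro (rfl | rfl)
    · exact hG.isNonseparatingEdge_succ i
    · obtain ⟨h1, h2⟩ := hG.isNonseparatingEdge_succ j
      refine ⟨h1.symm, fun x y hx hy => ?_⟩
      have := h2 x y hx.symm hy.symm
      unfold SimpleGraph.ReachableAvoiding at this ⊢
      convert this using 5 <;> exact and_comm

theorem polygonDrawing_iso_of_add {t : Fin n} (h : ∀ i j, G.Adj i j ↔ H.Adj (i + t) (j + t)) :
    (polygonDrawing G).Iso (polygonDrawing H) := by
  refine EmbeddedGraph.iso_ofAngle_of_forall ⟨Equiv.addRight t, fun {a b} => (h a b).symm⟩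
    (Or.inl fun v a b c _ _ _ => ?_)
  change _ ↔ CycLt (a + t - (v + t)).val (b + t - (v + t)).val (c + t - (v + t)).val
  simp only [add_sub_add_right_eq_sub]

theorem polygonDrawing_iso_of_sub {t : Fin n} (h : ∀ i j, G.Adj i j ↔ H.Adj (t - i) (t - j)) :
    (polygonDrawing G).Iso (polygonDrawing H) := by
  refine EmbeddedGraph.iso_ofAngle_of_forall ⟨Equiv.subLeft t, fun {a b} => (h a b).symm⟩
    (Or.inr fun v a b c _ _ _ => ?_)
  change _ ↔ CycLt (t - c - (t - v)).val (t - b - (t - v)).val (t - a - (t - v)).val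
  simp only [sub_sub_sub_cancel_left]
  rw [← cycLt_val_sub 0]
  simp

/-- An isomorphism takes nonseparating edges to nonseparating edges, hence sides to sides, and is
therefore a rotation or a reflection. -/
theorem polygonDrawing_iso_iff (hn : 3 ≤ n) (hG : IsDissection G) (hH : IsDissection H) :
    (polygonDrawing G).Iso (polygonDrawing H) ↔
      ∃ t : Fin n, (∀ i j, G.Adj i j ↔ H.Adj (i + t) (j + t)) ∨
        (∀ i j, G.Adj i j ↔ H.Adj (t - i) (t - j)) := by
  constructor
  · rintro ⟨f, _⟩
    change G ≃g H at f
    obtain ⟨t, ht⟩ := Fin.eq_add_or_eq_sub_of_side hn f.injective fun i =>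
      hH.isNonseparatingEdge_iff.1 ((hG.isNonseparatingEdge_succ i).map f)
    refine ⟨t, ht.imp (fun h i j => ?_) fun h i j => ?_⟩
    · rw [← h, ← h, f.map_adj_iff]
    · rw [← h, ← h, f.map_adj_iff]
  · rintro ⟨t, h | h⟩
    · exact polygonDrawing_iso_of_add h
    · exact polygonDrawing_iso_of_sub h

theorem countUpToIso_isType5 (hn : 3 ≤ n) :
    EmbeddedGraph.countUpToIso n IsType5 = dissectionCount n := by
  refine EmbeddedGraph.countUpToIso_eq_card_quotient (dissectionSetoid n)
    (fun G => polygonDrawing G.1) (fun _ => ⟨Equiv.refl _⟩) (fun D => ⟨?_, ?_⟩) fun G H => ?_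
  · rintro ⟨k, G, hG, h⟩
    obtain ⟨e⟩ := h.nonempty_equiv
    have := Nat.card_congr e
    simp only [Nat.card_eq_fintype_card, Fintype.card_fin] at this
    subst this
    exact ⟨⟨G, hG⟩, h⟩
  · rintro ⟨G, h⟩
    obtain ⟨k, rfl⟩ := Nat.exists_eq_add_of_le' hn
    exact ⟨k, G.1, G.2, h⟩
  · exact polygonDrawing_iso_iff hn G.2 H.2

end Dissection

/-! ### Counting invariant independent sets -/

section Independent

variable {α : Type} [DecidableEq α]

/-- The set `S` is invariant under `γ`, and no two of its elements are in conflict. -/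
def IsInvariantIndependent (γ : α → α) (X : α → α → Bool) (S : Finset α) : Prop :=
  (∀ x ∈ S, γ x ∈ S) ∧ ∀ x ∈ S, ∀ y ∈ S, X x y = false

instance (γ : α → α) (X : α → α → Bool) (S : Finset α) :
    Decidable (IsInvariantIndependent γ X S) := by
  unfold IsInvariantIndependent
  infer_instance

/-- The number of invariant independent subsets of `P`. -/
def numInvariantIndependent (γ : α → α) (X : α → α → Bool) (P : Finset α) : ℕ :=
  (P.powerset.filter (IsInvariantIndependent γ X)).card

/-- The list `[a, γ a, γ (γ a), …]` of length `N`. -/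
def orbitList (γ : α → α) : ℕ → α → List α
  | 0, _ => []
  | N + 1, a => a :: orbitList γ N (γ a)

theorem mem_orbitList {γ : α → α} {N : ℕ} {a y : α} :
    y ∈ orbitList γ N a ↔ ∃ k < N, y = γ^[k] a := by
  induction N generalizing a with
  | zero => simp [orbitList]
  | succ N ih =>
    rw [orbitList, List.mem_cons, ih]
    constructor
    · rintro (rfl | ⟨k, hk, rfl⟩)
      · exact ⟨0, by omega, rfl⟩
      · exact ⟨k + 1, by omega, rfl⟩
    · rintro ⟨_ | k, hk, rfl⟩
      · exact Or.inl rfl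
      · exact Or.inr ⟨k, by omega, rfl⟩

variable {γ : α → α} {X : α → α → Bool}

theorem iterate_mem_of_forall {S : Finset α} (h : ∀ x ∈ S, γ x ∈ S) {x : α} (hx : x ∈ S) (k : ℕ) :
    γ^[k] x ∈ S := by
  induction k with
  | zero => exact hx
  | succ k ih =>
    rw [Function.iterate_succ_apply']
    exact h _ ih

theorem numInvariantIndependent_empty : numInvariantIndependent γ X ∅ = 1 := by
  have : (∅ : Finset α).powerset.filter (IsInvariantIndependent γ X) = {∅} := by
    ext S
    simp only [Finset.powerset_empty, Finset.mem_filter, Finset.mem_singleton,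
      and_iff_left_iff_imp]
    rintro rfl
    exact ⟨by simp, by simp⟩
  rw [numInvariantIndependent, this, Finset.card_singleton]

/-- Invariant independent sets are counted by distinguishing whether `a` belongs to them. -/
theorem numInvariantIndependent_eq_add {P : Finset α} {N : ℕ} (hN : 0 < N)
    (hX : ∀ x y, X x y = X y x) (hγ : ∀ x ∈ P, γ^[N] x = x) {a : α} (ha : a ∈ P) :
    numInvariantIndependent γ X P =
      numInvariantIndependent γ X (P.filter fun x => x ∉ orbitList γ N a) +
      if (∀ x ∈ orbitList γ N a, ∀ y ∈ orbitList γ N a, X x y = false) ∧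
          (∀ x ∈ orbitList γ N a, x ∈ P) then
        numInvariantIndependent γ X
          (P.filter fun x => ∀ y ∈ orbitList γ N a, x ≠ y ∧ X x y = false)
      else 0 := by
  -- An invariant set contains the whole orbit of `a` or nothing of it. The set `P` is not assumed
  -- to be invariant, so the orbit has to be tested for lying in `P`.
  have haO : a ∈ orbitList γ N a := mem_orbitList.2 ⟨0, hN, rfl⟩
  have hback : ∀ x ∈ orbitList γ N a, ∃ k, γ^[k] x = a := by
    intro x hx
    obtain ⟨k, hk, rfl⟩ := mem_orbitList.1 hx
    exact ⟨N - k, by rw [← Function.iterate_add_apply, Nat.sub_add_cancel hk.le, hγ a ha]⟩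
  have hstep : ∀ x ∈ orbitList γ N a, γ x ∈ orbitList γ N a := by
    intro x hx
    obtain ⟨k, hk, rfl⟩ := mem_orbitList.1 hx
    rw [← Function.iterate_succ_apply' γ k a]
    rcases Nat.lt_or_ge (k + 1) N with h | h
    · exact mem_orbitList.2 ⟨k + 1, h, rfl⟩
    · rw [show k.succ = N by omega, hγ a ha]
      exact haO
  have hout : ∀ S : Finset α, (∀ x ∈ S, γ x ∈ S) → a ∉ S → ∀ x ∈ S, x ∉ orbitList γ N a := by
    intro S hS haS x hx hxO
    obtain ⟨k, hk⟩ := hback x hxO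
    exact haS (hk ▸ iterate_mem_of_forall hS hx k)
  have hin : ∀ S : Finset α, (∀ x ∈ S, γ x ∈ S) → a ∈ S → ∀ x ∈ orbitList γ N a, x ∈ S := by
    intro S hS haS x hx
    obtain ⟨k, -, rfl⟩ := mem_orbitList.1 hx
    exact iterate_mem_of_forall hS haS k
  rw [numInvariantIndependent, ← Finset.card_filter_add_card_filter_not (fun S => a ∉ S)]
  congr 1
  · rw [numInvariantIndependent]
    congr 1
    ext S
    simp only [Finset.mem_filter, Finset.mem_powerset]
    constructor
    · rintro ⟨⟨hSP, hS⟩, haS⟩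
      exact ⟨fun x hx => Finset.mem_filter.2 ⟨hSP hx, hout S hS.1 haS x hx⟩, hS⟩
    · rintro ⟨hSP, hS⟩
      exact ⟨⟨hSP.trans (Finset.filter_subset _ _), hS⟩,
        fun haS => (Finset.mem_filter.1 (hSP haS)).2 haO⟩
  · split_ifs with hc
    · obtain ⟨hc1, hc2⟩ := hc
      rw [numInvariantIndependent]
      refine Finset.card_nbij' (fun S => S.filter fun x => x ∉ orbitList γ N a)
        (fun T => T ∪ (orbitList γ N a).toFinset) ?_ ?_ ?_ ?_
      · intro S hS
        simp only [Finset.coe_filter, Finset.mem_filter, Finset.mem_powerset, not_not,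
          Set.mem_ofPred_eq] at hS ⊢
        obtain ⟨⟨hSP, hS1, hS2⟩, haS⟩ := hS
        refine ⟨fun x hx => ?_, fun x hx => ?_, fun x hx y hy => ?_⟩
        · rw [Finset.mem_filter] at hx ⊢
          refine ⟨hSP hx.1, fun y hy => ⟨?_, hS2 x hx.1 y (hin S hS1 haS y hy)⟩⟩
          rintro rfl
          exact hx.2 hy
        · rw [Finset.mem_filter] at hx ⊢
          refine ⟨hS1 x hx.1, fun h => hx.2 ?_⟩
          -- If `γ x` is in the orbit, then so is `x`, which is recovered from `γ x` by `N - 1`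
          -- further steps.
          have h' : γ^[N - 1] (γ x) ∈ (orbitList γ N a).toFinset :=
            iterate_mem_of_forall (fun y hy => List.mem_toFinset.2 (hstep y (List.mem_toFinset.1 hy)))
              (List.mem_toFinset.2 h) _
          rwa [← Function.iterate_succ_apply, show (N - 1).succ = N by omega, hγ x (hSP hx.1),
            List.mem_toFinset] at h'
        · exact hS2 x (Finset.mem_filter.1 hx).1 y (Finset.mem_filter.1 hy).1
      · intro T hT
        simp only [Finset.coe_filter, Finset.mem_filter, Finset.mem_powerset, not_not,
          Set.mem_ofPred_eq] at hT ⊢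
        obtain ⟨hTP, hT1, hT2⟩ := hT
        have hT3 : ∀ x ∈ T, ∀ y ∈ orbitList γ N a, X x y = false := fun x hx y hy =>
          ((Finset.mem_filter.1 (hTP hx)).2 y hy).2
        refine ⟨⟨fun x hx => ?_, fun x hx => ?_, fun x hx y hy => ?_⟩, ?_⟩
        · rcases Finset.mem_union.1 hx with h | h
          · exact (Finset.mem_filter.1 (hTP h)).1
          · exact hc2 x (List.mem_toFinset.1 h)
        · rcases Finset.mem_union.1 hx with h | h
          · exact Finset.mem_union_left _ (hT1 x h)
          · exact Finset.mem_union_right _ (List.mem_toFinset.2 (hstep x (List.mem_toFinset.1 h)))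
        · rcases Finset.mem_union.1 hx with h | h <;> rcases Finset.mem_union.1 hy with h' | h'
          · exact hT2 x h y h'
          · exact hT3 x h y (List.mem_toFinset.1 h')
          · rw [hX]
            exact hT3 y h' x (List.mem_toFinset.1 h)
          · exact hc1 x (List.mem_toFinset.1 h) y (List.mem_toFinset.1 h')
        · exact Finset.mem_union_right _ (List.mem_toFinset.2 haO)
      · intro S hS
        simp only [Finset.coe_filter, Finset.mem_filter, Finset.mem_powerset, not_not,
          Set.mem_ofPred_eq] at hS
        obtain ⟨⟨hSP, hS1, hS2⟩, haS⟩ := hS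
        ext x
        simp only [Finset.mem_union, Finset.mem_filter, List.mem_toFinset]
        constructor
        · rintro (h | h)
          · exact h.1
          · exact hin S hS1 haS x h
        · intro h
          by_cases hx : x ∈ orbitList γ N a
          · exact Or.inr hx
          · exact Or.inl ⟨h, hx⟩
      · intro T hT
        simp only [Finset.coe_filter, Finset.mem_powerset, Set.mem_ofPred_eq] at hT
        ext x
        simp only [Finset.mem_union, Finset.mem_filter, List.mem_toFinset]
        constructor
        · rintro ⟨h | h, hx⟩
          · exact h
          · exact absurd h hx
        · intro h
          exact ⟨Or.inl h, fun hx => ((Finset.mem_filter.1 (hT.1 h)).2 x hx).1 rfl⟩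
    · rw [Finset.card_eq_zero, Finset.filter_eq_empty_iff]
      intro S hS haS
      rw [Finset.mem_filter, Finset.mem_powerset] at hS
      rw [not_not] at haS
      exact hc ⟨fun x hx y hy => hS.2.2 x (hin S hS.2.1 haS x hx) y (hin S hS.2.1 haS y hy),
        fun x hx => hS.1 (hin S hS.2.1 haS x hx)⟩

/-- Invariant independent sets of a union without conflicts, for the trivial action. -/
theorem numInvariantIndependent_union {A B : Finset α} (hAB : Disjoint A B)
    (hX : ∀ x y, X x y = X y x) (h : ∀ x ∈ A, ∀ y ∈ B, X x y = false) :
    numInvariantIndependent id X (A ∪ B) =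
      numInvariantIndependent id X A * numInvariantIndependent id X B := by
  rw [numInvariantIndependent, numInvariantIndependent, numInvariantIndependent,
    ← Finset.card_product]
  have hd : ∀ x, x ∈ A → x ∉ B := fun _ h => Finset.disjoint_left.1 hAB h
  refine Finset.card_nbij' (fun S => (S ∩ A, S ∩ B)) (fun p => p.1 ∪ p.2) ?_ ?_ ?_ ?_
  · intro S hS
    simp only [Finset.coe_filter, Finset.mem_powerset, Set.mem_ofPred_eq, Finset.coe_product,
      Set.mem_prod] at hS ⊢
    exact ⟨⟨Finset.inter_subset_right, fun x hx => hx, fun x hx y hy =>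
      hS.2.2 x (Finset.mem_inter.1 hx).1 y (Finset.mem_inter.1 hy).1⟩,
      ⟨Finset.inter_subset_right, fun x hx => hx, fun x hx y hy =>
      hS.2.2 x (Finset.mem_inter.1 hx).1 y (Finset.mem_inter.1 hy).1⟩⟩
  · rintro ⟨S, T⟩ hST
    simp only [Finset.coe_filter, Finset.mem_powerset, Set.mem_ofPred_eq, Finset.coe_product,
      Set.mem_prod] at hST ⊢
    obtain ⟨⟨hSA, -, hS⟩, hTB, -, hT⟩ := hST
    refine ⟨Finset.union_subset_union hSA hTB, fun x hx => hx, fun x hx y hy => ?_⟩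
    rcases Finset.mem_union.1 hx with hx | hx <;> rcases Finset.mem_union.1 hy with hy | hy
    · exact hS x hx y hy
    · exact h x (hSA hx) y (hTB hy)
    · rw [hX]
      exact h y (hSA hy) x (hTB hx)
    · exact hT x hx y hy
  · intro S hS
    simp only [Finset.coe_filter, Finset.mem_powerset, Set.mem_ofPred_eq] at hS
    simp only
    rw [← Finset.inter_union_distrib_left, Finset.inter_eq_left.2 hS.1]
  · rintro ⟨S, T⟩ hST
    simp only [Finset.coe_filter, Finset.mem_powerset, Set.mem_ofPred_eq, Finset.coe_product,
      Set.mem_prod] at hST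
    obtain ⟨⟨hSA, -⟩, hTB, -⟩ := hST
    ext x
    · simp only [Finset.mem_inter, Finset.mem_union]
      exact ⟨fun ⟨h1, h2⟩ => h1.resolve_right fun h3 => hd x h2 (hTB h3), fun h => ⟨Or.inl h, hSA h⟩⟩
    · simp only [Finset.mem_inter, Finset.mem_union]
      exact ⟨fun ⟨h1, h2⟩ => h1.resolve_left fun h3 => hd x (hSA h3) h2, fun h => ⟨Or.inr h, hTB h⟩⟩

end Independent

/-! ### Noncrossing sets of chords -/

/-- The chords `(p.1, p.2)` and `(q.1, q.2)` cross. -/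
def chordsCross (p q : ℕ × ℕ) : Bool :=
  (Nat.blt p.1 q.1 && Nat.blt q.1 p.2 && Nat.blt p.2 q.2) ||
    (Nat.blt q.1 p.1 && Nat.blt p.1 q.2 && Nat.blt q.2 p.2)

theorem Nat.blt_eq_true_iff {a b : ℕ} : Nat.blt a b = true ↔ a < b := by
  rw [Nat.blt, Nat.ble_eq]
  exact Iff.rfl

theorem chordsCross_eq_true {p q : ℕ × ℕ} : chordsCross p q = true ↔
    (p.1 < q.1 ∧ q.1 < p.2 ∧ p.2 < q.2) ∨ (q.1 < p.1 ∧ p.1 < q.2 ∧ q.2 < p.2) := by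
  simp only [chordsCross, Bool.or_eq_true, Bool.and_eq_true, Nat.blt_eq_true_iff, and_assoc]

theorem chordsCross_eq_false {p q : ℕ × ℕ} : chordsCross p q = false ↔
    ¬ ((p.1 < q.1 ∧ q.1 < p.2 ∧ p.2 < q.2) ∨ (q.1 < p.1 ∧ p.1 < q.2 ∧ q.2 < p.2)) := by
  rw [← chordsCross_eq_true, Bool.not_eq_true]

theorem chordsCross_comm (p q : ℕ × ℕ) : chordsCross p q = chordsCross q p := by
  rw [Bool.eq_iff_iff, chordsCross_eq_true, chordsCross_eq_true, or_comm]

/-- The chords with ends among `i, …, j` that join no consecutive numbers. -/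
def chordsWithin (i j : ℕ) : Finset (ℕ × ℕ) :=
  (Finset.range (j + 1) ×ˢ Finset.range (j + 1)).filter fun p =>
    i ≤ p.1 ∧ p.1 + 2 ≤ p.2 ∧ p.2 ≤ j

theorem mem_chordsWithin {i j : ℕ} {p : ℕ × ℕ} :
    p ∈ chordsWithin i j ↔ i ≤ p.1 ∧ p.1 + 2 ≤ p.2 ∧ p.2 ≤ j := by
  simp only [chordsWithin, Finset.mem_filter, Finset.mem_product, Finset.mem_range]
  omega

/-- The diagonals of the polygon with the vertices `i, …, j`. -/
def diagonals (i j : ℕ) : Finset (ℕ × ℕ) :=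
  (chordsWithin i j).erase (i, j)

theorem mem_diagonals {i j : ℕ} {p : ℕ × ℕ} :
    p ∈ diagonals i j ↔ ¬ (p.1 = i ∧ p.2 = j) ∧ i ≤ p.1 ∧ p.1 + 2 ≤ p.2 ∧ p.2 ≤ j := by
  simp only [diagonals, Finset.mem_erase, mem_chordsWithin, ne_eq, Prod.ext_iff]

/-- The number of noncrossing subsets. -/
def numNoncrossing (P : Finset (ℕ × ℕ)) : ℕ :=
  numInvariantIndependent id chordsCross P

theorem numNoncrossing_eq_add {P : Finset (ℕ × ℕ)} {a : ℕ × ℕ} (ha : a ∈ P) :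
    numNoncrossing P = numNoncrossing (P.erase a) +
      numNoncrossing (P.filter fun x => x ≠ a ∧ chordsCross x a = false) := by
  unfold numNoncrossing
  rw [numInvariantIndependent_eq_add (γ := id) (N := 1) one_pos chordsCross_comm (fun _ _ => rfl) ha,
    if_pos]
  · congr 2
    · ext x
      simp [orbitList, and_comm]
    · ext x
      simp [orbitList]
  · simp only [orbitList, List.mem_singleton, forall_eq]
    exact ⟨by rw [chordsCross_eq_false]; omega, ha⟩

/-- The chord from `i` to `j` crosses none of the others, so it can be added or omitted freely. -/
theorem numNoncrossing_chordsWithin_of_lt {i j : ℕ} (h : i + 2 ≤ j) :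
    numNoncrossing (chordsWithin i j) = 2 * numNoncrossing (diagonals i j) := by
  rw [numNoncrossing_eq_add (a := (i, j)) (mem_chordsWithin.2 ⟨le_rfl, h, le_rfl⟩), two_mul]
  congr 2
  ext p
  simp only [Finset.mem_filter, mem_chordsWithin, mem_diagonals, chordsCross_eq_false, ne_eq,
    Prod.ext_iff]
  omega

theorem numNoncrossing_eq_one_of_forall {P : Finset (ℕ × ℕ)} (h : ∀ p, p ∉ P) :
    numNoncrossing P = 1 := by
  rw [Finset.eq_empty_of_forall_notMem h]
  exact numInvariantIndependent_empty

/-- The diagonals of the polygon `i, …, j` that do not join `j` with a number below `k`. -/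
def diagonalsFrom (i j k : ℕ) : Finset (ℕ × ℕ) :=
  (diagonals i j).filter fun p => p.2 = j → k ≤ p.1

/-- Either the chord from `k` to `j` is absent, or it splits the polygon. In the second case the
chord from `i` to `k` may be used, and the two parts are independent. -/
theorem numNoncrossing_diagonalsFrom_step {i j k : ℕ} (hik : i < k) (hkj : k + 2 ≤ j) :
    numNoncrossing (diagonalsFrom i j k) = numNoncrossing (diagonalsFrom i j (k + 1)) +
      numNoncrossing (chordsWithin i k) * numNoncrossing (diagonals k j) := by
  rw [numNoncrossing_eq_add (a := (k, j))]
  · congr 1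
    · congr 1
      ext p
      simp only [diagonalsFrom, Finset.mem_erase, Finset.mem_filter, mem_diagonals, ne_eq,
        Prod.ext_iff]
      omega
    · rw [numNoncrossing, numNoncrossing, numNoncrossing,
        ← numInvariantIndependent_union _ chordsCross_comm]
      · congr 1
        ext p
        simp only [diagonalsFrom, Finset.mem_union, Finset.mem_filter, mem_diagonals,
          mem_chordsWithin, ne_eq, Prod.ext_iff, chordsCross_eq_false]
        omega
      · intro x hx y hy
        rw [mem_chordsWithin] at hx
        rw [mem_diagonals] at hy
        rw [chordsCross_eq_false]
        omega
      · rw [Finset.disjoint_left]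
        intro x hx hy
        rw [mem_chordsWithin] at hx
        rw [mem_diagonals] at hy
        omega
  · simp only [diagonalsFrom, Finset.mem_filter, mem_diagonals]
    omega

/-- The sum is over the smallest admissible neighbour `k + l` of `j`. The last index `l = d` is `j -
1`, a neighbour along a side: no diagonal at `j` is used. -/
theorem numNoncrossing_diagonalsFrom {i j k d : ℕ} (hik : i < k) (hkj : k + 1 + d = j) :
    numNoncrossing (diagonalsFrom i j k) = ∑ l ∈ Finset.range (d + 1),
      numNoncrossing (chordsWithin i (k + l)) * numNoncrossing (diagonals (k + l) j) := by
  induction d generalizing k with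
  | zero =>
    have h1 : numNoncrossing (diagonals k j) = 1 := numNoncrossing_eq_one_of_forall fun p => by
      rw [mem_diagonals]
      omega
    rw [Finset.sum_range_one, add_zero, h1, mul_one]
    congr 1
    ext p
    simp only [diagonalsFrom, Finset.mem_filter, mem_diagonals, mem_chordsWithin]
    omega
  | succ d ih =>
    rw [Finset.sum_range_succ', numNoncrossing_diagonalsFrom_step hik (by omega),
      ih (by omega) (by omega)]
    simp only [add_zero, add_right_comm, ← add_assoc]

/-- The recursion for the number of dissections of a polygon. -/
theorem numNoncrossing_diagonals_eq_sum {i j d : ℕ} (h : i + d + 2 = j) :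
    numNoncrossing (diagonals i j) = ∑ l ∈ Finset.range (d + 1),
      numNoncrossing (chordsWithin i (i + 1 + l)) * numNoncrossing (diagonals (i + 1 + l) j) := by
  rw [← numNoncrossing_diagonalsFrom (by omega) (by omega)]
  congr 1
  ext p
  simp only [diagonalsFrom, Finset.mem_filter, mem_diagonals]
  omega

/-- A sequence that satisfies the recursion for the numbers of dissections, up to the index `M`,
agrees with these numbers. -/
theorem numNoncrossing_diagonals_eq {c : ℕ → ℕ} {M : ℕ} (h1 : c 1 = 1)
    (h : ∀ d, d + 2 ≤ M → c (d + 2) = ∑ l ∈ Finset.range (d + 1),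
      (if l = 0 then 1 else 2 * c (l + 1)) * c (d + 1 - l)) (m : ℕ) (hm : 1 ≤ m) (hmM : m ≤ M)
    (i : ℕ) : numNoncrossing (diagonals i (i + m)) = c m := by
  induction m using Nat.strong_induction_on generalizing i with
  | _ m ih =>
    rcases hm.eq_or_lt with rfl | hm
    · rw [h1]
      exact numNoncrossing_eq_one_of_forall fun p => by
        rw [mem_diagonals]
        omega
    · obtain ⟨d, rfl⟩ := Nat.exists_eq_add_of_le' (Nat.succ_le_of_lt hm)
      rw [h d hmM, numNoncrossing_diagonals_eq_sum (d := d) (by omega)]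
      refine Finset.sum_congr rfl fun l hl => ?_
      rw [Finset.mem_range] at hl
      congr 1
      · split_ifs with h0
        · exact numNoncrossing_eq_one_of_forall fun p => by
            rw [mem_chordsWithin]
            omega
        · rw [numNoncrossing_chordsWithin_of_lt (by omega), show i + 1 + l = i + (l + 1) by omega,
            ih (l + 1) (by omega) (by omega) (by omega)]
      · rw [show i + (d + 1 + 1) = i + 1 + l + (d + 1 - l) by omega,
          ih (d + 1 - l) (by omega) (by omega) (by omega)]

/-! ### Computing the number of invariant noncrossing sets -/

/-- Equality of pairs of numbers, in a form that evaluates fast. -/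
def pairEq (p q : ℕ × ℕ) : Bool :=
  Nat.beq p.1 q.1 && Nat.beq p.2 q.2

theorem pairEq_eq_true {p q : ℕ × ℕ} : pairEq p q = true ↔ p = q := by
  simp [pairEq, Prod.ext_iff]

theorem pairEq_eq_false {p q : ℕ × ℕ} : pairEq p q = false ↔ p ≠ q := by
  rw [ne_eq, ← pairEq_eq_true, Bool.not_eq_true]

/-- The number of noncrossing sublists that are invariant under a map `γ` of order `N`. -/
def countInvariant (γ : ℕ × ℕ → ℕ × ℕ) (N : ℕ) : ℕ → List (ℕ × ℕ) → ℕ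
  -- The number matched here only bounds the depth of the recursion. If it is at least the length of
  -- the list, it runs out only when the list is empty, where 1 is right.
  | 0, _ => 1
  | _ + 1, [] => 1
  | f + 1, a :: L =>
    countInvariant γ N f (L.filter fun x => (orbitList γ N a).all fun y => !pairEq x y) +
    bif ((orbitList γ N a).all fun x => (orbitList γ N a).all fun y => !chordsCross x y) &&
        ((orbitList γ N a).all fun x => pairEq x a || L.any (pairEq x)) then
      countInvariant γ N f
        (L.filter fun x => (orbitList γ N a).all fun y => !pairEq x y && !chordsCross x y)
    else 0

/-- The algorithm is the recursion of `numInvariantIndependent_eq_add`, with the head of the list as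
the distinguished element. -/
theorem countInvariant_eq {γ : ℕ × ℕ → ℕ × ℕ} {N : ℕ} (hN : 0 < N) (f : ℕ) :
    ∀ L : List (ℕ × ℕ), L.length ≤ f → (∀ x ∈ L, γ^[N] x = x) →
      countInvariant γ N f L = numInvariantIndependent γ chordsCross L.toFinset := by
  induction f with
  | zero =>
    intro L hL _
    rw [List.eq_nil_of_length_eq_zero (Nat.le_zero.1 hL)]
    exact numInvariantIndependent_empty.symm
  | succ f ih =>
    rintro (_ | ⟨a, L⟩) hL hγ
    · exact numInvariantIndependent_empty.symm
    have hlen : L.length ≤ f := by simpa using hL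
    have haO : a ∈ orbitList γ N a := mem_orbitList.2 ⟨0, hN, rfl⟩
    rw [countInvariant, ih _ ((List.length_filter_le _ _).trans hlen)
      (fun x hx => hγ x (List.mem_cons_of_mem _ (List.mem_filter.1 hx).1)),
      ih _ ((List.length_filter_le _ _).trans hlen)
      (fun x hx => hγ x (List.mem_cons_of_mem _ (List.mem_filter.1 hx).1)),
      numInvariantIndependent_eq_add hN chordsCross_comm (fun x hx => hγ x (List.mem_toFinset.1 hx))
        (a := a) (by simp)]
    congr 1
    · congr 1
      ext x
      simp only [List.mem_toFinset, List.mem_filter, Finset.mem_filter, List.mem_cons,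
        List.all_eq_true, Bool.not_eq_true', pairEq_eq_false]
      constructor
      · rintro ⟨h1, h2⟩
        exact ⟨Or.inr h1, fun h => h2 x h rfl⟩
      · rintro ⟨rfl | h1, h2⟩
        · exact absurd haO h2
        · exact ⟨h1, fun y hy e => h2 (e ▸ hy)⟩
    · rw [Bool.cond_eq_ite]
      congr 1
      · simp only [Bool.and_eq_true, List.all_eq_true, Bool.not_eq_true', Bool.or_eq_true,
          pairEq_eq_true, List.any_eq_true, List.mem_toFinset, List.mem_cons, exists_eq_right']
      · congr 1
        ext x
        simp only [List.mem_toFinset, List.mem_filter, Finset.mem_filter, List.mem_cons,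
          List.all_eq_true, Bool.not_eq_true', pairEq_eq_false, Bool.and_eq_true]
        constructor
        · rintro ⟨h1, h2⟩
          exact ⟨Or.inr h1, h2⟩
        · rintro ⟨rfl | h1, h2⟩
          · exact absurd rfl (h2 x haO).1
          · exact ⟨h1, h2⟩

/-- The diagonals of the `n`-gon. -/
def diagonalList (n : ℕ) : List (ℕ × ℕ) :=
  (List.range n).flatMap fun a =>
    ((List.range n).filter fun b => Nat.ble (a + 2) b && Nat.blt (b + 1) (n + a)).map fun b => (a, b)

theorem diagonalList_toFinset {n : ℕ} (hn : 1 ≤ n) :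
    (diagonalList n).toFinset = diagonals 0 (n - 1) := by
  ext ⟨a, b⟩
  simp only [diagonalList, List.mem_toFinset, List.mem_flatMap, List.mem_map, List.mem_filter,
    List.mem_range, Bool.and_eq_true, Nat.ble_eq, Nat.blt_eq_true_iff, mem_diagonals,
    Prod.mk.injEq]
  constructor
  · rintro ⟨a, ha, b, hb, rfl, rfl⟩
    omega
  · intro h
    exact ⟨a, by omega, b, by omega, rfl, rfl⟩

/-! ### Dissections as sets of chords, and the action of symmetries -/

/-- The chord with the ends `a` and `b`. -/
def orderedPair (a b : ℕ) : ℕ × ℕ :=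
  bif Nat.ble a b then (a, b) else (b, a)

theorem orderedPair_of_le {a b : ℕ} (h : a ≤ b) : orderedPair a b = (a, b) := by
  rw [orderedPair, Nat.ble_eq_true_of_le h]
  rfl

theorem orderedPair_of_lt {a b : ℕ} (h : a < b) : orderedPair b a = (a, b) := by
  have : Nat.ble b a = false := Bool.eq_false_iff.2 fun e => by
    rw [Nat.ble_eq] at e
    omega
  rw [orderedPair, this]
  rfl

theorem orderedPair_comm (a b : ℕ) : orderedPair a b = orderedPair b a := by
  rcases lt_trichotomy a b with h | rfl | h
  · rw [orderedPair_of_le h.le, orderedPair_of_lt h]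
  · rfl
  · rw [orderedPair_of_le h.le, orderedPair_of_lt h]

/-- The action of a map of the vertices on the chords. -/
def chordMap (s : ℕ → ℕ) (p : ℕ × ℕ) : ℕ × ℕ :=
  orderedPair (s p.1) (s p.2)

theorem chordMap_orderedPair (s : ℕ → ℕ) (a b : ℕ) :
    chordMap s (orderedPair a b) = orderedPair (s a) (s b) := by
  rcases le_total a b with h | h
  · rw [orderedPair_of_le h, chordMap]
  · rw [orderedPair_comm a b, orderedPair_of_le h, chordMap, orderedPair_comm]

section Chords

variable {n : ℕ} {σ : Equiv.Perm (Fin n)} {s : ℕ → ℕ}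

theorem chordMap_iterate (hs : ∀ i : Fin n, s i.val = (σ i).val) (i j : Fin n) (k : ℕ) :
    (chordMap s)^[k] (orderedPair i.val j.val) =
      orderedPair (σ^[k] i).val (σ^[k] j).val := by
  induction k with
  | zero => rfl
  | succ k ih =>
    rw [Function.iterate_succ_apply', ih, chordMap_orderedPair, hs, hs,
      Function.iterate_succ_apply', Function.iterate_succ_apply']

theorem chordMap_iterate_eq_self (hs : ∀ i : Fin n, s i.val = (σ i).val) {N : ℕ}
    (hσ : ∀ i, σ^[N] i = i) {p : ℕ × ℕ} (hp : p ∈ diagonals 0 (n - 1)) :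
    (chordMap s)^[N] p = p := by
  obtain ⟨a, b⟩ := p
  rw [mem_diagonals] at hp
  dsimp only at hp
  have h := chordMap_iterate hs ⟨a, by omega⟩ ⟨b, by omega⟩ N
  rwa [hσ, hσ, orderedPair_of_le (by dsimp only; omega)] at h

variable [NeZero n]

theorem Fin.val_add_one_eq_ite (k : Fin n) :
    (k + 1).val = if k.val + 1 = n then 0 else k.val + 1 := by
  have := k.2
  rw [Fin.val_add, Fin.val_one', Nat.add_mod_mod]
  split_ifs with h
  · rw [h, Nat.mod_self]
  · exact Nat.mod_eq_of_lt (by omega)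

/-- Two vertices of a polygon are adjacent or the ends of a diagonal, but not both. -/
theorem not_side_iff_mem_diagonals (hn : 3 ≤ n) {i j : Fin n} (hij : i ≠ j) :
    ¬ (j = i + 1 ∨ i = j + 1) ↔ orderedPair i.val j.val ∈ diagonals 0 (n - 1) := by
  have hij' : i.val ≠ j.val := fun e => hij (Fin.ext e)
  have hi := i.2
  have hj := j.2
  simp only [Fin.ext_iff, Fin.val_add_one_eq_ite]
  rcases le_total i.val j.val with h | h
  · rw [orderedPair_of_le h, mem_diagonals]
    split_ifs <;> omega
  · rw [orderedPair_comm, orderedPair_of_le h, mem_diagonals]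
    split_ifs <;> omega

open Classical in
/-- The diagonals that occur in a graph. -/
noncomputable def SimpleGraph.diagonalSet (G : SimpleGraph (Fin n)) : Finset (ℕ × ℕ) :=
  (diagonals 0 (n - 1)).filter fun p => ∃ i j, G.Adj i j ∧ p = orderedPair i.val j.val

theorem orderedPair_inj {i j k l : Fin n} (h : orderedPair i.val j.val = orderedPair k.val l.val) :
    (i = k ∧ j = l) ∨ (i = l ∧ j = k) := by
  simp only [Fin.ext_iff]
  rcases le_total i.val j.val with h1 | h1 <;> rcases le_total k.val l.val with h2 | h2
  · rw [orderedPair_of_le h1, orderedPair_of_le h2, Prod.mk.injEq] at h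
    omega
  · rw [orderedPair_of_le h1, orderedPair_comm k.val, orderedPair_of_le h2, Prod.mk.injEq] at h
    omega
  · rw [orderedPair_comm i.val, orderedPair_of_le h1, orderedPair_of_le h2, Prod.mk.injEq] at h
    omega
  · rw [orderedPair_comm i.val, orderedPair_of_le h1, orderedPair_comm k.val, orderedPair_of_le h2,
      Prod.mk.injEq] at h
    omega

theorem SimpleGraph.orderedPair_mem_diagonalSet {G : SimpleGraph (Fin n)} {i j : Fin n} :
    orderedPair i.val j.val ∈ G.diagonalSet ↔
      orderedPair i.val j.val ∈ diagonals 0 (n - 1) ∧ G.Adj i j := by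
  classical
  rw [SimpleGraph.diagonalSet, Finset.mem_filter]
  refine and_congr_right fun _ => ⟨?_, fun h => ⟨i, j, h, rfl⟩⟩
  rintro ⟨k, l, hkl, h⟩
  rcases orderedPair_inj h with ⟨rfl, rfl⟩ | ⟨rfl, rfl⟩
  · exact hkl
  · exact hkl.symm

/-- The sides of the polygon together with a set of diagonals. -/
def polygonWithDiagonals (n : ℕ) [NeZero n] (S : Finset (ℕ × ℕ)) : SimpleGraph (Fin n) where
  Adj i j := i ≠ j ∧ ((j = i + 1 ∨ i = j + 1) ∨ orderedPair i.val j.val ∈ S)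
  symm := ⟨fun i j h => ⟨h.1.symm, h.2.imp Or.symm fun h => by rwa [orderedPair_comm]⟩⟩
  loopless := ⟨fun _ h => h.1 rfl⟩

theorem exists_orderedPair_of_mem_diagonals {p : ℕ × ℕ} (hp : p ∈ diagonals 0 (n - 1)) :
    ∃ i j : Fin n, i ≠ j ∧ p = orderedPair i.val j.val := by
  obtain ⟨a, b⟩ := p
  rw [mem_diagonals] at hp
  dsimp only at hp
  refine ⟨⟨a, by omega⟩, ⟨b, by omega⟩, ?_, (orderedPair_of_le (by omega)).symm⟩
  rw [ne_eq, Fin.mk.injEq]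
  omega

theorem polygonWithDiagonals_diagonalSet (hn : 3 ≤ n) {G : SimpleGraph (Fin n)}
    (hG : IsDissection G) : polygonWithDiagonals n G.diagonalSet = G := by
  ext i j
  change (i ≠ j ∧ _) ↔ _
  rw [SimpleGraph.orderedPair_mem_diagonalSet]
  constructor
  · rintro ⟨_, (rfl | rfl) | h⟩
    · exact hG.1 i
    · exact (hG.1 j).symm
    · exact h.2
  · intro h
    refine ⟨h.ne, ?_⟩
    rw [← not_side_iff_mem_diagonals hn h.ne]
    tauto

theorem diagonalSet_polygonWithDiagonals (hn : 3 ≤ n) {S : Finset (ℕ × ℕ)}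
    (hS : S ⊆ diagonals 0 (n - 1)) : (polygonWithDiagonals n S).diagonalSet = S := by
  classical
  ext p
  constructor
  · intro hp
    obtain ⟨i, j, hij, rfl⟩ := exists_orderedPair_of_mem_diagonals (Finset.mem_filter.1 hp).1
    obtain ⟨h1, -, h2⟩ := SimpleGraph.orderedPair_mem_diagonalSet.1 hp
    exact h2.resolve_left ((not_side_iff_mem_diagonals hn hij).2 h1)
  · intro hp
    obtain ⟨i, j, hij, rfl⟩ := exists_orderedPair_of_mem_diagonals (hS hp)
    exact SimpleGraph.orderedPair_mem_diagonalSet.2 ⟨hS hp, hij, Or.inr hp⟩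

theorem isDissection_polygonWithDiagonals (hn : 3 ≤ n) {S : Finset (ℕ × ℕ)}
    (hS : ∀ p ∈ S, ∀ q ∈ S, chordsCross p q = false) :
    IsDissection (polygonWithDiagonals n S) := by
  refine ⟨fun i => ⟨(Fin.add_one_ne_self (by omega) i).symm, Or.inl (Or.inl rfl)⟩, ?_⟩
  rintro a b c d hab hbc hcd ⟨⟨hac', hac⟩, ⟨hbd', hbd⟩⟩
  simp only [Fin.lt_def] at hab hbc hcd
  have h1 := d.2
  have hac2 : orderedPair a.val c.val ∈ S := hac.resolve_left (by
    simp only [Fin.ext_iff, Fin.val_add_one_eq_ite]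
    split_ifs <;> omega)
  have hbd2 : orderedPair b.val d.val ∈ S := hbd.resolve_left (by
    simp only [Fin.ext_iff, Fin.val_add_one_eq_ite]
    split_ifs <;> omega)
  have := hS _ hac2 _ hbd2
  rw [orderedPair_of_le (by omega), orderedPair_of_le (by omega), chordsCross_eq_false] at this
  dsimp only at this
  omega

theorem IsDissection.diagonalSet_noncrossing {G : SimpleGraph (Fin n)} (hG : IsDissection G) :
    ∀ p ∈ G.diagonalSet, ∀ q ∈ G.diagonalSet, chordsCross p q = false := by
  classical
  have key : ∀ p ∈ G.diagonalSet, ∀ q ∈ G.diagonalSet,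
      ¬ (p.1 < q.1 ∧ q.1 < p.2 ∧ p.2 < q.2) := by
    rintro ⟨a, c⟩ hp ⟨b, d⟩ hq ⟨h1, h2, h3⟩
    have hp' := mem_diagonals.1 (Finset.mem_filter.1 hp).1
    have hq' := mem_diagonals.1 (Finset.mem_filter.1 hq).1
    dsimp only at h1 h2 h3 hp' hq'
    have hac : (a, c) = orderedPair (⟨a, by omega⟩ : Fin n).val (⟨c, by omega⟩ : Fin n).val :=
      (orderedPair_of_le (by omega)).symm
    have hbd : (b, d) = orderedPair (⟨b, by omega⟩ : Fin n).val (⟨d, by omega⟩ : Fin n).val :=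
      (orderedPair_of_le (by omega)).symm
    rw [hac, SimpleGraph.orderedPair_mem_diagonalSet] at hp
    rw [hbd, SimpleGraph.orderedPair_mem_diagonalSet] at hq
    exact hG.2 _ _ _ _ h1 h2 h3 ⟨hp.2, hq.2⟩
  intro p hp q hq
  rw [chordsCross_eq_false]
  rintro (h | h)
  · exact key p hp q hq h
  · exact key q hq p hp h

/-- The dissections that are invariant under a symmetry `σ` of the polygon correspond to the
invariant noncrossing sets of diagonals. -/
theorem card_invariant_dissections (hn : 3 ≤ n) (hs : ∀ i : Fin n, s i.val = (σ i).val)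
    (hσ : ∀ i j, (σ j = σ i + 1 ∨ σ i = σ j + 1) ↔ (j = i + 1 ∨ i = j + 1)) :
    Nat.card {G : SimpleGraph (Fin n) // IsDissection G ∧
      ∀ i j, G.Adj i j ↔ G.Adj (σ i) (σ j)} =
      numInvariantIndependent (chordMap s) chordsCross (diagonals 0 (n - 1)) := by
  classical
  have hmap : ∀ i j : Fin n, chordMap s (orderedPair i.val j.val) =
      orderedPair (σ i).val (σ j).val := fun i j => by rw [chordMap_orderedPair, hs, hs]
  rw [numInvariantIndependent, ← Fintype.card_coe, ← Nat.card_eq_fintype_card]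
  refine Nat.card_congr ⟨fun G => ⟨G.1.diagonalSet, ?_⟩,
    fun S => ⟨polygonWithDiagonals n S.1, ?_⟩, ?_, ?_⟩
  · obtain ⟨G, hG, hinv⟩ := G
    rw [Finset.mem_filter, Finset.mem_powerset]
    refine ⟨Finset.filter_subset _ _, fun p hp => ?_, hG.diagonalSet_noncrossing⟩
    obtain ⟨i, j, hij, rfl⟩ := exists_orderedPair_of_mem_diagonals (Finset.mem_filter.1 hp).1
    rw [hmap]
    rw [SimpleGraph.orderedPair_mem_diagonalSet] at hp ⊢
    rw [← not_side_iff_mem_diagonals hn hij] at hp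
    rw [← not_side_iff_mem_diagonals hn (σ.injective.ne hij), hσ, ← hinv]
    exact hp
  · obtain ⟨S, hS⟩ := S
    rw [Finset.mem_filter, Finset.mem_powerset] at hS
    obtain ⟨-, hS1, hS2⟩ := hS
    refine ⟨isDissection_polygonWithDiagonals hn hS2, ?_⟩
    have hfwd : ∀ p : Fin n × Fin n, (polygonWithDiagonals n S).Adj p.1 p.2 →
        (polygonWithDiagonals n S).Adj (σ.prodCongr σ p).1 (σ.prodCongr σ p).2 := by
      rintro ⟨i, j⟩ ⟨hij, h⟩
      refine ⟨σ.injective.ne hij, h.imp (hσ i j).2 fun h => ?_⟩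
      change orderedPair (σ i).val (σ j).val ∈ S
      rw [← hmap]
      exact hS1 _ h
    intro i j
    refine ⟨hfwd (i, j), fun h => ?_⟩
    -- Invariance of `S` only says that `σ` maps edges to edges; being injective on a finite set of
    -- edges, it is also onto.
    obtain ⟨⟨x, hx⟩, hxe⟩ := Finite.surjective_of_injective
      (f := fun p : {p : Fin n × Fin n // (polygonWithDiagonals n S).Adj p.1 p.2} =>
        (⟨_, hfwd p.1 p.2⟩ : {p : Fin n × Fin n // (polygonWithDiagonals n S).Adj p.1 p.2}))
      (fun p q e => Subtype.ext ((σ.prodCongr σ).injective (congrArg Subtype.val e)))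
      ⟨(σ i, σ j), h⟩
    have e : x = (i, j) := (σ.prodCongr σ).injective (congrArg Subtype.val hxe)
    rwa [e] at hx
  · rintro ⟨G, hG, hinv⟩
    exact Subtype.ext (polygonWithDiagonals_diagonalSet hn hG)
  · rintro ⟨S, hS⟩
    exact Subtype.ext (diagonalSet_polygonWithDiagonals hn
      (Finset.mem_powerset.1 (Finset.mem_filter.1 hS).1))

end Chords

/-! ### Counting the dissections up to symmetry -/

/-- Crossing is a statement about cyclic order and is symmetric under reversal, so rotations and
reflections preserve it. -/
theorem IsDissection.comap {n : ℕ} [NeZero n] {G : SimpleGraph (Fin n)} (hG : IsDissection G)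
    {f : Fin n → Fin n} (hside : ∀ i, f (i + 1) = f i + 1 ∨ f i = f (i + 1) + 1)
    (hcyc : (∀ a b c, CycLt a.val b.val c.val → CycLt (f a).val (f b).val (f c).val) ∨
      ∀ a b c, CycLt a.val b.val c.val → CycLt (f c).val (f b).val (f a).val) :
    IsDissection (G.comap f) := by
  constructor
  · intro i
    change G.Adj (f i) (f (i + 1))
    rcases hside i with h | h
    · rw [h]
      exact hG.1 _
    · rw [h]
      exact (hG.1 _).symm
  · rintro a b c d hab hbc hcd ⟨h1, h2⟩
    change G.Adj (f a) (f c) at h1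
    change G.Adj (f b) (f d) at h2
    have h3 : CycLt a.val b.val c.val := by
      unfold CycLt
      omega
    have h4 : CycLt c.val d.val a.val := by
      unfold CycLt
      omega
    rcases hcyc with h | h
    · exact hG.not_cross h1 h2 (h _ _ _ h3) (h _ _ _ h4)
    · exact hG.not_cross h1.symm h2 (h _ _ _ h3) (h _ _ _ h4)

section Action

variable {n : ℕ} [NeZero n]

/-- The dissection rotated by `t`. -/
def rotateDissection (t : Fin n) (G : {G : SimpleGraph (Fin n) // IsDissection G}) :
    {G : SimpleGraph (Fin n) // IsDissection G} :=
  ⟨G.1.comap fun i => i - t, G.2.comap (fun i => Or.inl (by rw [add_sub_right_comm]))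
    (Or.inl fun a b c h => by simpa only [sub_eq_add_neg, cycLt_val_add] using h)⟩

/-- The dissection reflected by `i ↦ t - i`. -/
def reflectDissection (t : Fin n) (G : {G : SimpleGraph (Fin n) // IsDissection G}) :
    {G : SimpleGraph (Fin n) // IsDissection G} :=
  ⟨G.1.comap fun i => t - i, G.2.comap (fun i => Or.inr (by abel))
    (Or.inr fun a b c h => by simpa only [cycLt_val_sub] using h)⟩

/-- By `h` the map `γ` carries a dissection along `σ`, so its fixed points are the `σ`-invariant
dissections. -/
theorem card_fixed_eq {γ : {G : SimpleGraph (Fin n) // IsDissection G} →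
    {G : SimpleGraph (Fin n) // IsDissection G}} {σ : Equiv.Perm (Fin n)}
    (h : ∀ G i j, (γ G).1.Adj (σ i) (σ j) ↔ G.1.Adj i j) (hn : 3 ≤ n) {s : ℕ → ℕ}
    (hs : ∀ i : Fin n, s i.val = (σ i).val)
    (hσ : ∀ i j, (σ j = σ i + 1 ∨ σ i = σ j + 1) ↔ (j = i + 1 ∨ i = j + 1)) :
    Nat.card {G // γ G = G} =
      numInvariantIndependent (chordMap s) chordsCross (diagonals 0 (n - 1)) := by
  rw [← card_invariant_dissections hn hs hσ]
  have key : ∀ G, γ G = G ↔ ∀ i j, G.1.Adj i j ↔ G.1.Adj (σ i) (σ j) := by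
    intro G
    rw [Subtype.ext_iff, SimpleGraph.ext_iff, funext_iff, σ.surjective.forall]
    refine forall_congr' fun i => ?_
    rw [funext_iff, σ.surjective.forall]
    refine forall_congr' fun j => ?_
    rw [h, eq_iff_iff]
  exact Nat.card_congr ((Equiv.subtypeEquivRight key).trans
    (Equiv.subtypeSubtypeEquivSubtypeInter IsDissection
      (fun G : SimpleGraph (Fin n) => ∀ i j, G.Adj i j ↔ G.Adj (σ i) (σ j))))

theorem card_fixed_rotate (hn : 3 ≤ n) (t : Fin n) :
    Nat.card {G // rotateDissection t G = G} =
      numInvariantIndependent (chordMap fun a => (a + t.val) % n) chordsCross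
        (diagonals 0 (n - 1)) := by
  refine card_fixed_eq (σ := Equiv.addRight t) (fun G i j => ?_) hn
    (fun i => (Fin.val_add i t).symm) fun i j => ?_
  · change G.1.Adj (i + t - t) (j + t - t) ↔ _
    rw [add_sub_cancel_right, add_sub_cancel_right]
  · change (j + t = i + t + 1 ∨ i + t = j + t + 1) ↔ _
    rw [add_right_comm i, add_right_comm j, add_left_inj, add_left_inj]

theorem card_fixed_reflect (hn : 3 ≤ n) (t : Fin n) :
    Nat.card {G // reflectDissection t G = G} =
      numInvariantIndependent (chordMap fun a => (n - a + t.val) % n) chordsCross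
        (diagonals 0 (n - 1)) := by
  refine card_fixed_eq (σ := Equiv.subLeft t) (fun G i j => ?_) hn
    (fun i => (Fin.val_sub t i).symm) fun i j => ?_
  · change G.1.Adj (t - (t - i)) (t - (t - j)) ↔ _
    rw [sub_sub_cancel, sub_sub_cancel]
  · change (t - j = t - i + 1 ∨ t - i = t - j + 1) ↔ _
    rw [sub_add, sub_add, sub_right_inj, sub_right_inj, eq_sub_iff_add_eq, eq_sub_iff_add_eq,
      or_comm, eq_comm, @eq_comm _ _ i, or_comm]

theorem numInvariantIndependent_congr {α : Type} [DecidableEq α] {γ γ' : α → α}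
    {X : α → α → Bool} {P : Finset α} (h : ∀ x ∈ P, γ x = γ' x) :
    numInvariantIndependent γ X P = numInvariantIndependent γ' X P := by
  unfold numInvariantIndependent
  congr 1
  refine Finset.filter_congr fun S hS => and_congr_left fun _ => forall₂_congr fun x hx => ?_
  rw [h x (Finset.mem_powerset.1 hS hx)]

/-- The number of noncrossing sets of diagonals of the polygon with `m + 1 ≤ 14` vertices. -/
def superCatalan (m : ℕ) : ℕ :=
  [0, 1, 1, 3, 11, 45, 197, 903, 4279, 20793, 103049, 518859, 2646723, 13648869].getD m 0

theorem numNoncrossing_diagonals_eq_superCatalan {m : ℕ} (hm : 1 ≤ m) (hm' : m ≤ 13) :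
    numNoncrossing (diagonals 0 m) = superCatalan m := by
  have := numNoncrossing_diagonals_eq (c := superCatalan) (M := 13) rfl (fun d hd => by
    have : d ≤ 11 := by omega
    interval_cases d <;> decide +kernel) m hm hm' 0
  rwa [zero_add] at this

/-- The identity fixes all dissections, up to 13648869 of them, so it is treated by the Schröder
recursion and not by branching over sets. -/
theorem card_fixed_rotate_zero (hn : 3 ≤ n) (hn' : n ≤ 14) :
    Nat.card {G // rotateDissection (0 : Fin n) G = G} = superCatalan (n - 1) := by
  rw [card_fixed_rotate hn, ← numNoncrossing_diagonals_eq_superCatalan (by omega) (by omega)]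
  refine numInvariantIndependent_congr fun x hx => ?_
  rw [mem_diagonals] at hx
  rw [chordMap, Fin.val_zero, add_zero, add_zero, Nat.mod_eq_of_lt (by omega),
    Nat.mod_eq_of_lt (by omega), orderedPair_of_le (by omega), id]

/-- The number of sets of diagonals of the `n`-gon that are invariant under the map `s` of
order `N` and noncrossing. -/
def countInvariantDissections (n : ℕ) (s : ℕ → ℕ) (N : ℕ) : ℕ :=
  countInvariant (chordMap s) N (diagonalList n).length (diagonalList n)

theorem countInvariantDissections_eq {σ : Equiv.Perm (Fin n)} {s : ℕ → ℕ} {N : ℕ} (hN : 0 < N)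
    (hs : ∀ i : Fin n, s i.val = (σ i).val) (hσ : ∀ i, σ^[N] i = i) :
    countInvariantDissections n s N =
      numInvariantIndependent (chordMap s) chordsCross (diagonals 0 (n - 1)) := by
  have hn : 1 ≤ n := Nat.one_le_iff_ne_zero.2 (NeZero.ne n)
  rw [countInvariantDissections, countInvariant_eq hN _ _ le_rfl, diagonalList_toFinset hn]
  intro x hx
  rw [← List.mem_toFinset, diagonalList_toFinset hn] at hx
  exact chordMap_iterate_eq_self hs hσ hx

/-- The rotation by `t` returns to the identity after `n / gcd n t` steps, since this multiple of
`t` is divisible by `n`. -/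
theorem card_fixed_rotate_eq (hn : 3 ≤ n) (t : Fin n) :
    Nat.card {G // rotateDissection t G = G} =
      countInvariantDissections n (fun a => (a + t.val) % n) (n / n.gcd t.val) := by
  rw [card_fixed_rotate hn, countInvariantDissections_eq (σ := Equiv.addRight t)
    (Nat.div_pos (Nat.gcd_le_left _ (by omega)) (Nat.gcd_pos_of_pos_left _ (by omega)))
    (fun i => (Fin.val_add i t).symm)]
  intro i
  have h : ∀ k : ℕ, ((Equiv.addRight t)^[k] i).val = (i.val + k * t.val) % n := by
    intro k
    induction k with
    | zero => simp [Nat.mod_eq_of_lt i.2]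
    | succ k ih =>
      rw [Function.iterate_succ_apply', Equiv.coe_addRight, Fin.val_add,
        ← Equiv.coe_addRight, ih, Nat.mod_add_mod]
      congr 1
      ring
  ext
  rw [h]
  obtain ⟨c, hc⟩ := Nat.gcd_dvd_right n t.val
  have : n / n.gcd t.val * t.val = n * c := by
    calc n / n.gcd t.val * t.val = n / n.gcd t.val * (n.gcd t.val * c) := by rw [← hc]
      _ = n * c := by rw [← mul_assoc, Nat.div_mul_cancel (Nat.gcd_dvd_left n _)]
  rw [this, Nat.add_mul_mod_self_left, Nat.mod_eq_of_lt i.2]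

theorem card_fixed_reflect_eq (hn : 3 ≤ n) (t : Fin n) :
    Nat.card {G // reflectDissection t G = G} =
      countInvariantDissections n (fun a => (n - a + t.val) % n) 2 := by
  rw [card_fixed_reflect hn, countInvariantDissections_eq (σ := Equiv.subLeft t) two_pos
    (fun i => (Fin.val_sub t i).symm)]
  exact fun i => sub_sub_cancel t i

/-- The sum, over the symmetries of the `n`-gon, of the numbers of invariant dissections. -/
def totalInvariantDissections (n : ℕ) : ℕ :=
  -- The three summands belong to the identity, to the rotations by `1, …, n - 1`, and to the
  -- reflections, of which `i ↦ 0 - i` and `i ↦ 1 - i` represent the two kinds.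
  superCatalan (n - 1) +
    ((List.range (n - 1)).map fun t => countInvariantDissections n (fun a => (a + (t + 1)) % n)
      (n / n.gcd (t + 1))).sum +
    ((n + 1) / 2 * countInvariantDissections n (fun a => (n - a + 0) % n) 2 +
      n / 2 * countInvariantDissections n (fun a => (n - a + 1) % n) 2)

theorem dissectionCount_mul (hn : 3 ≤ n) (hn' : n ≤ 14) :
    dissectionCount n * (2 * n) = totalInvariantDissections n := by
  rw [dissectionCount, card_quotient_mul_eq_sum_fixed_rotation rotateDissection reflectDissection]
  · rw [totalInvariantDissections, card_fixed_reflect_eq hn, card_fixed_reflect_eq hn, Fin.val_zero,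
      Fin.val_one', Nat.mod_eq_of_lt (by omega : 1 < n)]
    congr 1
    obtain ⟨m, rfl⟩ : ∃ m, n = m + 1 := ⟨n - 1, by omega⟩
    rw [Fin.sum_univ_succ, card_fixed_rotate_zero hn hn']
    congr 1
    rw [Nat.add_sub_cancel, ← List.sum_toFinset _ List.nodup_range, List.toFinset_range,
      ← Fin.sum_univ_eq_sum_range (fun t => countInvariantDissections (m + 1)
        (fun a => (a + (t + 1)) % (m + 1)) ((m + 1) / (m + 1).gcd (t + 1)))]
    refine Finset.sum_congr rfl fun t _ => ?_
    rw [card_fixed_rotate_eq hn, Fin.val_succ]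
  · intro G
    refine Subtype.ext (SimpleGraph.ext ?_)
    ext i j
    change G.1.Adj (i - 0) (j - 0) ↔ _
    rw [sub_zero, sub_zero]
  · intro s t G
    refine Subtype.ext (SimpleGraph.ext ?_)
    ext i j
    change G.1.Adj (i - s - t) (j - s - t) ↔ G.1.Adj (i - (s + t)) (j - (s + t))
    rw [sub_sub, sub_sub]
  · intro s t G
    refine Subtype.ext (SimpleGraph.ext ?_)
    ext i j
    change G.1.Adj (t - (i - s)) (t - (j - s)) ↔ G.1.Adj (s + t - i) (s + t - j)
    rw [sub_sub_eq_add_sub, sub_sub_eq_add_sub, add_comm]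
  · intro s t G
    refine Subtype.ext (SimpleGraph.ext ?_)
    ext i j
    change G.1.Adj (s - i - t) (s - j - t) ↔ G.1.Adj (s - t - i) (s - t - j)
    rw [sub_right_comm, sub_right_comm s j]
  · intro s t G
    refine Subtype.ext (SimpleGraph.ext ?_)
    ext i j
    change G.1.Adj (t - (s - i)) (t - (s - j)) ↔ G.1.Adj (i - (s - t)) (j - (s - t))
    rw [sub_sub_eq_add_sub, sub_sub_eq_add_sub, sub_sub_eq_add_sub, sub_sub_eq_add_sub, add_comm t,
      add_comm t]
  · intro G H
    refine exists_congr fun t => or_congr (Iff.symm ?_) (Iff.symm ?_)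
    · rw [Subtype.ext_iff, SimpleGraph.ext_iff, funext_iff, (Equiv.addRight t).surjective.forall]
      refine forall_congr' fun i => ?_
      rw [funext_iff, (Equiv.addRight t).surjective.forall]
      refine forall_congr' fun j => ?_
      change G.1.Adj (i + t - t) (j + t - t) = H.1.Adj (i + t) (j + t) ↔ _
      rw [add_sub_cancel_right, add_sub_cancel_right, eq_iff_iff]
    · rw [Subtype.ext_iff, SimpleGraph.ext_iff, funext_iff, (Equiv.subLeft t).surjective.forall]
      refine forall_congr' fun i => ?_
      rw [funext_iff, (Equiv.subLeft t).surjective.forall]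
      refine forall_congr' fun j => ?_
      change G.1.Adj (t - (t - i)) (t - (t - j)) = H.1.Adj (t - i) (t - j) ↔ _
      rw [sub_sub_cancel, sub_sub_cancel, eq_iff_iff]

end Action

/-- The kernel runs the algorithm; for this purpose the tests on chords were written with Boolean
operations on natural numbers. Division by the order `2 * n` of the dihedral group gives the numbers
of orbits. -/
theorem map_totalInvariantDissections :
    (List.range 12).map (fun k => totalInvariantDissections (k + 3) / (2 * (k + 3))) =
      [1, 2, 3, 9, 20, 75, 262, 1117, 4783, 21971, 102249, 489077] := by
  decide +kernel

theorem proposition2 :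
    (∀ n : ℕ, 3 ≤ n →
      (EmbeddedGraph.countUpToIso n IsType1 : ℤ) = ⌊(((n : ℚ) - 3) ^ 2 + 6) / 12⌋ ∧
      (EmbeddedGraph.countUpToIso n IsType2 : ℤ) = ⌊(((n : ℚ) - 4) ^ 2 + 6) / 12⌋ ∧
      (EmbeddedGraph.countUpToIso n IsType3 : ℤ) = ⌊(((n : ℚ) - 5) ^ 2 + 6) / 12⌋ ∧
      (EmbeddedGraph.countUpToIso n IsType4 : ℚ) =
        1 / 4 * ((((n - 1) % 2 : ℕ) : ℚ) + 3) * 2 ^ ((n - 1) / 2) +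
          1 / (2 * ((n : ℚ) - 1)) *
            ∑ d ∈ (n - 1).divisors, (Nat.totient d : ℚ) * 2 ^ ((n - 1) / d) - 3) ∧
    (∀ (n : ℕ) [NeZero n], 3 ≤ n →
      EmbeddedGraph.countUpToIso n IsType5 = dissectionCount n) ∧
    (List.range 12).map (fun k => EmbeddedGraph.countUpToIso (k + 3) IsType5) =
      [1, 2, 3, 9, 20, 75, 262, 1117, 4783, 21971, 102249, 489077] := by
  refine ⟨fun n hn => ⟨?_, ?_, ?_, countUpToIso_isType4 hn⟩,
    fun n _ hn => countUpToIso_isType5 hn, ?_⟩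
  -- The constants 6, 7, 8 of the three counts are `j + 3` for `j = 3, 4, 5`.
  · rw [countUpToIso_isType1]
    exact_mod_cast card_tripleSetoid (j := 3) hn (by omega)
  · rw [countUpToIso_isType2]
    exact_mod_cast card_tripleSetoid (j := 4) hn (by omega)
  · rw [countUpToIso_isType3]
    exact_mod_cast card_tripleSetoid (j := 5) hn (by omega)
  · rw [← map_totalInvariantDissections]
    refine List.map_congr_left fun k hk => ?_
    rw [List.mem_range] at hk
    rw [countUpToIso_isType5 (by omega), ← dissectionCount_mul (by omega) (by omega),
      Nat.mul_div_cancel _ (by omega)]
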